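/- Let $\mathbb{C}^{m+1}$ carry the Euclidean Hermitian form $\sum_{i=1}^{m+1} z_i\bar w_i$, respectively the indefinite form $(z,w)=\sum_{i=1}^{m} z_i\bar w_i-z_{m+1}\bar w_{m+1}$, with $\langle\,,\rangle$ the real part of the form and $J$ multiplication by $i$. Let $\mathbb{S}^{2m+1}\subset\mathbb{C}^{m+1}$ be the unit sphere, $\mathbb{H}_1^{2m+1}=\{z\in\mathbb{C}^{m+1} : (z,z)=-1\}$ anti-de Sitter space, and $\Pi:\mathbb{H}_1^{2m+1}\to\mathbb{CH}^m$, $\Pi(z)=[z]$, the Hopf fibration onto complex hyperbolic space, whose Kähler metric (of constant holomorphic sectional curvature $-4$) makes $\Pi$ a pseudo-Riemannian submersion. An immersion $\psi$ of an $m$-manifold into $\mathbb{S}^{2m+1}$ or $\mathbb{H}_1^{2m+1}$ is Legendrian if $\langle d\psi(v),J\psi\rangle=0$ for all tangent vectors $v$; an immersion $\Phi$ of an $m$-manifold into $\mathbb{CH}^m$ is Lagrangian if it pulls the Kähler form $\langle J\cdot,\cdot\rangle$ back to $0$. With $H$ the mean curvature vector of the immersion and $\mathrm{div}$ the divergence for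 the induced metric, a Legendrian immersion is called C-minimal, and a Lagrangian immersion H-minimal, if $\mathrm{div}\,JH=0$. Let $n_1,n_2\ge 0$ be integers and $n=n_1+n_2+1$. Let $\psi_1:N_1\to\mathbb{S}^{2n_1+1}\subset\mathbb{C}^{n_1+1}$ and $\psi_2:N_2\to\mathbb{H}_1^{2n_2+1}\subset\mathbb{C}^{n_2+1}$ be C-minimal Legendrian immersions of smooth manifolds $N_1$, $N_2$ of dimensions $n_1$, $n_2$ (with the induced metrics), and let $\rho>0$. Then \[ \Phi_\rho:\mathbb{S}^1\times N_1\times N_2\to\mathbb{CH}^n,\qquad \Phi_\rho(e^{is},p,q)=\big[\big(\sinh\rho\; e^{is\cosh^2\rho}\,\psi_1(p),\ \cosh\rho\; e^{is\sinh^2\rho}\,\psi_2(q)\big)\big] \] is well defined and is an H-minimal Lagrangian immersion. -/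

import Mathlib

open scoped Manifold ContDiff Matrix ComplexConjugate

noncomputable section

/-! ### Linear algebra: trace with respect to a scalar product -/

section Trace

variable {E : Type*} [NormedAddCommGroup E] [NormedSpace ℝ E] [FiniteDimensional ℝ E]
variable {W : Type*} [AddCommGroup W] [Module ℝ W]

/-- The Gram matrix of the bilinear form `g` in a fixed basis of `E`. -/
def gramOf (g : E → E → ℝ) :
    Matrix (Fin (Module.finrank ℝ E)) (Fin (Module.finrank ℝ E)) ℝ :=
  Matrix.of fun i j => g (Module.finBasis ℝ E i) (Module.finBasis ℝ E j)

/-- `tr_g B = ∑ g^{ij} B(b_i, b_j)`, the trace of a bilinear map `B` with respect to a scalar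
product `g` on `E`; it does not depend on the basis `b`. -/
def metricTrace (g : E → E → ℝ) (B : E → E → W) : W :=
  ∑ i, ∑ j, (gramOf g)⁻¹ i j • B (Module.finBasis ℝ E i) (Module.finBasis ℝ E j)

end Trace

/-! ### Derivatives of vector-valued maps on a manifold -/

section Derivatives

variable {E : Type*} [NormedAddCommGroup E] [NormedSpace ℝ E]
variable {H : Type*} [TopologicalSpace H] (I : ModelWithCorners ℝ E H) [I.Boundaryless]
variable {M : Type*} [TopologicalSpace M] [ChartedSpace H M]
variable {V : Type*} [NormedAddCommGroup V] [NormedSpace ℝ V]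

/-- The differential `dF_p(u) ∈ V` of `F : M → V` at `p`, for `u ∈ T_pM = E`
(identified through the preferred chart at `p`). -/
def dMap (F : M → V) (p : M) (u : E) : V := mfderiv I 𝓘(ℝ, V) F p u

/-- The matrix of second partial derivatives of `F : M → V` at `p`, in the preferred chart at `p`,
applied to `u, v ∈ T_pM = E`. (A change of chart adds to it a vector tangent to `F`.) -/
def hessMap (F : M → V) (p : M) (u v : E) : V :=
  fderiv ℝ (fderiv ℝ (F ∘ (extChartAt I p).symm)) (extChartAt I p p) u v

end Derivatives

/-! ### Hermitian forms on complex Euclidean space -/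

/-- The standard Hermitian form `(z, w) = ∑ zᵢ w̄ᵢ` on `ℂ^k`. -/
def hermE {k : ℕ} (z w : Fin k → ℂ) : ℂ := ∑ i, z i * conj (w i)

/-- The indefinite Hermitian form `(z, w) = ∑_{i ≤ n} zᵢ w̄ᵢ - z_{n+1} w̄_{n+1}` on `ℂ^{n+1}`. -/
def hermL {n : ℕ} (z w : Fin (n + 1) → ℂ) : ℂ :=
  ∑ i : Fin n, z i.castSucc * conj (w i.castSucc) - z (Fin.last n) * conj (w (Fin.last n))

/-- Anti-de Sitter space `H₁^{2n+1} = {z ∈ ℂ^{n+1} | (z, z) = -1}`. -/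
def AntiDeSitter (n : ℕ) : Set (Fin (n + 1) → ℂ) := {z | hermL z z = -1}

/-! ### Legendrian immersions into the quadric `(z, z) = κ`, and C-minimality

Here `h` is one of the two Hermitian forms above and `κ = 1` (the unit sphere, `h = hermE`) or
`κ = -1` (anti-de Sitter space, `h = hermL`). The metric of the quadric is the restriction of
`⟨z, w⟩ = Re h(z, w)` and `J` is multiplication by `i`. -/

section Legendrian

variable {E : Type*} [NormedAddCommGroup E] [NormedSpace ℝ E] [FiniteDimensional ℝ E]
variable {H : Type*} [TopologicalSpace H] (I : ModelWithCorners ℝ E H) [I.Boundaryless]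
variable {M : Type*} [TopologicalSpace M] [ChartedSpace H M]
variable {n : ℕ} (h : (Fin (n + 1) → ℂ) → (Fin (n + 1) → ℂ) → ℂ) (κ : ℝ)

/-- `φ` is a Legendrian immersion of the `n`-manifold `M` into the quadric
`{z ∈ ℂ^{n+1} | h(z, z) = κ}`: the pull-back of the Liouville form `Λ_z(v) = ⟨v, J z⟩` vanishes. -/
structure IsLegendrianImmersion (φ : M → Fin (n + 1) → ℂ) : Prop where
  dim_eq : Module.finrank ℝ E = n
  mem : ∀ p, h (φ p) (φ p) = κ
  smooth : ContMDiff I 𝓘(ℝ, Fin (n + 1) → ℂ) ∞ φ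
  immersion : ∀ p, Function.Injective (dMap I φ p)
  legendrian : ∀ p u, (h (dMap I φ p u) (Complex.I • φ p)).re = 0

/-- The metric induced on `M` by `φ`. -/
def quadricInduced (φ : M → Fin (n + 1) → ℂ) (p : M) (u v : E) : ℝ :=
  (h (dMap I φ p u) (dMap I φ p v)).re

/-- The second fundamental form of `φ` in the quadric: the second derivative of `φ` in flat space,
minus its component tangent to `M` and its component along the normal `φ` of the quadric. -/
def quadricSecondFF (φ : M → Fin (n + 1) → ℂ) (p : M) (u v : E) : Fin (n + 1) → ℂ :=
  let X := hessMap I φ p u v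
  X - metricTrace (quadricInduced I h φ p) (fun a b => (h X (dMap I φ p a)).re • dMap I φ p b)
    - (κ * (h X (φ p)).re) • φ p

/-- The mean curvature vector `H = (1/n) tr σ` of `φ` in the quadric. -/
def quadricMeanCurv (φ : M → Fin (n + 1) → ℂ) (p : M) : Fin (n + 1) → ℂ :=
  (n : ℝ)⁻¹ • metricTrace (quadricInduced I h φ p) (quadricSecondFF I h κ φ p)

/-- `div JH`, the divergence on `M` of the tangent vector field `JH`. The Levi-Civita connection
of `M` is the tangential part of the derivative in flat space, so that the divergence is the trace
of `(u, v) ↦ ⟨D_u (JH), dφ(v)⟩`. -/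
def quadricDivJH (φ : M → Fin (n + 1) → ℂ) (p : M) : ℝ :=
  metricTrace (quadricInduced I h φ p) fun u v =>
    (h (dMap I (fun x => Complex.I • quadricMeanCurv I h κ φ x) p u) (dMap I φ p v)).re

/-- A Legendrian immersion is C-minimal (contact minimal) if `div JH = 0`. -/
structure IsCMinimalLegendrian (φ : M → Fin (n + 1) → ℂ) : Prop where
  legendrian_immersion : IsLegendrianImmersion I h κ φ
  div_JH : ∀ p, quadricDivJH I h κ φ p = 0

end Legendrian

/-! ### Complex hyperbolic space -/

/-- Complex hyperbolic space: the complex lines in `ℂ^{n+1}` on which the indefinite Hermitian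
form is negative. -/
def ComplexHyperbolic (n : ℕ) : Type :=
  {ℓ : Projectivization ℂ (Fin (n + 1) → ℂ) // ∀ z ∈ ℓ.submodule, z ≠ 0 → (hermL z z).re < 0}

namespace ComplexHyperbolic

variable {n : ℕ}

lemma hermL_smul (a : ℂ) (z : Fin (n + 1) → ℂ) :
    (hermL (a • z) (a • z)).re = Complex.normSq a * (hermL z z).re := by
  have : hermL (a • z) (a • z) = (Complex.normSq a : ℂ) * hermL z z := by
    simp only [hermL, Pi.smul_apply, smul_eq_mul, map_mul, Complex.normSq_eq_conj_mul_self, mul_sub,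
      Finset.mul_sum]
    congr 1
    · exact Finset.sum_congr rfl fun i _ => by ring
    · ring
  rw [this, Complex.re_ofReal_mul]

lemma hermL_self_re (z : Fin (n + 1) → ℂ) :
    (hermL z z).re = ∑ i : Fin n, Complex.normSq (z i.castSucc)
      - Complex.normSq (z (Fin.last n)) := by
  simp [hermL, Complex.mul_conj]

/-- The line `[z]` spanned by a negative vector. -/
def mk (z : Fin (n + 1) → ℂ) (hz : (hermL z z).re < 0) : ComplexHyperbolic n :=
  ⟨Projectivization.mk ℂ z (by rintro rfl; simp [hermL] at hz), by
    intro w hw hw0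
    rw [Projectivization.submodule_mk, Submodule.mem_span_singleton] at hw
    obtain ⟨a, rfl⟩ := hw
    have ha : a ≠ 0 := by rintro rfl; simp at hw0
    rw [hermL_smul]
    exact mul_neg_of_pos_of_neg (Complex.normSq_pos.2 ha) hz⟩

/-- The Hopf fibration `Π : H₁^{2n+1} → ℂH^n`, `Π(z) = [z]`. -/
def hopf (z : AntiDeSitter n) : ComplexHyperbolic n :=
  mk z.1 (by rw [show hermL z.1 z.1 = -1 from z.2]; simp)

/-- The affine coordinates `zᵢ / z_{n+1}`, `i ≤ n`, of a point `[z]` of `ℂH^n`. They are a global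
holomorphic chart: they identify `ℂH^n` with the open unit ball of `ℂ^n`. Tangent vectors of `ℂH^n`
are represented in this chart, and its complex structure `J` is multiplication by `i`. -/
def affine (x : ComplexHyperbolic n) : Fin n → ℂ :=
  fun i => x.1.rep i.castSucc / x.1.rep (Fin.last n)

lemma mk_affine (z : Fin (n + 1) → ℂ) (hz : (hermL z z).re < 0) :
    (mk z hz).affine = fun i => z i.castSucc / z (Fin.last n) := by
  have hz0 : z ≠ 0 := by rintro rfl; simp [hermL] at hz
  obtain ⟨a, ha⟩ := Projectivization.exists_smul_eq_mk_rep ℂ z hz0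
  funext i
  change (Projectivization.mk ℂ z hz0).rep _ / (Projectivization.mk ℂ z hz0).rep _ = _
  rw [← ha]
  simp only [Units.smul_def, Pi.smul_apply, smul_eq_mul]
  exact mul_div_mul_left _ _ a.ne_zero

lemma rep_neg (x : ComplexHyperbolic n) : (hermL x.1.rep x.1.rep).re < 0 :=
  x.2 _ (by rw [Projectivization.submodule_eq]; exact Submodule.mem_span_singleton_self _)
    x.1.rep_nonzero

lemma last_ne_zero {z : Fin (n + 1) → ℂ} (hz : (hermL z z).re < 0) : z (Fin.last n) ≠ 0 := by
  intro h0
  rw [hermL_self_re, h0, map_zero, sub_zero] at hz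
  exact absurd (Finset.sum_nonneg fun i _ => Complex.normSq_nonneg (z (Fin.castSucc i)))
    (not_le.2 hz)

/-- The affine coordinates are a bijection of `ℂH^n` onto the open unit ball of `ℂ^n`. -/
lemma affine_bijOn : Set.BijOn (affine (n := n)) Set.univ
    {w | ∑ i, Complex.normSq (w i) < 1} := by
  refine ⟨fun x _ => ?_, fun x _ y _ hxy => ?_, fun w hw => ?_⟩
  · have h1 := x.rep_neg
    have h2 := Complex.normSq_pos.2 (last_ne_zero h1)
    rw [hermL_self_re] at h1
    simp only [Set.mem_ofPred_eq, affine, map_div₀, ← Finset.sum_div]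
    rw [div_lt_one h2]
    linarith
  · have hx := last_ne_zero x.rep_neg
    have hy := last_ne_zero y.rep_neg
    apply Subtype.ext
    rw [← x.1.mk_rep, ← y.1.mk_rep, Projectivization.mk_eq_mk_iff']
    refine ⟨x.1.rep (Fin.last n) / y.1.rep (Fin.last n), ?_⟩
    funext i
    refine Fin.lastCases ?_ (fun j => ?_) i
    · simp [hy]
    · have := congrFun hxy j
      simp only [affine] at this
      simp only [Pi.smul_apply, smul_eq_mul]
      field_simp at this ⊢
      linear_combination -this
  · have hz : (hermL (Fin.snoc w 1 : Fin (n + 1) → ℂ) (Fin.snoc w 1)).re < 0 := by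
      rw [hermL_self_re]
      simp only [Fin.snoc_castSucc, Fin.snoc_last, map_one]
      have : ∑ i, Complex.normSq (w i) < 1 := hw
      linarith
    refine ⟨mk _ hz, trivial, ?_⟩
    rw [mk_affine]
    funext i
    simp

/-- The lift `(w, 1)` of the point with affine coordinates `w`. -/
def lift (w : Fin n → ℂ) : Fin (n + 1) → ℂ := Fin.snoc w 1

/-- The horizontal part of `(u, 0)` at `(w, 1)`, that is, the component `(,)`-orthogonal to the
complex line spanned by `(w, 1)`. -/
def horiz (w u : Fin n → ℂ) : Fin (n + 1) → ℂ :=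
  let u' : Fin (n + 1) → ℂ := Fin.snoc u 0
  u' - (hermL u' (lift w) / hermL (lift w) (lift w)) • lift w

/-- The Kähler metric of `ℂH^n` in affine coordinates, at the point `w` of the unit ball: the one
that makes the Hopf fibration a Riemannian submersion. With `r² = -(lift w, lift w)`, the point
`lift w / r` lies on anti-de Sitter space, over `w`, and `horiz w u / r` is the horizontal lift of
`u` there. The holomorphic sectional curvature is `-4`. -/
def metric (w u v : Fin n → ℂ) : ℝ :=
  (hermL (horiz w u) (horiz w v)).re / -(hermL (lift w) (lift w)).re

/-- The Christoffel symbols of the Levi-Civita connection of `metric` at `w`: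
`2 g(Γ(u, v), a) = D_u g(v, a) + D_v g(u, a) - D_a g(u, v)`. -/
def christoffel (w u v : Fin n → ℂ) : Fin n → ℂ :=
  metricTrace (metric w) fun a b =>
    ((fderiv ℝ (fun x => metric x v a) w u + fderiv ℝ (fun x => metric x u a) w v
      - fderiv ℝ (fun x => metric x u v) w a) / 2) • b

end ComplexHyperbolic

/-! ### Lagrangian immersions into complex hyperbolic space, and H-minimality -/

section Lagrangian

open ComplexHyperbolic

variable {E : Type*} [NormedAddCommGroup E] [NormedSpace ℝ E] [FiniteDimensional ℝ E]
variable {H : Type*} [TopologicalSpace H] (I : ModelWithCorners ℝ E H) [I.Boundaryless]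
variable {M : Type*} [TopologicalSpace M] [ChartedSpace H M]
variable {n : ℕ}

/-- `Φ : M → ℂH^n` in the affine chart of `ℂH^n`. -/
def inAffine (Φ : M → ComplexHyperbolic n) (p : M) : Fin n → ℂ := (Φ p).affine

/-- The metric induced on `M` by `Φ`. -/
def chInduced (Φ : M → ComplexHyperbolic n) (p : M) (u v : E) : ℝ :=
  metric (inAffine Φ p) (dMap I (inAffine Φ) p u) (dMap I (inAffine Φ) p v)

/-- `Φ` is a Lagrangian immersion of the `n`-manifold `M` into `ℂH^n`: the pull-back of the Kähler
form `ω(u, v) = ⟨J u, v⟩` vanishes. -/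
structure IsLagrangianImmersion (Φ : M → ComplexHyperbolic n) : Prop where
  dim_eq : Module.finrank ℝ E = n
  smooth : ContMDiff I 𝓘(ℝ, Fin n → ℂ) ∞ (inAffine Φ)
  immersion : ∀ p, Function.Injective (dMap I (inAffine Φ) p)
  lagrangian : ∀ p u v, metric (inAffine Φ p)
    (Complex.I • dMap I (inAffine Φ) p u) (dMap I (inAffine Φ) p v) = 0

/-- The second fundamental form of `Φ`: the second covariant derivative of `Φ`, minus its
component tangent to `M`. -/
def chSecondFF (Φ : M → ComplexHyperbolic n) (p : M) (u v : E) : Fin n → ℂ :=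
  let X := hessMap I (inAffine Φ) p u v
    + christoffel (inAffine Φ p) (dMap I (inAffine Φ) p u) (dMap I (inAffine Φ) p v)
  X - metricTrace (chInduced I Φ p) fun a b =>
    metric (inAffine Φ p) X (dMap I (inAffine Φ) p a) • dMap I (inAffine Φ) p b

/-- The mean curvature vector `H = (1/n) tr σ` of `Φ`. -/
def chMeanCurv (Φ : M → ComplexHyperbolic n) (p : M) : Fin n → ℂ :=
  (n : ℝ)⁻¹ • metricTrace (chInduced I Φ p) (chSecondFF I Φ p)

/-- The covariant derivative `∇_u X` in `ℂH^n` of a vector field `X` along `Φ`. -/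
def chCovDeriv (Φ : M → ComplexHyperbolic n) (X : M → Fin n → ℂ) (p : M) (u : E) : Fin n → ℂ :=
  dMap I X p u + christoffel (inAffine Φ p) (dMap I (inAffine Φ) p u) (X p)

/-- `div JH`, the divergence on `M` of the tangent vector field `JH`. The Levi-Civita connection
of `M` is the tangential part of that of `ℂH^n`, so that the divergence is the trace of
`(u, v) ↦ ⟨∇_u (JH), dΦ(v)⟩`. -/
def chDivJH (Φ : M → ComplexHyperbolic n) (p : M) : ℝ :=
  metricTrace (chInduced I Φ p) fun u v =>
    metric (inAffine Φ p) (chCovDeriv I Φ (fun x => Complex.I • chMeanCurv I Φ x) p u)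
      (dMap I (inAffine Φ) p v)

/-- A Lagrangian immersion is H-minimal (Hamiltonian minimal) if `div JH = 0`. -/
structure IsHMinimalLagrangian (Φ : M → ComplexHyperbolic n) : Prop where
  lagrangian_immersion : IsLagrangianImmersion I Φ
  div_JH : ∀ p, chDivJH I Φ p = 0

end Lagrangian

end

/-! ### Traces in orthonormal bases -/

section TraceAlgebra

variable {E : Type*} [AddCommGroup E] [Module ℝ E]
variable {W : Type*} [AddCommGroup W] [Module ℝ W]

/-! Put A = sinh ρ, C = cosh ρ, so C² = A² + 1. Locally the map lifts to anti-de Sitter space as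
Ψ(s, x, y) = (A e^{iC²s} F₁(x), C e^{iA²s} F₂(y)), where F₁, F₂ are the given immersions read in
charts. The exponents are balanced so that ⟨∂ₛΨ, JΨ⟩ = A²C² − C²A² = 0: the lift is Legendrian. It
need not be periodic in s, but the common phase e^{iA²s} does not change the complex line, and what
remains depends on e^{i(C²−A²)s} = e^{is} only. So the map itself is well defined on the circle, and
smooth there (`append_phase`, `productLift`).

The Hopf fibration is isometric on horizontal vectors (`metric_dAffineProj`), and its covariant
Hessian vanishes on pairs of them (`hessian_affineProj_add_christoffel`). Tangent vectors of a
Legendrian lift are horizontal, so the second fundamental form, JH and div JH downstairs are the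
images of those upstairs (`I_smul_chMeanCurv`, `chDivJH_eq`). It remains to show that local
Legendrian lifts have divergence-free JH (`isHMinimalLagrangian_of_lift`).

For a Legendrian map, −nJH equals the tangent field Σ B(hess(eᵢ,eᵢ), J dF eⱼ) dF eⱼ
(`I_smul_normal_part`, `IsLegendrianOn.I_smul_trace_normal`). This Maslov field involves only first
and second derivatives in flat space, and hypotheses and conclusion are all restated through its
divergence `maslovDiv`.

The metric induced by Ψ is the product A²C² ds² + A² g₁ + C² g₂ (`pullbackForm_twistedProduct`). The
Maslov field of Ψ is k ∂ₛ plus the Maslov fields of the factors scaled by A⁻² and C⁻², with k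
constant (`maslovField_twistedProduct`). The field ∂ₛ is divergence free, so the divergence is A⁻²
and C⁻² times the divergences of the factors, which vanish by C-minimality
(`maslovDiv_twistedProduct`). -/

/-- Bilinearity of an unbundled map. -/
structure IsBilin (f : E → E → W) : Prop where
  add_left : ∀ u u' v, f (u + u') v = f u v + f u' v
  smul_left : ∀ (c : ℝ) u v, f (c • u) v = c • f u v
  add_right : ∀ u v v', f u (v + v') = f u v + f u v'
  smul_right : ∀ (c : ℝ) u v, f u (c • v) = c • f u v

lemma IsBilin.sum_sum {f : E → E → W} (hf : IsBilin f) {ι : Type*} (s t : Finset ι)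
    (c d : ι → ℝ) (e : ι → E) :
    f (∑ i ∈ s, c i • e i) (∑ j ∈ t, d j • e j) =
      ∑ i ∈ s, ∑ j ∈ t, (c i * d j) • f (e i) (e j) := by
  let L : E →ₗ[ℝ] E →ₗ[ℝ] W := LinearMap.mk₂ ℝ f hf.add_left hf.smul_left hf.add_right
    hf.smul_right
  change L _ _ = ∑ i ∈ s, ∑ j ∈ t, (c i * d j) • L (e i) (e j)
  simp only [map_sum, map_smul, LinearMap.sum_apply, LinearMap.smul_apply, Finset.smul_sum,
    smul_smul]
  rw [Finset.sum_comm]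
  simp only [mul_comm]

lemma IsBilin.comp {E' : Type*} [AddCommGroup E'] [Module ℝ E'] {f : E → E → W} (hf : IsBilin f)
    (T : E' →ₗ[ℝ] E) : IsBilin fun u v => f (T u) (T v) := by
  constructor <;> intros <;> simp [hf.add_left, hf.smul_left, hf.add_right, hf.smul_right]

/-- A scalar product on `E`. -/
structure IsScalarProduct (g : E → E → ℝ) : Prop where
  bilin : IsBilin g
  symm : ∀ u v, g u v = g v u
  pos : ∀ u, u ≠ 0 → 0 < g u u

/-- Orthonormality of a basis for an unbundled bilinear form. -/
def IsONBasis {ι : Type*} (g : E → E → ℝ) (e : Module.Basis ι ℝ E) : Prop :=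
  (∀ i, g (e i) (e i) = 1) ∧ ∀ i j, i ≠ j → g (e i) (e j) = 0

lemma IsONBasis.apply {ι : Type*} [DecidableEq ι] {g : E → E → ℝ} {e : Module.Basis ι ℝ E}
    (he : IsONBasis g e) (i j : ι) : g (e i) (e j) = if i = j then 1 else 0 := by
  split_ifs with h
  · rw [h, he.1]
  · exact he.2 i j h

lemma IsScalarProduct.exists_basis [Module.Finite ℝ E] {g : E → E → ℝ} (hg : IsScalarProduct g) :
    ∃ e : Module.Basis (Fin (Module.finrank ℝ E)) ℝ E, IsONBasis g e := by
  let B : LinearMap.BilinForm ℝ E := LinearMap.mk₂ ℝ g hg.bilin.add_left hg.bilin.smul_left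
    hg.bilin.add_right hg.bilin.smul_right
  have hB : LinearMap.IsSymm B := ⟨fun u v => hg.symm u v⟩
  obtain ⟨v, hv⟩ := LinearMap.BilinForm.exists_orthogonal_basis hB
  have hv' : ∀ i j, i ≠ j → B (v i) (v j) = 0 := fun i j hij =>
    LinearMap.isOrthoᵢ_def.1 hv i j hij
  have hpos : ∀ i, 0 < g (v i) (v i) := fun i => hg.pos _ (v.ne_zero i)
  refine ⟨v.isUnitSMul (w := fun i => (√(g (v i) (v i)))⁻¹) fun i =>
    (inv_ne_zero (Real.sqrt_pos.2 (hpos i)).ne').isUnit, fun i => ?_, fun i j hij => ?_⟩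
  · rw [Module.Basis.isUnitSMul_apply, hg.bilin.smul_left, hg.bilin.smul_right]
    have h1 := Real.sqrt_pos.2 (hpos i)
    have h2 := Real.mul_self_sqrt (hpos i).le
    simp only [smul_eq_mul]
    field_simp
    rw [sq, h2]
  · rw [Module.Basis.isUnitSMul_apply, Module.Basis.isUnitSMul_apply, hg.bilin.smul_left,
      hg.bilin.smul_right, show g (v i) (v j) = 0 from hv' i j hij]
    simp

lemma IsONBasis.sum_smul {ι : Type*} [Fintype ι] {g : E → E → ℝ} {e : Module.Basis ι ℝ E}
    (he : IsONBasis g e) (hg : IsBilin g) (u : E) : ∑ i, g u (e i) • e i = u := by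
  classical
  have h : ∀ i, g u (e i) = e.repr u i := by
    intro i
    conv_lhs => rw [← e.sum_repr u]
    have := hg.sum_sum Finset.univ {i} (fun j => e.repr u j) (fun _ => 1) e
    simp only [Finset.sum_singleton, one_smul, mul_one] at this
    rw [this]
    simp [he.apply]
  simp only [h]
  exact e.sum_repr u

end TraceAlgebra

/-! ### Metric traces: change of basis, orthogonal products, rescaling. -/

section MetricTrace

variable {E : Type*} [NormedAddCommGroup E] [NormedSpace ℝ E] [FiniteDimensional ℝ E]
variable {W : Type*} [AddCommGroup W] [Module ℝ W]
variable {W' : Type*} [AddCommGroup W'] [Module ℝ W']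

lemma gramOf_eq {ι : Type*} [Fintype ι] {g : E → E → ℝ} (hg : IsBilin g)
    {e : Module.Basis ι ℝ E} (he : IsONBasis g e) :
    gramOf g = (e.toMatrix (Module.finBasis ℝ E))ᵀ * e.toMatrix (Module.finBasis ℝ E) := by
  classical
  ext i j
  have h := hg.sum_sum Finset.univ Finset.univ (fun k => e.repr (Module.finBasis ℝ E i) k)
    (fun k => e.repr (Module.finBasis ℝ E j) k) e
  simp only [e.sum_repr] at h
  simp [gramOf, h, Matrix.mul_apply, Module.Basis.toMatrix_apply, he.apply]

/-- With P and Q the mutually inverse transition matrices between the fixed basis and the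
orthonormal one, the Gram matrix is PᵀP, so its inverse is QQᵀ. Contracting with QQᵀ is summation
over the orthonormal basis, which makes the trace basis free. -/
lemma gramOf_inv {ι : Type*} [Fintype ι] [DecidableEq ι] {g : E → E → ℝ} (hg : IsBilin g)
    {e : Module.Basis ι ℝ E} (he : IsONBasis g e) :
    gramOf g * ((Module.finBasis ℝ E).toMatrix e * ((Module.finBasis ℝ E).toMatrix e)ᵀ) = 1 := by
  rw [gramOf_eq hg he, Matrix.mul_assoc, ← Matrix.mul_assoc (e.toMatrix _),
    Module.Basis.toMatrix_mul_toMatrix_flip, Matrix.one_mul, ← Matrix.transpose_mul,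
    Module.Basis.toMatrix_mul_toMatrix_flip, Matrix.transpose_one]

/-- The trace is the sum of the diagonal entries in an orthonormal basis. -/
lemma metricTrace_eq_sum {ι : Type*} [Fintype ι] {g : E → E → ℝ} (hg : IsBilin g)
    {e : Module.Basis ι ℝ E} (he : IsONBasis g e) {B : E → E → W} (hB : IsBilin B) :
    metricTrace g B = ∑ i, B (e i) (e i) := by
  classical
  have hinv : (gramOf g)⁻¹ =
      (Module.finBasis ℝ E).toMatrix e * ((Module.finBasis ℝ E).toMatrix e)ᵀ :=
    Matrix.inv_eq_right_inv (gramOf_inv hg he)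
  have h : ∀ k, B (e k) (e k) = ∑ i, ∑ j, ((Module.finBasis ℝ E).repr (e k) i *
      (Module.finBasis ℝ E).repr (e k) j) •
        B (Module.finBasis ℝ E i) (Module.finBasis ℝ E j) := fun k => by
    have h := hB.sum_sum Finset.univ Finset.univ (fun i => (Module.finBasis ℝ E).repr (e k) i)
      (fun i => (Module.finBasis ℝ E).repr (e k) i) (Module.finBasis ℝ E)
    simpa only [Module.Basis.sum_repr] using h
  simp only [metricTrace, hinv, h, Matrix.mul_apply, Matrix.transpose_apply, Finset.sum_smul,
    Module.Basis.toMatrix_apply]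
  rw [Finset.sum_comm' (t' := Finset.univ) (s' := fun _ => Finset.univ) (by simp)]
  simp_rw [Finset.sum_comm (s := Finset.univ (α := ι))]
  rw [Finset.sum_comm]

lemma IsScalarProduct.isUnit_gramOf {g : E → E → ℝ} (hg : IsScalarProduct g) :
    IsUnit (gramOf g).det := by
  classical
  obtain ⟨e, he⟩ := hg.exists_basis
  exact Matrix.isUnit_det_of_right_inverse (gramOf_inv hg.bilin he)

lemma metricTrace_add (g : E → E → ℝ) (B B' : E → E → W) :
    metricTrace g (fun u v => B u v + B' u v) = metricTrace g B + metricTrace g B' := by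
  simp only [metricTrace, smul_add, Finset.sum_add_distrib]

lemma map_metricTrace (L : W →ₗ[ℝ] W') (g : E → E → ℝ) (B : E → E → W) :
    L (metricTrace g B) = metricTrace g fun u v => L (B u v) := by
  simp only [metricTrace, map_sum, map_smul]

lemma metricTrace_smul (c : ℝ) (g : E → E → ℝ) (B : E → E → W) :
    metricTrace g (fun u v => c • B u v) = c • metricTrace g B := by
  simp only [metricTrace, Finset.smul_sum, smul_comm c]

lemma metricTrace_neg (g : E → E → ℝ) (B : E → E → W) :
    metricTrace g (fun u v => - B u v) = - metricTrace g B := by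
  simp only [metricTrace, smul_neg, Finset.sum_neg_distrib]

lemma metricTrace_zero (g : E → E → ℝ) :
    metricTrace g (fun _ _ => (0 : W)) = 0 := by
  simp only [metricTrace, smul_zero, Finset.sum_const_zero]

lemma metricTrace_of_finrank_eq_zero (h : Module.finrank ℝ E = 0) (g : E → E → ℝ)
    (B : E → E → W) : metricTrace g B = 0 := by
  have : IsEmpty (Fin (Module.finrank ℝ E)) := by rw [h]; infer_instance
  simp [metricTrace]

/-- The trace of `g` itself is the dimension. -/
lemma IsScalarProduct.metricTrace_self {g : E → E → ℝ} (hg : IsScalarProduct g) :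
    metricTrace g g = Module.finrank ℝ E := by
  obtain ⟨e, he⟩ := hg.exists_basis
  rw [metricTrace_eq_sum hg.bilin he hg.bilin]
  simp [he.1]

/-- Invariance of the trace under linear isomorphisms. -/
lemma metricTrace_comp_equiv {E' : Type*} [NormedAddCommGroup E'] [NormedSpace ℝ E']
    [FiniteDimensional ℝ E'] {g : E → E → ℝ} (hg : IsScalarProduct g) (T : E' ≃ₗ[ℝ] E)
    {B : E → E → W} (hB : IsBilin B) :
    metricTrace (fun u v => g (T u) (T v)) (fun u v => B (T u) (T v)) = metricTrace g B := by
  obtain ⟨e, he⟩ := hg.exists_basis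
  rw [metricTrace_eq_sum hg.bilin he hB]
  have he' : IsONBasis (fun u v => g (T u) (T v)) (e.map T.symm) := by
    constructor <;> simp [he.1]
    exact he.2
  refine (metricTrace_eq_sum (hg.bilin.comp (T : E' →ₗ[ℝ] E)) he'
    (hB.comp (T : E' →ₗ[ℝ] E))).trans ?_
  simp

/-- Expansion of a linear map along the trace. -/
lemma IsScalarProduct.metricTrace_expand {g : E → E → ℝ} (hg : IsScalarProduct g)
    (L : E →ₗ[ℝ] W) (u : E) : metricTrace g (fun a b => g u a • L b) = L u := by
  obtain ⟨e, he⟩ := hg.exists_basis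
  rw [metricTrace_eq_sum hg.bilin he]
  · conv_rhs => rw [← he.sum_smul hg.bilin u]
    simp
  · constructor <;> intros <;>
      simp [hg.bilin.add_right, hg.bilin.smul_right, add_smul, smul_smul, mul_comm]

/-- The trace for an orthogonal product metric. -/
lemma metricTrace_prod {E₁ E₂ : Type*} [NormedAddCommGroup E₁] [NormedSpace ℝ E₁]
    [FiniteDimensional ℝ E₁] [NormedAddCommGroup E₂] [NormedSpace ℝ E₂] [FiniteDimensional ℝ E₂]
    {g : E₁ × E₂ → E₁ × E₂ → ℝ} {g₁ : E₁ → E₁ → ℝ} {g₂ : E₂ → E₂ → ℝ}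
    (hg₁ : IsScalarProduct g₁) (hg₂ : IsScalarProduct g₂)
    (hg : ∀ u v, g u v = g₁ u.1 v.1 + g₂ u.2 v.2)
    {B : E₁ × E₂ → E₁ × E₂ → W} (hB : IsBilin B) :
    metricTrace g B = metricTrace g₁ (fun u v => B (u, 0) (v, 0))
      + metricTrace g₂ (fun u v => B (0, u) (0, v)) := by
  obtain ⟨e₁, he₁⟩ := hg₁.exists_basis
  obtain ⟨e₂, he₂⟩ := hg₂.exists_basis
  have h10 : ∀ u, g₁ u 0 = 0 := fun u => by simpa using hg₁.bilin.smul_right 0 u 0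
  have h20 : ∀ u, g₂ u 0 = 0 := fun u => by simpa using hg₂.bilin.smul_right 0 u 0
  have h10' : ∀ u, g₁ 0 u = 0 := fun u => by rw [hg₁.symm, h10]
  have h20' : ∀ u, g₂ 0 u = 0 := fun u => by rw [hg₂.symm, h20]
  have hgb : IsBilin g := by
    constructor <;> intros <;>
      simp [hg, hg₁.bilin.add_left, hg₁.bilin.add_right, hg₁.bilin.smul_left, hg₁.bilin.smul_right,
        hg₂.bilin.add_left, hg₂.bilin.add_right, hg₂.bilin.smul_left, hg₂.bilin.smul_right] <;> ring
  have he : IsONBasis g (e₁.prod e₂) := by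
    constructor
    · rintro (i | i) <;> simp [hg, he₁.1, he₂.1, h10, h20]
    · rintro (i | i) (j | j) hij <;> simp [hg, h10, h20, h10', h20']
      · exact he₁.2 _ _ (by simpa using hij)
      · exact he₂.2 _ _ (by simpa using hij)
  have t₁ := metricTrace_eq_sum hg₁.bilin he₁ (hB.comp (LinearMap.inl ℝ E₁ E₂))
  have t₂ := metricTrace_eq_sum hg₂.bilin he₂ (hB.comp (LinearMap.inr ℝ E₁ E₂))
  simp only [LinearMap.inl_apply, LinearMap.inr_apply] at t₁ t₂
  rw [metricTrace_eq_sum hgb he hB, t₁, t₂]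
  simp

/-- The trace for a rescaled metric. -/
lemma metricTrace_rescale {g : E → E → ℝ} {c : ℝ} (hc : c ≠ 0) (B : E → E → W) :
    metricTrace (fun u v => c * g u v) B = c⁻¹ • metricTrace g B := by
  have : gramOf (fun u v => c * g u v) = c • gramOf g := by ext; simp [gramOf]
  have h2 : (c • gramOf g)⁻¹ = c⁻¹ • (gramOf g)⁻¹ := by
    -- No nondegeneracy of `g` is assumed: if the Gram matrix is singular, both inverses are the
    -- default value 0.
    by_cases h : IsUnit (gramOf g).det
    · simpa [Units.smul_def] using Matrix.inv_smul' (gramOf g) (Units.mk0 c hc) h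
    · rw [Matrix.nonsing_inv_apply_not_isUnit _ h, Matrix.nonsing_inv_apply_not_isUnit, smul_zero]
      rw [Matrix.det_smul]
      intro h'
      exact h (isUnit_of_mul_isUnit_right h')
  simp [metricTrace, this, h2, Finset.smul_sum, smul_smul]

/-- The trace on a line. -/
lemma metricTrace_line (e : E) (he : ∀ u : E, ∃ c : ℝ, u = c • e) {g : E → E → ℝ}
    (hg : IsScalarProduct g) (h1 : g e e = 1) {B : E → E → W} (hB : IsBilin B) :
    metricTrace g B = B e e := by
  have he0 : e ≠ 0 := by
    rintro rfl
    have := hg.bilin.smul_right 0 0 0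
    simp [h1] at this
  have hli : LinearIndependent ℝ (fun _ : Unit => e) :=
    (linearIndependent_unique_iff (R := ℝ) (v := fun _ : Unit => e)).2 he0
  have hsp : ⊤ ≤ Submodule.span ℝ (Set.range fun _ : Unit => e) := by
    intro u _
    obtain ⟨c, rfl⟩ := he u
    exact Submodule.smul_mem _ _ (Submodule.subset_span ⟨(), rfl⟩)
  rw [metricTrace_eq_sum hg.bilin (e := Module.Basis.mk hli hsp) _ hB]
  · simp
  · constructor
    · simp [h1]
    · intro i j hij; exact absurd rfl hij

end MetricTrace

/-! ### Legendrian immersions of open subsets of a vector space -/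

noncomputable section Flat

variable {E : Type*} [NormedAddCommGroup E] [NormedSpace ℝ E]
variable {V : Type*} [NormedAddCommGroup V] [NormedSpace ℝ V] [NormedSpace ℂ V]

/-- The real part of a Hermitian form. -/
structure IsHermitianRe (B : V →L[ℝ] V →L[ℝ] ℝ) : Prop where
  symm : ∀ z w, B z w = B w z
  map_I : ∀ z w, B (Complex.I • z) (Complex.I • w) = B z w

namespace IsHermitianRe

variable {B : V →L[ℝ] V →L[ℝ] ℝ} (hB : IsHermitianRe B)
include hB

lemma I_left (z w : V) : B (Complex.I • z) w = - B z (Complex.I • w) := by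
  rw [← hB.map_I z (Complex.I • w), smul_smul, Complex.I_mul_I, neg_one_smul, map_neg, neg_neg]

lemma self_I (z : V) : B z (Complex.I • z) = 0 := by
  have := hB.I_left z z
  rw [hB.symm] at this
  linarith

lemma I_self (z : V) : B (Complex.I • z) z = 0 := by
  rw [hB.symm, hB.self_I]

end IsHermitianRe

lemma fderiv_bilin {F G H : Type*} [NormedAddCommGroup F] [NormedSpace ℝ F]
    [NormedAddCommGroup G] [NormedSpace ℝ G] [NormedAddCommGroup H] [NormedSpace ℝ H]
    (B : F →L[ℝ] G →L[ℝ] H) {f : E → F} {g : E → G} {y : E} (hf : DifferentiableAt ℝ f y)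
    (hg : DifferentiableAt ℝ g y) (u : E) :
    fderiv ℝ (fun x => B (f x) (g x)) y u = B (f y) (fderiv ℝ g y u) + B (fderiv ℝ f y u) (g y) := by
  rw [(B.hasFDerivAt_of_bilinear hf.hasFDerivAt hg.hasFDerivAt).fderiv]
  simp

lemma DifferentiableAt.bilin {F G H : Type*} [NormedAddCommGroup F] [NormedSpace ℝ F]
    [NormedAddCommGroup G] [NormedSpace ℝ G] [NormedAddCommGroup H] [NormedSpace ℝ H]
    (B : F →L[ℝ] G →L[ℝ] H) {f : E → F} {g : E → G} {y : E} (hf : DifferentiableAt ℝ f y)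
    (hg : DifferentiableAt ℝ g y) : DifferentiableAt ℝ (fun x => B (f x) (g x)) y :=
  (B.hasFDerivAt_of_bilinear hf.hasFDerivAt hg.hasFDerivAt).differentiableAt

/-- The pull-back of a bilinear form by the differential of `F`. -/
def pullbackForm (B : V →L[ℝ] V →L[ℝ] ℝ) (F : E → V) (y u v : E) : ℝ :=
  B (fderiv ℝ F y u) (fderiv ℝ F y v)

/-- The second derivative of `F`. -/
def hessian (F : E → V) (y u v : E) : V := fderiv ℝ (fderiv ℝ F) y u v

section Maslov

variable [FiniteDimensional ℝ E]

/-- The tangent field `∑ B(hess(eᵢ, eᵢ), J dF(eⱼ)) dF(eⱼ)`; for a Legendrian `F` this is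
`-n J H`. -/
def maslovField (B : V →L[ℝ] V →L[ℝ] ℝ) (F : E → V) (y : E) : V :=
  metricTrace (pullbackForm B F y) fun u v => metricTrace (pullbackForm B F y) fun a b =>
    B (hessian F y u v) (Complex.I • fderiv ℝ F y a) • fderiv ℝ F y b

/-- The divergence of `maslovField`. -/
def maslovDiv (B : V →L[ℝ] V →L[ℝ] ℝ) (F : E → V) (y : E) : ℝ :=
  metricTrace (pullbackForm B F y) fun u v => B (fderiv ℝ (maslovField B F) y u) (fderiv ℝ F y v)

end Maslov

/-- A Legendrian immersion of the open set `U` into the quadric `B(z, z) = κ`, with positive definite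
induced metric. -/
structure IsLegendrianOn (B : V →L[ℝ] V →L[ℝ] ℝ) (κ : ℝ) (F : E → V) (U : Set E) : Prop where
  isOpen : IsOpen U
  smooth : ContDiffOn ℝ ∞ F U
  mem : ∀ y ∈ U, B (F y) (F y) = κ
  legendrian : ∀ y ∈ U, ∀ u, B (fderiv ℝ F y u) (Complex.I • F y) = 0
  pos : ∀ y ∈ U, ∀ u, u ≠ 0 → 0 < B (fderiv ℝ F y u) (fderiv ℝ F y u)

namespace IsLegendrianOn

variable {B : V →L[ℝ] V →L[ℝ] ℝ} {κ : ℝ} {F : E → V} {U : Set E}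
variable (h : IsLegendrianOn B κ F U) {y : E} (hy : y ∈ U)
include h hy

lemma contDiffAt : ContDiffAt ℝ ∞ F y := h.smooth.contDiffAt (h.isOpen.mem_nhds hy)

lemma contDiffAt_fderiv : ContDiffAt ℝ ∞ (fderiv ℝ F) y :=
  (h.contDiffAt hy).fderiv_right (by simp)

lemma differentiableAt : DifferentiableAt ℝ F y := (h.contDiffAt hy).differentiableAt (by simp)

lemma differentiableAt_fderiv : DifferentiableAt ℝ (fderiv ℝ F) y :=
  (h.contDiffAt_fderiv hy).differentiableAt (by simp)

lemma differentiableAt_fderiv_apply (v : E) : DifferentiableAt ℝ (fun x => fderiv ℝ F x v) y :=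
  (h.differentiableAt_fderiv hy).clm_apply (differentiableAt_const v)

lemma differentiableAt_hessian (u v : E) : DifferentiableAt ℝ (fun x => hessian F x u v) y := by
  have : DifferentiableAt ℝ (fderiv ℝ (fderiv ℝ F)) y :=
    ((h.contDiffAt_fderiv hy).fderiv_right (m := ∞) (by simp)).differentiableAt (by simp)
  exact (this.clm_apply (differentiableAt_const u)).clm_apply (differentiableAt_const v)

lemma fderiv_fderiv_apply (u v : E) :
    fderiv ℝ (fun x => fderiv ℝ F x v) y u = hessian F y u v := by
  rw [fderiv_clm_apply (h.differentiableAt_fderiv hy) (differentiableAt_const v)]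
  simp [hessian]

lemma hessian_symm (u v : E) : hessian F y u v = hessian F y v u := by
  have := (h.contDiffAt hy).isSymmSndFDerivAt (by
    rw [minSmoothness_of_isRCLikeNormedField]; exact WithTop.coe_le_coe.2 (le_top : (2 : ℕ∞) ≤ ⊤))
  exact this u v

lemma scalarProduct (hB : IsHermitianRe B) : IsScalarProduct (pullbackForm B F y) where
  bilin := by constructor <;> intros <;> simp [pullbackForm]
  symm u v := hB.symm _ _
  pos u hu := h.pos y hy u hu

lemma tangent (hB : IsHermitianRe B) (u : E) : B (fderiv ℝ F y u) (F y) = 0 := by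
  have h1 : (fun x => B (F x) (F x)) =ᶠ[nhds y] fun _ => κ := by
    filter_upwards [h.isOpen.mem_nhds hy] with x hx using h.mem x hx
  have h2 := h1.fderiv_eq (𝕜 := ℝ)
  have h3 := fderiv_bilin B (h.differentiableAt hy) (h.differentiableAt hy) u
  rw [h2, hB.symm (F y)] at h3
  simp at h3
  linarith

/-- Differentiate B(dF v, F) = 0. Traced, this gives B(tr hess, F) = −dim, the source of the
constant coefficient of ∂ₛ in the twisted product. -/
lemma hessian_radial (hB : IsHermitianRe B) (u v : E) :
    B (hessian F y u v) (F y) = - pullbackForm B F y u v := by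
  have h1 : (fun x => B (fderiv ℝ F x v) (F x)) =ᶠ[nhds y] fun _ => 0 := by
    filter_upwards [h.isOpen.mem_nhds hy] with x hx using h.tangent hx hB v
  have h3 := fderiv_bilin B (h.differentiableAt_fderiv_apply hy v) (h.differentiableAt hy) u
  rw [h1.fderiv_eq, h.fderiv_fderiv_apply hy] at h3
  simp at h3
  rw [pullbackForm, hB.symm (fderiv ℝ F y u)]
  linarith

/-- This is the derivative of the Legendrian condition B(dF v, JF) = 0 in the direction u. -/
lemma lagrangian_aux [IsScalarTower ℝ ℂ V] (u v : E) :
    B (hessian F y u v) (Complex.I • F y) =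
      - B (fderiv ℝ F y v) (Complex.I • fderiv ℝ F y u) := by
  have h1 : (fun x => B (fderiv ℝ F x v) (Complex.I • F x)) =ᶠ[nhds y] fun _ => 0 := by
    filter_upwards [h.isOpen.mem_nhds hy] with x hx using h.legendrian x hx v
  have h3 := fderiv_bilin B (h.differentiableAt_fderiv_apply hy v)
    ((h.differentiableAt hy).const_smul Complex.I) u
  simp only [Pi.smul_def] at h3
  rw [h1.fderiv_eq, h.fderiv_fderiv_apply hy,
    show fderiv ℝ (fun x => Complex.I • F x) y = _ from
      fderiv_const_smul (h.differentiableAt hy) Complex.I] at h3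
  simp at h3
  linarith

/-- In `lagrangian_aux` the left side is symmetric in u, v because second derivatives commute, while
B(·, J·) is skew. Both sides therefore vanish: the tangent spaces of a Legendrian map are isotropic.
-/
lemma lagrangian [IsScalarTower ℝ ℂ V] (hB : IsHermitianRe B) (u v : E) :
    B (fderiv ℝ F y u) (Complex.I • fderiv ℝ F y v) = 0 := by
  have h1 := h.lagrangian_aux hy u v
  have h2 := h.lagrangian_aux hy v u
  rw [h.hessian_symm hy, h2, hB.symm (fderiv ℝ F y v), hB.I_left] at h1
  linarith

/-- The Hessian has no component along the Reeb direction JF. The normal part in the quadric thus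
lies in J dF(E), and J turns it into a tangent vector. -/
lemma hessian_reeb [IsScalarTower ℝ ℂ V] (hB : IsHermitianRe B) (u v : E) :
    B (hessian F y u v) (Complex.I • F y) = 0 := by
  rw [h.lagrangian_aux hy, h.lagrangian hy hB, neg_zero]

end IsLegendrianOn

/-! ### Differentiability of traces and of the Maslov field in the base point. -/

section Smooth

variable [FiniteDimensional ℝ E]
variable {W : Type*} [NormedAddCommGroup W] [NormedSpace ℝ W]

lemma differentiableAt_matrix_det {X ι : Type*} [NormedAddCommGroup X] [NormedSpace ℝ X] [Fintype ι]
    [DecidableEq ι] {A : X → Matrix ι ι ℝ} {y : X}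
    (hA : ∀ i j, DifferentiableAt ℝ (fun x => A x i j) y) :
    DifferentiableAt ℝ (fun x => (A x).det) y := by
  simp only [Matrix.det_apply]
  fun_prop

/-- Cramer's rule: the entries of the inverse are quotients of determinants in the entries. -/
lemma differentiableAt_matrix_inv {X ι : Type*} [NormedAddCommGroup X] [NormedSpace ℝ X] [Fintype ι]
    [DecidableEq ι] {A : X → Matrix ι ι ℝ} {y : X}
    (hA : ∀ i j, DifferentiableAt ℝ (fun x => A x i j) y) (hu : IsUnit (A y).det) (i j : ι) :
    DifferentiableAt ℝ (fun x => (A x)⁻¹ i j) y := by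
  simp only [Matrix.inv_def, Matrix.smul_apply, Ring.inverse_eq_inv', smul_eq_mul]
  refine ((differentiableAt_matrix_det hA).inv hu.ne_zero).mul ?_
  simp only [Matrix.adjugate_apply]
  refine differentiableAt_matrix_det fun k l => ?_
  simp only [Matrix.updateRow_apply]
  split_ifs
  · exact differentiableAt_const _
  · exact hA k l

/-- The trace is written in one fixed basis of E, so no differentiable choice of orthonormal frames
is needed; positivity at the single point `y` makes the Gram determinant nonzero there. -/
lemma differentiableAt_metricTrace {X : Type*} [NormedAddCommGroup X] [NormedSpace ℝ X]
    {g : X → E → E → ℝ} {B : X → E → E → W} {y : X}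
    (hy : IsScalarProduct (g y)) (hg : ∀ u v, DifferentiableAt ℝ (fun x => g x u v) y)
    (hB : ∀ u v, DifferentiableAt ℝ (fun x => B x u v) y) :
    DifferentiableAt ℝ (fun x => metricTrace (g x) (B x)) y := by
  unfold metricTrace
  refine .fun_sum fun i _ => .fun_sum fun j _ => .smul ?_ (hB _ _)
  exact differentiableAt_matrix_inv (A := fun x => gramOf (g x)) (fun i j => hg _ _)
    hy.isUnit_gramOf i j

omit [FiniteDimensional ℝ E] in
lemma IsLegendrianOn.differentiableAt_pullbackForm {B : V →L[ℝ] V →L[ℝ] ℝ} {κ : ℝ} {F : E → V}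
    {U : Set E} (h : IsLegendrianOn B κ F U) {y : E} (hy : y ∈ U) (u v : E) :
    DifferentiableAt ℝ (fun x => pullbackForm B F x u v) y :=
  .bilin B (h.differentiableAt_fderiv_apply hy u) (h.differentiableAt_fderiv_apply hy v)

lemma IsLegendrianOn.differentiableAt_maslovField [IsScalarTower ℝ ℂ V] {B : V →L[ℝ] V →L[ℝ] ℝ} (hB : IsHermitianRe B)
    {κ : ℝ} {F : E → V}
    {U : Set E} (h : IsLegendrianOn B κ F U) {y : E} (hy : y ∈ U) :
    DifferentiableAt ℝ (maslovField B F) y := by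
  refine differentiableAt_metricTrace (h.scalarProduct hy hB)
    (h.differentiableAt_pullbackForm hy) fun u v => ?_
  refine differentiableAt_metricTrace (h.scalarProduct hy hB)
    (h.differentiableAt_pullbackForm hy) fun a b => ?_
  exact (DifferentiableAt.bilin B (h.differentiableAt_hessian hy u v)
    ((h.differentiableAt_fderiv_apply hy a).const_smul Complex.I)).smul
    (h.differentiableAt_fderiv_apply hy b)

end Smooth

/-! ### The mean curvature vector -/

/-- The dimension count behind the decomposition of `V` into the tangent space, its image by `J` and
the complex line of the position vector. -/
lemma exists_legendrian_decomposition [IsScalarTower ℝ ℂ V] [FiniteDimensional ℝ E] [FiniteDimensional ℝ V]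
    {B : V →L[ℝ] V →L[ℝ] ℝ} (hB : IsHermitianRe B)
    (hdim : Module.finrank ℝ V = 2 * (Module.finrank ℝ E + 1)) {κ : ℝ} (hκ : κ ≠ 0)
    (d : E →ₗ[ℝ] V) {z : V} (hz : B z z = κ) (ht : ∀ u, B (d u) z = 0)
    (hl : ∀ u, B (d u) (Complex.I • z) = 0) (hL : ∀ u v, B (d u) (Complex.I • d v) = 0)
    (hpos : ∀ u, u ≠ 0 → 0 < B (d u) (d u)) (X : V) :
    ∃ (s t : ℝ) (u v : E), X = s • z + t • Complex.I • z + d u + Complex.I • d v := by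
  let JL : V →ₗ[ℝ] V := ⟨⟨fun v => Complex.I • v, fun _ _ => smul_add _ _ _⟩,
    fun c v => smul_comm _ _ _⟩
  let L : (ℝ × ℝ) × (E × E) →ₗ[ℝ] V :=
    ((LinearMap.toSpanSingleton ℝ V z).coprod (LinearMap.toSpanSingleton ℝ V (Complex.I • z))).coprod
      (d.coprod (JL ∘ₗ d))
  have hLap : ∀ s t u v, L ((s, t), (u, v)) = s • z + t • Complex.I • z + d u + Complex.I • d v := by
    intro s t u v
    simp [L, JL, add_assoc]
  have hinj : Function.Injective L := by
    rw [← LinearMap.ker_eq_bot, LinearMap.ker_eq_bot']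
    rintro ⟨⟨s, t⟩, ⟨u, v⟩⟩ h0
    rw [hLap] at h0
    -- The four summands are mutually B-orthogonal, so pairing the relation with z, Jz, du and J dv
    -- isolates one each. The complex line is handled by κ ≠ 0, the other two by positivity on the
    -- image of d, as B itself may be indefinite.
    have e1 := congrArg (fun X => B X z) h0
    have e2 := congrArg (fun X => B X (Complex.I • z)) h0
    have e3 := congrArg (fun X => B X (d u)) h0
    have e4 := congrArg (fun X => B X (Complex.I • d v)) h0
    have hz' : ∀ u, B z (d u) = 0 := fun u => by rw [hB.symm, ht]
    have hz'' : ∀ u, B z (Complex.I • d u) = 0 := fun u => by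
      have := hB.I_left z (d u); rw [hB.symm, hl] at this; linarith
    have hL' : ∀ u v, B (Complex.I • d u) (d v) = 0 := fun u v => by rw [hB.symm, hL]
    have hIz : ∀ u, B (Complex.I • z) (d u) = 0 := fun u => by rw [hB.symm, hl]
    have hIz' : ∀ u, B (Complex.I • d u) z = 0 := fun u => by rw [hB.symm, hz'']
    simp only [map_add, map_smul, add_apply, smul_apply,
      hz, ht, hl, hL, hB.self_I, hB.I_self, hB.map_I, map_zero, zero_apply,
      smul_eq_mul, hz', hz'', hL', hIz, hIz', mul_zero, add_zero, zero_add] at e1 e2 e3 e4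
    have hs : s = 0 := by simpa [hκ] using e1
    have ht : t = 0 := by simpa [hκ] using e2
    have hu : u = 0 := by
      by_contra hu
      exact (hpos u hu).ne' e3
    have hv : v = 0 := by
      by_contra hv
      exact (hpos v hv).ne' e4
    simp [hs, ht, hu, hv]
  have hsurj : Function.Surjective L := by
    refine (LinearMap.injective_iff_surjective_of_finrank_eq_finrank ?_).1 hinj
    simp [hdim]
    ring
  obtain ⟨⟨⟨s, t⟩, ⟨u, v⟩⟩, h⟩ := hsurj X
  exact ⟨s, t, u, v, by rw [← h, hLap]⟩

/-- `J` of the normal part of a vector orthogonal to `J z`. -/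
lemma I_smul_normal_part [IsScalarTower ℝ ℂ V] [FiniteDimensional ℝ E] [FiniteDimensional ℝ V]
    {B : V →L[ℝ] V →L[ℝ] ℝ} (hB : IsHermitianRe B)
    (hdim : Module.finrank ℝ V = 2 * (Module.finrank ℝ E + 1)) {κ : ℝ} (hκ : κ * κ = 1)
    (d : E →ₗ[ℝ] V) {z : V} (hz : B z z = κ) (ht : ∀ u, B (d u) z = 0)
    (hl : ∀ u, B (d u) (Complex.I • z) = 0) (hL : ∀ u v, B (d u) (Complex.I • d v) = 0)
    (hpos : ∀ u, u ≠ 0 → 0 < B (d u) (d u)) (X : V) (hX : B X (Complex.I • z) = 0) :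
    Complex.I • (X - metricTrace (fun u v => B (d u) (d v)) (fun a b => B X (d a) • d b)
        - (κ * B X z) • z) =
      - metricTrace (fun u v => B (d u) (d v)) fun a b => B X (Complex.I • d a) • d b := by
  have hκ0 : κ ≠ 0 := by rintro rfl; simp at hκ
  obtain ⟨s, t, u, v, rfl⟩ := exists_legendrian_decomposition hB hdim hκ0 d hz ht hl hL hpos X
  have hg : IsScalarProduct fun u v => B (d u) (d v) :=
    { bilin := by constructor <;> intros <;> simp
      symm := fun u v => hB.symm _ _
      pos := hpos }
  have hz' : ∀ u, B z (d u) = 0 := fun u => by rw [hB.symm, ht]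
  have hz'' : ∀ u, B z (Complex.I • d u) = 0 := fun u => by
    have := hB.I_left z (d u); rw [hB.symm, hl] at this; linarith
  have hL' : ∀ u v, B (Complex.I • d u) (d v) = 0 := fun u v => by rw [hB.symm, hL]
  have hIz : ∀ u, B (Complex.I • z) (d u) = 0 := fun u => by rw [hB.symm, hl]
  have hIz' : ∀ u, B (Complex.I • d u) z = 0 := fun u => by rw [hB.symm, hz'']
  simp only [map_add, map_smul, add_apply, smul_apply,
    hz, ht, hl, hL, hB.self_I, hB.I_self, hB.map_I, smul_eq_mul, hz', hz'', hL', hIz, hIz',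
    mul_zero, add_zero, zero_add] at hX ⊢
  -- For X = s z + t Jz + du + J dv, orthogonality to Jz kills t, the tangential trace removes du,
  -- and the radial term removes s z because κ² = 1. What is left is J(J dv) = −dv, and the trace on
  -- the right reconstructs dv.
  have ht0 : t = 0 := by simpa [hκ0] using hX
  have hs : κ * (s * κ) = s := by linear_combination s * hκ
  rw [hg.metricTrace_expand d u, hg.metricTrace_expand d v, ht0, hs, zero_smul]
  rw [show s • z + 0 + d u + Complex.I • d v - d u - s • z = Complex.I • d v by abel, smul_smul,
    Complex.I_mul_I, neg_one_smul]

end Flat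

/-! ### Derivatives in charts -/

section Charts

variable {E : Type*} [NormedAddCommGroup E] [NormedSpace ℝ E]
variable {V : Type*} [NormedAddCommGroup V] [NormedSpace ℝ V]

lemma fderiv_comp_apply {F : Type*} [NormedAddCommGroup F] [NormedSpace ℝ F] {G : E → V} {τ : F → E}
    {a : F} (hG : DifferentiableAt ℝ G (τ a)) (hτ : DifferentiableAt ℝ τ a) (u : F) :
    fderiv ℝ (G ∘ τ) a u = fderiv ℝ G (τ a) (fderiv ℝ τ a u) := by
  rw [fderiv_comp a hG hτ]; rfl

/-- The second derivative of a composition. -/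
lemma hessian_comp {F : Type*} [NormedAddCommGroup F] [NormedSpace ℝ F] {G : E → V} {τ : F → E}
    {a : F} (hG : ContDiffAt ℝ ∞ G (τ a)) (hτ : ContDiffAt ℝ ∞ τ a) (u v : F) :
    hessian (G ∘ τ) a u v = hessian G (τ a) (fderiv ℝ τ a u) (fderiv ℝ τ a v)
      + fderiv ℝ G (τ a) (hessian τ a u v) := by
  have h1 : fderiv ℝ (G ∘ τ) =ᶠ[nhds a] fun x => (fderiv ℝ G (τ x)).comp (fderiv ℝ τ x) := by
    have e1 := hτ.continuousAt.eventually (hG.of_le (m := 1) (by norm_cast) |>.eventually (by simp))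
    have e2 := (hτ.of_le (m := 1) (by norm_cast)).eventually (by simp)
    filter_upwards [e1, e2] with x hx1 hx2
    exact fderiv_comp x (hx1.differentiableAt (by simp)) (hx2.differentiableAt (by simp))
  have dG : DifferentiableAt ℝ (fderiv ℝ G) (τ a) :=
    (hG.fderiv_right (m := ∞) (by simp)).differentiableAt (by simp)
  have dτ : DifferentiableAt ℝ (fderiv ℝ τ) a :=
    (hτ.fderiv_right (m := ∞) (by simp)).differentiableAt (by simp)
  have dτ0 : DifferentiableAt ℝ τ a := hτ.differentiableAt (by simp)
  have h2 : HasFDerivAt (fun x => fderiv ℝ G (τ x)) _ a := dG.hasFDerivAt.comp a dτ0.hasFDerivAt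
  rw [hessian, h1.fderiv_eq, (h2.clm_comp dτ.hasFDerivAt).fderiv]
  simp [hessian, add_comm]

variable {H : Type*} [TopologicalSpace H] (I : ModelWithCorners ℝ E H) [I.Boundaryless]
variable {M : Type*} [TopologicalSpace M] [ChartedSpace H M]

lemma dMap_eq_fderiv {f : M → V} {x : M} (hf : MDifferentiableAt I 𝓘(ℝ, V) f x) (u : E) :
    dMap I f x u = fderiv ℝ (f ∘ (extChartAt I x).symm) (extChartAt I x x) u := by
  have h : (mfderiv I 𝓘(ℝ, V) f x : E →L[ℝ] V) =
      fderivWithin ℝ (f ∘ (extChartAt I x).symm) (Set.range I) (extChartAt I x x) := hf.mfderiv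
  rw [I.range_eq_univ, fderivWithin_univ] at h
  exact congrArg (fun L : E →L[ℝ] V => L u) h

/-- The manifold derivative is 0 by default at a point of non-differentiability, so fields such as
JH, known only through a chart formula, need this before their derivative can be computed. -/
lemma mdifferentiableAt_of_chart {f : M → V} {x : M}
    (hf : DifferentiableAt ℝ (f ∘ (extChartAt I x).symm) (extChartAt I x x)) :
    MDifferentiableAt I 𝓘(ℝ, V) f x := by
  rw [mdifferentiableAt_iff]
  refine ⟨?_, ?_⟩
  · have h1 : ContinuousAt ((f ∘ (extChartAt I x).symm) ∘ extChartAt I x) x :=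
      hf.continuousAt.comp (continuousAt_extChartAt x)
    refine h1.congr ?_
    filter_upwards [extChartAt_source_mem_nhds (I := I) x] with z hz
    simp only [Function.comp, (extChartAt I x).left_inv hz]
  · rw [I.range_eq_univ, differentiableWithinAt_univ]
    exact hf

variable [IsManifold I ∞ M]

omit [I.Boundaryless] in
lemma contDiffOn_comp_chart_symm {f : M → V} (hf : ContMDiff I 𝓘(ℝ, V) ∞ f) (p : M) :
    ContDiffOn ℝ ∞ (f ∘ (extChartAt I p).symm) (extChartAt I p).target := by
  rw [← contMDiffOn_iff_contDiffOn]
  exact hf.comp_contMDiffOn (contMDiffOn_extChartAt_symm p)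

/-- `dMap` and `hessMap` at a point use the preferred chart of that very point, whereas
differentiating a field requires one chart for all nearby points. T is the differential of the
transition map and S its second derivative. Both are independent of f, and the S-term is tangent to
f. -/
lemma exists_coord_change (p : M) {y : E} (hy : y ∈ (extChartAt I p).target) :
    ∃ (T : E ≃ₗ[ℝ] E) (S : E → E → E), ∀ f : M → V, ContMDiff I 𝓘(ℝ, V) ∞ f →
      (∀ u, dMap I f ((extChartAt I p).symm y) u = fderiv ℝ (f ∘ (extChartAt I p).symm) y (T u)) ∧
      ∀ u v, hessMap I f ((extChartAt I p).symm y) u v =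
        hessian (f ∘ (extChartAt I p).symm) y (T u) (T v) +
          fderiv ℝ (f ∘ (extChartAt I p).symm) y (S u v) := by
  set x := (extChartAt I p).symm y with hx
  have hxp : x ∈ (extChartAt I p).source := (extChartAt I p).map_target hy
  have hxx : x ∈ (extChartAt I x).source := mem_extChartAt_source x
  set a := extChartAt I x x with ha
  set τ := extChartAt I p ∘ (extChartAt I x).symm with hτ
  set τ' := extChartAt I x ∘ (extChartAt I p).symm with hτ'
  have hax : (extChartAt I x).symm a = x := (extChartAt I x).left_inv hxx
  have hτa : τ a = y := by
    simp only [hτ, Function.comp, hax]; exact (extChartAt I p).right_inv hy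
  have sτ : ContDiffAt ℝ ∞ τ a := by
    have := contDiffWithinAt_ext_coord_change (I := I) (n := ∞) p x (y := a) (by
      rw [PartialEquiv.trans_source]
      refine ⟨mem_extChartAt_target x, ?_⟩
      rw [Set.mem_preimage, hax]; exact hxp)
    rwa [I.range_eq_univ, contDiffWithinAt_univ] at this
  have sτ' : ContDiffAt ℝ ∞ τ' y := by
    have := contDiffWithinAt_ext_coord_change (I := I) (n := ∞) x p (y := y) (by
      rw [PartialEquiv.trans_source]
      exact ⟨hy, hxx⟩)
    rwa [I.range_eq_univ, contDiffWithinAt_univ] at this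
  have c1 : ∀ᶠ b in nhds a, (extChartAt I x).symm b ∈ (extChartAt I p).source := by
    have : ContinuousAt (extChartAt I x).symm a := continuousAt_extChartAt_symm x
    refine this.eventually ?_
    rw [hax]
    exact (isOpen_extChartAt_source p).mem_nhds hxp
  have c2 : ∀ᶠ b in nhds a, b ∈ (extChartAt I x).target := extChartAt_target_mem_nhds x
  have c3 : ∀ᶠ b in nhds y, (extChartAt I p).symm b ∈ (extChartAt I x).source := by
    have : ContinuousAt (extChartAt I p).symm y := continuousAt_extChartAt_symm'' hy
    exact this.eventually ((isOpen_extChartAt_source x).mem_nhds hxx)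
  have c4 : ∀ᶠ b in nhds y, b ∈ (extChartAt I p).target := (isOpen_extChartAt_target p).mem_nhds hy
  have i1 : τ' ∘ τ =ᶠ[nhds a] id := by
    filter_upwards [c1, c2] with b h1 h2
    simp only [hτ, hτ', Function.comp, id, (extChartAt I p).left_inv h1, (extChartAt I x).right_inv h2]
  have i2 : τ ∘ τ' =ᶠ[nhds y] id := by
    filter_upwards [c3, c4] with b h1 h2
    simp only [hτ, hτ', Function.comp, id, (extChartAt I x).left_inv h1, (extChartAt I p).right_inv h2]
  have hτy : τ' y = a := rfl
  have j1 : ∀ u, fderiv ℝ τ' y (fderiv ℝ τ a u) = u := fun u => by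
    have := fderiv_comp_apply (G := τ') (τ := τ) (a := a)
      (by rw [hτa]; exact sτ'.differentiableAt (by simp)) (sτ.differentiableAt (by simp)) u
    rw [i1.fderiv_eq, hτa] at this
    simpa using this.symm
  have j2 : ∀ u, fderiv ℝ τ a (fderiv ℝ τ' y u) = u := fun u => by
    have := fderiv_comp_apply (G := τ) (τ := τ') (a := y)
      (by rw [hτy]; exact sτ.differentiableAt (by simp)) (sτ'.differentiableAt (by simp)) u
    rw [i2.fderiv_eq, hτy] at this
    simpa using this.symm
  refine ⟨LinearEquiv.ofLinearMap (fderiv ℝ τ a : E →ₗ[ℝ] E) (fderiv ℝ τ' y : E →ₗ[ℝ] E)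
    (LinearMap.ext j2) (LinearMap.ext j1), hessian τ a, fun f hf => ?_⟩
  have sF : ContDiffAt ℝ ∞ (f ∘ (extChartAt I p).symm) (τ a) := by
    rw [hτa]
    exact (contDiffOn_comp_chart_symm I hf p).contDiffAt ((isOpen_extChartAt_target p).mem_nhds hy)
  have k : f ∘ (extChartAt I x).symm =ᶠ[nhds a] (f ∘ (extChartAt I p).symm) ∘ τ := by
    filter_upwards [c1] with b h1
    simp only [hτ, Function.comp, (extChartAt I p).left_inv h1]
  constructor
  · intro u
    rw [dMap_eq_fderiv I ((hf x).mdifferentiableAt (by simp)), ← ha, k.fderiv_eq,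
      fderiv_comp_apply (sF.differentiableAt (by simp)) (sτ.differentiableAt (by simp)), hτa]
    rfl
  · intro u v
    rw [hessMap, ← ha, (k.fderiv (𝕜 := ℝ)).fderiv_eq]
    have := hessian_comp sF sτ u v
    rw [hτa] at this
    exact this

end Charts

/-! ### C-minimality in a chart -/

noncomputable section QuadricCharts

/-! ### The Maslov field as a trace, and its independence of charts. -/

section NormalTrace

variable {E : Type*} [NormedAddCommGroup E] [NormedSpace ℝ E] [FiniteDimensional ℝ E]
variable {V : Type*} [NormedAddCommGroup V] [NormedSpace ℝ V] [NormedSpace ℂ V]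

/-- Multiplication by `i` as a real linear map. -/
def mulI (V : Type*) [NormedAddCommGroup V] [NormedSpace ℝ V] [NormedSpace ℂ V]
    [SMulCommClass ℂ ℝ V] : V →ₗ[ℝ] V where
  toFun v := Complex.I • v
  map_add' := smul_add _
  map_smul' _ _ := smul_comm _ _ _

/-- The map `X ↦ ∑ B(X, J d eᵢ) d eᵢ`. -/
def normalTrace (B : V →L[ℝ] V →L[ℝ] ℝ) (d : E →ₗ[ℝ] V) : V →ₗ[ℝ] V where
  toFun X := metricTrace (fun u v => B (d u) (d v)) fun a b => B X (Complex.I • d a) • d b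
  map_add' X Y := by
    rw [← metricTrace_add]
    simp only [map_add, add_apply, add_smul]
  map_smul' c X := by
    rw [← metricTrace_smul]
    simp only [map_smul, smul_apply, smul_smul, smul_eq_mul, RingHom.id_apply]

omit [FiniteDimensional ℝ E] in
lemma isBilin_normalTrace [SMulCommClass ℂ ℝ V] (B : V →L[ℝ] V →L[ℝ] ℝ) (d : E →ₗ[ℝ] V) (X : V) :
    IsBilin fun a b => B X (Complex.I • d a) • d b := by
  constructor <;> intros <;> simp [add_smul, smul_smul, smul_comm Complex.I, mul_comm]

lemma maslovField_eq (B : V →L[ℝ] V →L[ℝ] ℝ) (F : E → V) (y : E) :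
    maslovField B F y = metricTrace (pullbackForm B F y) fun u v =>
      normalTrace B (fderiv ℝ F y : E →ₗ[ℝ] V) (hessian F y u v) := rfl

/-- By linearity the Hessian can be traced before it is paired with the tangent space; for a twisted
product the traced Hessian is explicit. -/
lemma maslovField_eq_normalTrace (B : V →L[ℝ] V →L[ℝ] ℝ) (F : E → V) (y : E) :
    maslovField B F y = normalTrace B (fderiv ℝ F y : E →ₗ[ℝ] V)
      (metricTrace (pullbackForm B F y) (hessian F y)) := by
  rw [maslovField_eq]
  exact (map_metricTrace (normalTrace B (fderiv ℝ F y : E →ₗ[ℝ] V)) _ _).symm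

omit [FiniteDimensional ℝ E] in
lemma isScalarProduct_comp {B : V →L[ℝ] V →L[ℝ] ℝ} (hB : IsHermitianRe B) {d : E →ₗ[ℝ] V}
    (hpos : ∀ u, u ≠ 0 → 0 < B (d u) (d u)) : IsScalarProduct fun u v => B (d u) (d v) where
  bilin := by constructor <;> intros <;> simp
  symm _ _ := hB.symm _ _
  pos := hpos

lemma normalTrace_comp_equiv [SMulCommClass ℂ ℝ V] {B : V →L[ℝ] V →L[ℝ] ℝ} (hB : IsHermitianRe B)
    (d : E →ₗ[ℝ] V) (hpos : ∀ u, u ≠ 0 → 0 < B (d u) (d u)) (T : E ≃ₗ[ℝ] E) :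
    normalTrace B (d ∘ₗ (T : E →ₗ[ℝ] E)) = normalTrace B d := by
  ext X
  exact metricTrace_comp_equiv (isScalarProduct_comp hB hpos) T (isBilin_normalTrace B d X)

/-- The Maslov field is orthogonal to the complex line of the position vector. -/
lemma IsLegendrianOn.maslovField_horizontal {B : V →L[ℝ] V →L[ℝ] ℝ} (hB : IsHermitianRe B) {κ : ℝ}
    {F : E → V} {U : Set E} (h : IsLegendrianOn B κ F U) {y : E} (hy : y ∈ U) :
    B (maslovField B F y) (F y) = 0 ∧ B (maslovField B F y) (Complex.I • F y) = 0 := by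
  have key : ∀ X, (∀ u, B (fderiv ℝ F y u) X = 0) → B (maslovField B F y) X = 0 := by
    intro X hX
    change (B.flip X : V →ₗ[ℝ] ℝ) _ = 0
    rw [maslovField, map_metricTrace]
    have : ∀ u v, (B.flip X : V →ₗ[ℝ] ℝ) (metricTrace (pullbackForm B F y) fun a b =>
        B (hessian F y u v) (Complex.I • fderiv ℝ F y a) • fderiv ℝ F y b) = 0 := by
      intro u v
      rw [map_metricTrace]
      simp [hX, metricTrace_zero]
    simp only [this, metricTrace_zero]
  exact ⟨key _ (h.tangent hy hB), key _ (h.legendrian y hy)⟩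

/-- The mean curvature vector of a Legendrian immersion, computed in an arbitrary chart with the
second derivative known up to tangent vectors. -/
lemma IsLegendrianOn.I_smul_trace_normal [IsScalarTower ℝ ℂ V] [FiniteDimensional ℝ V]
    {B : V →L[ℝ] V →L[ℝ] ℝ} (hB : IsHermitianRe B) {κ : ℝ} (hκ : κ * κ = 1)
    (hdim : Module.finrank ℝ V = 2 * (Module.finrank ℝ E + 1)) {F : E → V} {U : Set E}
    (h : IsLegendrianOn B κ F U) {y : E} (hy : y ∈ U) (T : E ≃ₗ[ℝ] E) (S : E → E → E) :
    metricTrace (fun u v => pullbackForm B F y (T u) (T v)) (fun u v =>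
      Complex.I • (hessian F y (T u) (T v) + fderiv ℝ F y (S u v)
        - metricTrace (fun u v => pullbackForm B F y (T u) (T v)) (fun a b =>
          B (hessian F y (T u) (T v) + fderiv ℝ F y (S u v)) (fderiv ℝ F y (T a)) •
            fderiv ℝ F y (T b))
        - (κ * B (hessian F y (T u) (T v) + fderiv ℝ F y (S u v)) (F y)) • F y)) =
      - maslovField B F y := by
  have key : ∀ u v, Complex.I • (hessian F y (T u) (T v) + fderiv ℝ F y (S u v)
        - metricTrace (fun u v => pullbackForm B F y (T u) (T v)) (fun a b =>
          B (hessian F y (T u) (T v) + fderiv ℝ F y (S u v)) (fderiv ℝ F y (T a)) •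
            fderiv ℝ F y (T b))
        - (κ * B (hessian F y (T u) (T v) + fderiv ℝ F y (S u v)) (F y)) • F y) =
      - normalTrace B (fderiv ℝ F y : E →ₗ[ℝ] V) (hessian F y (T u) (T v)) := by
    intro u v
    have h1 := I_smul_normal_part hB hdim hκ ((fderiv ℝ F y : E →ₗ[ℝ] V) ∘ₗ (T : E →ₗ[ℝ] E))
      (h.mem y hy) (fun u => h.tangent hy hB _) (fun u => h.legendrian y hy _)
      (fun u v => h.lagrangian hy hB _ _) (fun u hu => h.pos y hy _ (by simpa using hu))
      (hessian F y (T u) (T v) + fderiv ℝ F y (S u v))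
      (by rw [map_add, add_apply, h.hessian_reeb hy hB, h.legendrian y hy, add_zero])
    refine h1.trans ?_
    have h2 := normalTrace_comp_equiv hB (fderiv ℝ F y : E →ₗ[ℝ] V) (h.pos y hy) T
    -- The term created by the coordinate change is tangent, hence orthogonal to J dF by the
    -- Lagrangian property.
    have h3 : normalTrace B (fderiv ℝ F y : E →ₗ[ℝ] V) (fderiv ℝ F y (S u v)) = 0 := by
      simp [normalTrace, h.lagrangian hy hB, metricTrace_zero]
    change - normalTrace B ((fderiv ℝ F y : E →ₗ[ℝ] V) ∘ₗ (T : E →ₗ[ℝ] E)) _ = _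
    rw [h2, map_add, h3, add_zero]
  simp only [key]
  rw [metricTrace_neg, maslovField_eq]
  congr 1
  exact metricTrace_comp_equiv (h.scalarProduct hy hB) T
    (B := fun u v => normalTrace B (fderiv ℝ F y : E →ₗ[ℝ] V) (hessian F y u v))
    (by constructor <;> intros <;> simp [hessian])

end NormalTrace

/-! ### From Legendrian immersions of manifolds to their chart expressions. -/

section Manifold

variable {E : Type*} [NormedAddCommGroup E] [NormedSpace ℝ E]
variable {H : Type*} [TopologicalSpace H] (I : ModelWithCorners ℝ E H) [I.Boundaryless]
variable {M : Type*} [TopologicalSpace M] [ChartedSpace H M]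

lemma dMap_eq_of_eventuallyEq {W : Type*} [NormedAddCommGroup W] [NormedSpace ℝ W] {X : M → W}
    {p : M} {G : E → W}
    (h : X ∘ (extChartAt I p).symm =ᶠ[nhds (extChartAt I p p)] G)
    (hG : DifferentiableAt ℝ G (extChartAt I p p)) (u : E) :
    dMap I X p u = fderiv ℝ G (extChartAt I p p) u := by
  rw [dMap_eq_fderiv I (mdifferentiableAt_of_chart I (h.differentiableAt_iff.2 hG)), h.fderiv_eq]

variable [IsManifold I ∞ M]

lemma finrank_real_complex_space (k : ℕ) : Module.finrank ℝ (Fin k → ℂ) = 2 * k := by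
  rw [Module.finrank_pi_fintype]
  simp [Complex.finrank_real_complex, mul_comm]

variable {n : ℕ} {h : (Fin (n + 1) → ℂ) → (Fin (n + 1) → ℂ) → ℂ} {κ : ℝ}
  {B : (Fin (n + 1) → ℂ) →L[ℝ] (Fin (n + 1) → ℂ) →L[ℝ] ℝ}
  {φ : M → Fin (n + 1) → ℂ}

/-- Since B may be indefinite, injectivity of the differential does not by itself make the induced
metric definite. Tangent vectors are orthogonal to φ (differentiate the quadric equation) and to Jφ
(Legendrian), and `hpos` supplies positivity on that complement. -/
lemma IsLegendrianImmersion.isLegendrianOn [FiniteDimensional ℝ E] (hB : IsHermitianRe B)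
    (hh : ∀ z w, (h z w).re = B z w)
    (hpos : ∀ z Z, B z z = κ → B Z z = 0 → B Z (Complex.I • z) = 0 → Z ≠ 0 → 0 < B Z Z)
    (hφ : IsLegendrianImmersion I h κ φ) (p : M) :
    IsLegendrianOn B κ (φ ∘ (extChartAt I p).symm) (extChartAt I p).target := by
  have hmem : ∀ y, B ((φ ∘ (extChartAt I p).symm) y) ((φ ∘ (extChartAt I p).symm) y) = κ := by
    intro y
    rw [← hh, Function.comp_apply, hφ.mem]; simp
  have hsm := contDiffOn_comp_chart_symm I hφ.smooth p
  have hd : ∀ y ∈ (extChartAt I p).target, ∀ u, ∃ v,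
      (v = 0 ↔ u = 0) ∧ fderiv ℝ (φ ∘ (extChartAt I p).symm) y u =
        dMap I φ ((extChartAt I p).symm y) v := by
    intro y hy u
    obtain ⟨T, S, hT⟩ := exists_coord_change I (V := Fin (n + 1) → ℂ) p hy
    refine ⟨T.symm u, by simp, ?_⟩
    rw [((hT φ hφ.smooth).1 _)]
    simp
  have hleg : ∀ y ∈ (extChartAt I p).target, ∀ u, B (fderiv ℝ (φ ∘ (extChartAt I p).symm) y u)
      (Complex.I • (φ ∘ (extChartAt I p).symm) y) = 0 := by
    intro y hy u
    obtain ⟨v, -, hv⟩ := hd y hy u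
    rw [hv, ← hh]
    exact hφ.legendrian _ _
  refine ⟨isOpen_extChartAt_target p, hsm, fun y _ => hmem y, hleg, fun y hy u hu => ?_⟩
  have hdiff := (hsm.contDiffAt ((isOpen_extChartAt_target p).mem_nhds hy)).differentiableAt
    (by simp)
  refine hpos _ _ (hmem y) ?_ (hleg y hy u) ?_
  · have h3 := fderiv_bilin B hdiff hdiff u
    rw [funext hmem, hB.symm ((φ ∘ (extChartAt I p).symm) y)] at h3
    rw [fderiv_fun_const, Pi.zero_apply, zero_apply] at h3
    linarith
  · obtain ⟨v, hv0, hv⟩ := hd y hy u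
    rw [hv]
    intro h0
    have h00 : dMap I φ ((extChartAt I p).symm y) 0 = 0 :=
      map_zero (mfderiv I 𝓘(ℝ, Fin (n + 1) → ℂ) φ ((extChartAt I p).symm y))
    exact hu (hv0.1 (hφ.immersion _ (h0.trans h00.symm)))

variable [FiniteDimensional ℝ E]

/-- The divergence of `JH` is, up to a constant, the divergence of the Maslov field in a chart. -/
lemma IsLegendrianImmersion.quadricDivJH_eq (hB : IsHermitianRe B)
    (hκ : κ * κ = 1) (hh : ∀ z w, (h z w).re = B z w)
    (hpos : ∀ z Z, B z z = κ → B Z z = 0 → B Z (Complex.I • z) = 0 → Z ≠ 0 → 0 < B Z Z)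
    (hφ : IsLegendrianImmersion I h κ φ) (p : M) :
    quadricDivJH I h κ φ p =
      -((n : ℝ)⁻¹ * maslovDiv B (φ ∘ (extChartAt I p).symm) (extChartAt I p p)) := by
  have hL := hφ.isLegendrianOn I hB hh hpos p
  set F := φ ∘ (extChartAt I p).symm with hF
  have hdim : Module.finrank ℝ (Fin (n + 1) → ℂ) = 2 * (Module.finrank ℝ E + 1) := by
    rw [finrank_real_complex_space, hφ.dim_eq]
  have hp := mem_extChartAt_target (I := I) p
  -- JH at each nearby point is defined through that point's own chart; here it is expressed
  -- throughout in the single chart at `p`, so that it can be differentiated.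
  have hJH : (fun x => Complex.I • quadricMeanCurv I h κ φ x) ∘ (extChartAt I p).symm
      =ᶠ[nhds (extChartAt I p p)] fun y => -((n : ℝ)⁻¹ • maslovField B F y) := by
    filter_upwards [extChartAt_target_mem_nhds (I := I) p] with y hy
    obtain ⟨T, S, hTS⟩ := exists_coord_change I (V := Fin (n + 1) → ℂ) p hy
    obtain ⟨hT, hS⟩ := hTS φ hφ.smooth
    have hg : quadricInduced I h φ ((extChartAt I p).symm y) =
        fun u v => pullbackForm B F y (T u) (T v) := by
      funext u v
      rw [quadricInduced, hh, hT, hT]; rfl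
    have := hL.I_smul_trace_normal hB hκ hdim hy T S
    rw [← smul_neg, ← this]
    simp only [Function.comp_apply, quadricMeanCurv]
    rw [smul_comm]
    congr 1
    rw [show ∀ X : Fin (n + 1) → ℂ, Complex.I • X = mulI _ X from fun _ => rfl, map_metricTrace, hg]
    congr 1
    funext u v
    simp only [quadricSecondFF, hS, hT, hh, hg]
    rfl
  have hG : DifferentiableAt ℝ (fun y => -((n : ℝ)⁻¹ • maslovField B F y)) (extChartAt I p p) :=
    ((hL.differentiableAt_maslovField hB hp).const_smul (n : ℝ)⁻¹).neg
  have e1 : ∀ u, dMap I φ p u = fderiv ℝ F (extChartAt I p p) u :=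
    dMap_eq_fderiv I ((hφ.smooth p).mdifferentiableAt (by simp))
  have e2 : ∀ u, dMap I (fun x => Complex.I • quadricMeanCurv I h κ φ x) p u =
      -((n : ℝ)⁻¹ • fderiv ℝ (maslovField B F) (extChartAt I p p) u) := by
    intro u
    rw [dMap_eq_of_eventuallyEq I hJH hG, fderiv_fun_neg, fderiv_fun_const_smul
      (hL.differentiableAt_maslovField hB hp)]
    rfl
  have hg : quadricInduced I h φ p = pullbackForm B F (extChartAt I p p) := by
    funext u v
    rw [quadricInduced, hh, e1, e1]; rfl
  rw [quadricDivJH, hg, maslovDiv, ← smul_eq_mul, ← metricTrace_smul, ← metricTrace_neg]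
  simp only [hh, e1, e2]
  simp

lemma IsCMinimalLegendrian.maslovDiv_eq_zero (hB : IsHermitianRe B)
    (hκ : κ * κ = 1) (hh : ∀ z w, (h z w).re = B z w)
    (hpos : ∀ z Z, B z z = κ → B Z z = 0 → B Z (Complex.I • z) = 0 → Z ≠ 0 → 0 < B Z Z)
    (hφ : IsCMinimalLegendrian I h κ φ) (p : M) :
    maslovDiv B (φ ∘ (extChartAt I p).symm) (extChartAt I p p) = 0 := by
  -- In dimension 0 the factor (n : ℝ)⁻¹ is 0 and the hypothesis carries no information, but every
  -- trace is then an empty sum.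
  rcases Nat.eq_zero_or_pos n with hn | hn
  · exact metricTrace_of_finrank_eq_zero (hφ.legendrian_immersion.dim_eq.trans hn) _ _
  · have := hφ.legendrian_immersion.quadricDivJH_eq I hB hκ hh hpos p
    rw [hφ.div_JH] at this
    have hn' : (n : ℝ) ≠ 0 := by positivity
    field_simp at this
    simpa using this

end Manifold

end QuadricCharts

/-! ### The two Hermitian forms -/

noncomputable section Forms

/-- The real part of the diagonal Hermitian form `∑ εᵢ zᵢ w̄ᵢ`. -/
def hermRe {k : ℕ} (ε : Fin k → ℝ) : (Fin k → ℂ) →L[ℝ] (Fin k → ℂ) →L[ℝ] ℝ :=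
  LinearMap.toContinuousLinearMap
    ((LinearMap.toContinuousLinearMap : ((Fin k → ℂ) →ₗ[ℝ] ℝ) ≃ₗ[ℝ] _).toLinearMap ∘ₗ
      LinearMap.mk₂ ℝ (fun z w : Fin k → ℂ => ∑ i, ε i * (z i * conj (w i)).re)
        (fun _ _ _ => by simp only [Pi.add_apply, add_mul, Complex.add_re, mul_add, Finset.sum_add_distrib])
        (fun _ _ _ => by simp [Finset.mul_sum]; exact Finset.sum_congr rfl fun _ _ => by ring)
        (fun _ _ _ => by
          simp only [Pi.add_apply, map_add, Complex.add_re, mul_add, Finset.sum_add_distrib])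
        (fun _ _ _ => by simp [Finset.mul_sum]; exact Finset.sum_congr rfl fun _ _ => by ring))

lemma hermRe_apply {k : ℕ} (ε : Fin k → ℝ) (z w : Fin k → ℂ) :
    hermRe ε z w = ∑ i, ε i * (z i * conj (w i)).re := rfl

lemma isHermitianRe_hermRe {k : ℕ} (ε : Fin k → ℝ) : IsHermitianRe (hermRe ε) where
  symm z w := by
    simp only [hermRe_apply]
    exact Finset.sum_congr rfl fun i _ => by
      rw [Complex.mul_re, Complex.mul_re, Complex.conj_re, Complex.conj_re, Complex.conj_im,
        Complex.conj_im]
      ring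
  map_I z w := by
    simp only [hermRe_apply]
    exact Finset.sum_congr rfl fun i _ => by simp [add_comm]

/-- The real part of `hermE`. -/
def formE (k : ℕ) : (Fin k → ℂ) →L[ℝ] (Fin k → ℂ) →L[ℝ] ℝ := hermRe fun _ => 1

/-- The real part of `hermL`. -/
def formL (n : ℕ) : (Fin (n + 1) → ℂ) →L[ℝ] (Fin (n + 1) → ℂ) →L[ℝ] ℝ :=
  hermRe (Fin.snoc (fun _ => 1) (-1))

lemma hermE_re {k : ℕ} (z w : Fin k → ℂ) : (hermE z w).re = formE k z w := by
  simp [hermE, formE, hermRe_apply]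

lemma hermL_re {n : ℕ} (z w : Fin (n + 1) → ℂ) : (hermL z w).re = formL n z w := by
  simp [hermL, formL, hermRe_apply, Fin.sum_univ_castSucc]
  ring

lemma isHermitianRe_formE (k : ℕ) : IsHermitianRe (formE k) := isHermitianRe_hermRe _

lemma isHermitianRe_formL (n : ℕ) : IsHermitianRe (formL n) := isHermitianRe_hermRe _

lemma hermE_add_left {k : ℕ} (z z' w : Fin k → ℂ) : hermE (z + z') w = hermE z w + hermE z' w := by
  simp [hermE, add_mul, Finset.sum_add_distrib]

lemma hermE_add_right {k : ℕ} (z w w' : Fin k → ℂ) : hermE z (w + w') = hermE z w + hermE z w' := by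
  simp [hermE, mul_add, Finset.sum_add_distrib]

lemma hermE_smul_left {k : ℕ} (c : ℂ) (z w : Fin k → ℂ) : hermE (c • z) w = c * hermE z w := by
  simp [hermE, Finset.mul_sum, mul_assoc]

lemma hermE_smul_right {k : ℕ} (c : ℂ) (z w : Fin k → ℂ) :
    hermE z (c • w) = conj c * hermE z w := by
  simp [hermE, Finset.mul_sum, mul_left_comm]

lemma hermE_conj {k : ℕ} (z w : Fin k → ℂ) : conj (hermE z w) = hermE w z := by
  simp [hermE, mul_comm]

lemma hermE_self {k : ℕ} (z : Fin k → ℂ) : hermE z z = ((formE k z z : ℝ) : ℂ) := by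
  rw [← hermE_re]
  exact (Complex.conj_eq_iff_re.1 (hermE_conj z z)).symm

lemma hermE_eq {k : ℕ} (z w : Fin k → ℂ) :
    hermE z w = formE k z w - Complex.I * formE k (Complex.I • z) w := by
  have h2 : formE k (Complex.I • z) w = - (hermE z w).im := by
    rw [← hermE_re, hermE_smul_left]; simp
  rw [h2, ← hermE_re]
  apply Complex.ext <;> simp

lemma hermL_eq {n : ℕ} (z w : Fin (n + 1) → ℂ) :
    hermL z w = hermE (Fin.init z) (Fin.init w) - z (Fin.last n) * conj (w (Fin.last n)) := rfl

lemma hermL_smul_right {n : ℕ} (c : ℂ) (z w : Fin (n + 1) → ℂ) :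
    hermL z (c • w) = conj c * hermL z w := by
  have : Fin.init (c • w) = c • (Fin.init w : Fin n → ℂ) := rfl
  rw [hermL_eq, hermL_eq, this, hermE_smul_right]
  simp
  ring

/-- Real orthogonality to z and to Jz gives the real and the imaginary part of complex
orthogonality. -/
lemma hermL_eq_zero {n : ℕ} {z Z : Fin (n + 1) → ℂ} (h1 : formL n Z z = 0)
    (h2 : formL n Z (Complex.I • z) = 0) : hermL Z z = 0 := by
  rw [← hermL_re] at h1 h2
  rw [hermL_smul_right] at h2
  apply Complex.ext
  · simpa using h1
  · simpa using h2

lemma formE_pos {k : ℕ} {z : Fin k → ℂ} (hz : z ≠ 0) : 0 < formE k z z := by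
  obtain ⟨i, hi⟩ := Function.ne_iff.1 hz
  have : formE k z z = ∑ i, Complex.normSq (z i) := by
    simp [formE, hermRe_apply, Complex.normSq_apply]
  rw [this]
  exact Finset.sum_pos' (fun j _ => Complex.normSq_nonneg _)
    ⟨i, Finset.mem_univ _, Complex.normSq_pos.2 hi⟩

lemma formE_nonneg {k : ℕ} (z : Fin k → ℂ) : 0 ≤ formE k z z := by
  rcases eq_or_ne z 0 with rfl | hz
  · simp
  · exact (formE_pos hz).le

lemma normSq_hermE_le {k : ℕ} (z w : Fin k → ℂ) :
    Complex.normSq (hermE z w) ≤ formE k z z * formE k w w := by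
  have h1 : ∀ z : Fin k → ℂ, formE k z z = ∑ i, ‖z i‖ ^ 2 := fun z => by
    simp [formE, hermRe_apply, ← Complex.normSq_eq_norm_sq, Complex.normSq_apply]
  rw [h1, h1, Complex.normSq_eq_norm_sq]
  refine le_trans ?_ (Finset.sum_mul_sq_le_sq_mul_sq Finset.univ (fun i => ‖z i‖) fun i => ‖w i‖)
  gcongr
  refine (norm_sum_le _ _).trans (le_of_eq ?_)
  simp

lemma formL_self {n : ℕ} (z : Fin (n + 1) → ℂ) :
    formL n z z = formE n (Fin.init z) (Fin.init z) - Complex.normSq (z (Fin.last n)) := by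
  rw [← hermL_re, hermL_eq, Complex.sub_re, hermE_re, Complex.mul_conj, Complex.ofReal_re]

/-- The orthogonal complement of a negative vector is positive definite. -/
lemma formL_pos {n : ℕ} (z Z : Fin (n + 1) → ℂ) (hz : formL n z z = -1) (h1 : formL n Z z = 0)
    (h2 : formL n Z (Complex.I • z) = 0) (hZ : Z ≠ 0) : 0 < formL n Z Z := by
  have h := hermL_eq_zero h1 h2
  rw [hermL_eq, sub_eq_zero] at h
  have hcs := normSq_hermE_le (Fin.init Z : Fin n → ℂ) (Fin.init z)
  rw [h, map_mul, Complex.normSq_conj] at hcs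
  rw [formL_self] at hz ⊢
  have hS := formE_nonneg (Fin.init Z : Fin n → ℂ)
  have hl := Complex.normSq_nonneg (Z (Fin.last n))
  by_contra hneg
  have hs := formE_nonneg (Fin.init z : Fin n → ℂ)
  -- Reversed Cauchy–Schwarz. Write S, s for the squared norms of the initial parts of Z, z, and l
  -- for that of the last entry of Z. Orthogonality and |z_{n+1}|² = s + 1 give l(s + 1) ≤ S s; with
  -- S ≤ l this forces l = 0.
  have hl0 : Complex.normSq (Z (Fin.last n)) = 0 := by nlinarith
  have hS0 : formE n (Fin.init Z : Fin n → ℂ) (Fin.init Z) = 0 := by linarith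
  apply hZ
  funext i
  refine Fin.lastCases (Complex.normSq_eq_zero.1 hl0) (fun j => ?_) i
  by_contra hj
  exact (formE_pos (z := (Fin.init Z : Fin n → ℂ)) fun h0 => hj (congrFun h0 j)).ne' hS0

end Forms

/-! ### The Kähler metric of complex hyperbolic space in affine coordinates -/

noncomputable section Hyperbolic

open ComplexHyperbolic

variable {n : ℕ}

lemma hermL_snoc (u v : Fin n → ℂ) (a b : ℂ) :
    hermL (Fin.snoc u a : Fin (n + 1) → ℂ) (Fin.snoc v b) = hermE u v - a * conj b := by
  rw [hermL_eq]; simp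

lemma horiz_eq (w u : Fin n → ℂ) :
    horiz w u = Fin.snoc (u + (hermE u w / (1 - hermE w w)) • w) (hermE u w / (1 - hermE w w)) := by
  have h1 : hermL (Fin.snoc u 0 : Fin (n + 1) → ℂ) (lift w) = hermE u w := by
    rw [lift, hermL_snoc]; simp
  have h2 : hermL (lift w) (lift w) = -(1 - hermE w w) := by
    rw [lift, hermL_snoc]; simp
  simp only [horiz]
  rw [h1, h2, div_neg, neg_smul, sub_neg_eq_add]
  funext i
  refine Fin.lastCases ?_ (fun j => ?_) i <;> simp [lift]

/-- The horizontal part of (u, 0) is (u + λw, λ) with λ = (u, w)/(1 − |w|²); expanding gives the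
Bergman metric of the ball. Only 1 − |w|² ≠ 0 is needed, an open condition, so the formula can be
differentiated. -/
lemma metric_eq_hermE {w : Fin n → ℂ} (hw : 1 - formE n w w ≠ 0) (u v : Fin n → ℂ) :
    metric w u v = (hermE u v + hermE u w * conj (hermE v w) / (1 - formE n w w : ℝ)).re *
      (1 - formE n w w)⁻¹ := by
  have h2 : hermL (lift w) (lift w) = -(1 - hermE w w) := by
    rw [lift, hermL_snoc]; simp
  have hr : (1 - hermE w w : ℂ) = ((1 - formE n w w : ℝ) : ℂ) := by rw [hermE_self]; simp
  have hr0 : ((1 - formE n w w : ℝ) : ℂ) ≠ 0 := by exact_mod_cast hw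
  set r := 1 - formE n w w with hrdef
  have hww : hermE w w = 1 - (r : ℂ) := by rw [← hr]; ring
  have key : hermL (horiz w u) (horiz w v) = hermE u v + hermE u w * conj (hermE v w) / r := by
    rw [horiz_eq, horiz_eq, hermL_snoc, hr]
    simp only [hermE_add_left, hermE_add_right, hermE_smul_left, hermE_smul_right, map_div₀,
      Complex.conj_ofReal, hww]
    rw [hermE_conj v w]
    field_simp
    ring
  rw [metric, key, h2, hr, Complex.neg_re, neg_neg, Complex.ofReal_re, div_eq_mul_inv _ r]

/-- The metric in terms of the Euclidean form. -/
lemma metric_eq {w : Fin n → ℂ} (hw : 1 - formE n w w ≠ 0) (u v : Fin n → ℂ) :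
    metric w u v = formE n u v * (1 - formE n w w)⁻¹ +
      (formE n u w * formE n v w + formE n (Complex.I • u) w * formE n (Complex.I • v) w) *
        ((1 - formE n w w)⁻¹) ^ 2 := by
  rw [metric_eq_hermE hw, hermE_eq u w, hermE_eq v w]
  simp only [Complex.add_re, Complex.div_ofReal_re, hermE_re]
  simp
  field_simp

lemma fderiv_metric {w : Fin n → ℂ} (hw : 1 - formE n w w ≠ 0) (u v a : Fin n → ℂ) :
    fderiv ℝ (fun x => metric x u v) w a =
      2 * formE n w a * formE n u v * ((1 - formE n w w)⁻¹) ^ 2 +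
      (formE n u a * formE n v w + formE n u w * formE n v a +
        formE n (Complex.I • u) a * formE n (Complex.I • v) w +
        formE n (Complex.I • u) w * formE n (Complex.I • v) a) * ((1 - formE n w w)⁻¹) ^ 2 +
      (formE n u w * formE n v w + formE n (Complex.I • u) w * formE n (Complex.I • v) w) *
        (4 * formE n w a) * ((1 - formE n w w)⁻¹) ^ 3 := by
  have hr : HasFDerivAt (fun x => 1 - formE n x x) (-(2 • formE n w)) w := by
    have h := ((formE n).hasFDerivAt_of_bilinear (hasFDerivAt_id w) (hasFDerivAt_id w)).const_sub 1
    refine h.congr_fderiv ?_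
    ext b
    simp [(isHermitianRe_formE n).symm b w, two_mul]
  have hev : (fun x => metric x u v) =ᶠ[nhds w] fun x => formE n u v * (1 - formE n x x)⁻¹ +
      (formE n u x * formE n v x + formE n (Complex.I • u) x * formE n (Complex.I • v) x) *
        ((1 - formE n x x)⁻¹) ^ 2 := by
    filter_upwards [hr.continuousAt.eventually_ne hw] with x hx using metric_eq hx u v
  have hinv := (hasDerivAt_inv hw).comp_hasFDerivAt w hr
  have hL : ∀ z, HasFDerivAt (fun x => formE n z x) (formE n z) w := fun z =>
    (formE n z).hasFDerivAt
  have hD := (hinv.const_mul (formE n u v)).add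
    ((((hL u).mul (hL v)).add ((hL (Complex.I • u)).mul (hL (Complex.I • v)))).mul (hinv.pow 2))
  rw [hev.fderiv_eq]
  refine (congrArg (fun L => L a) hD.fderiv).trans ?_
  simp
  simp only [← inv_pow]
  generalize (1 - formE n w w)⁻¹ = r
  ring

lemma metric_isScalarProduct {w : Fin n → ℂ} (hw : 0 < 1 - formE n w w) :
    IsScalarProduct (metric w) where
  bilin := by
    constructor <;> intros <;> simp [metric_eq hw.ne', smul_comm Complex.I] <;> ring
  symm u v := by
    rw [metric_eq hw.ne', metric_eq hw.ne', (isHermitianRe_formE n).symm u v]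
    ring
  pos u hu := by
    rw [metric_eq hw.ne']
    have := formE_pos hu
    have := inv_pos.2 hw
    have h1 := mul_self_nonneg (formE n u w)
    have h2 := mul_self_nonneg (formE n (Complex.I • u) w)
    positivity

/-- The Christoffel symbols in closed form. -/
lemma christoffel_eq {w : Fin n → ℂ} (hw : 0 < 1 - formE n w w) (u v : Fin n → ℂ) :
    christoffel w u v = (1 - formE n w w)⁻¹ • (hermE u w • v + hermE v w • u) := by
  set Γ := (1 - formE n w w)⁻¹ • (hermE u w • v + hermE v w • u) with hΓ
  have hS := isHermitianRe_formE n
  have hΓ' : Γ = (1 - formE n w w)⁻¹ • (formE n u w • v - formE n (Complex.I • u) w • Complex.I • v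
      + (formE n v w • u - formE n (Complex.I • v) w • Complex.I • u)) := by
    rw [hΓ, hermE_eq, hermE_eq]
    congr 1
    funext i
    simp
    ring
  -- The closed form satisfies the Koszul identity against every `a`. The trace defining the
  -- Christoffel symbols then recovers it, as the expansion of Γ in the metric.
  have key : ∀ a, (fderiv ℝ (fun x => metric x v a) w u + fderiv ℝ (fun x => metric x u a) w v
      - fderiv ℝ (fun x => metric x u v) w a) / 2 = metric w Γ a := by
    intro a
    rw [fderiv_metric hw.ne', fderiv_metric hw.ne', fderiv_metric hw.ne',
      metric_eq hw.ne', hΓ']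
    have hII : ∀ z : Fin n → ℂ, Complex.I • Complex.I • z = - z := fun z => by
      rw [smul_smul, Complex.I_mul_I, neg_one_smul]
    simp only [smul_add, smul_sub, smul_comm Complex.I (_ : ℝ), hII, map_add, map_sub, map_smul,
      map_neg, add_apply, sub_apply, smul_apply, neg_apply, smul_eq_mul, smul_neg]
    have e1 : formE n (Complex.I • v) u = - formE n (Complex.I • u) v := by
      rw [hS.I_left v u, hS.symm v]
    have e2 : ∀ z, formE n (Complex.I • a) z = - formE n (Complex.I • z) a := fun z => by
      rw [hS.I_left a z, hS.symm a]
    rw [e1, e2, e2, e2, hS.symm v u, hS.symm a u, hS.symm a v, hS.symm w u, hS.symm w v,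
      hS.symm w a]
    generalize (1 - formE n w w)⁻¹ = r
    ring
  rw [christoffel]
  simp only [key]
  exact (metric_isScalarProduct hw).metricTrace_expand LinearMap.id Γ

/-! ### The projection of `ℂ^{n+1}` onto affine coordinates -/

/-- The affine coordinates `zᵢ / z_{n+1}` of `z`. -/
def affineProj (z : Fin (n + 1) → ℂ) : Fin n → ℂ := fun i => z i.castSucc / z (Fin.last n)

/-- The differential of `affineProj` at `z`. -/
def dAffineProj (z : Fin (n + 1) → ℂ) : (Fin (n + 1) → ℂ) →ₗ[ℂ] (Fin n → ℂ) where
  toFun Z := (z (Fin.last n))⁻¹ • ((Fin.init Z : Fin n → ℂ) - Z (Fin.last n) • affineProj z)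
  map_add' Z W := by
    funext i
    simp [Fin.init]
    ring
  map_smul' c Z := by
    funext i
    simp [Fin.init]
    ring

lemma dAffineProj_apply (z Z : Fin (n + 1) → ℂ) : dAffineProj z Z =
    (z (Fin.last n))⁻¹ • ((Fin.init Z : Fin n → ℂ) - Z (Fin.last n) • affineProj z) := rfl

lemma smul_affineProj {z : Fin (n + 1) → ℂ} (hz : z (Fin.last n) ≠ 0) :
    z (Fin.last n) • affineProj z = Fin.init z := by
  funext i
  simp [affineProj, Fin.init]
  field_simp

lemma dAffineProj_self {z : Fin (n + 1) → ℂ} (hz : z (Fin.last n) ≠ 0) : dAffineProj z z = 0 := by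
  rw [dAffineProj_apply, smul_affineProj hz, sub_self, smul_zero]

lemma contDiffAt_affineProj {z : Fin (n + 1) → ℂ} (hz : z (Fin.last n) ≠ 0) :
    ContDiffAt ℝ ∞ (affineProj (n := n)) z := by
  refine contDiffAt_pi.2 fun i => ?_
  simp only [affineProj, div_eq_mul_inv]
  exact (contDiffAt_apply _ _ i.castSucc z).mul ((contDiffAt_apply _ _ (Fin.last n) z).inv hz)

/-- Apply the product rule to the identity z_{n+1} · π(z) = (z₁, …, zₙ), whose right side is linear,
and solve for dπ. -/
lemma fderiv_affineProj {z : Fin (n + 1) → ℂ} (hz : z (Fin.last n) ≠ 0) (Z : Fin (n + 1) → ℂ) :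
    fderiv ℝ (affineProj (n := n)) z Z = dAffineProj z Z := by
  let L : (Fin (n + 1) → ℂ) →L[ℝ] ℂ := ContinuousLinearMap.proj (Fin.last n)
  let J : (Fin (n + 1) → ℂ) →L[ℝ] (Fin n → ℂ) :=
    ContinuousLinearMap.pi fun i => ContinuousLinearMap.proj i.castSucc
  have hd : HasFDerivAt (affineProj (n := n)) _ z :=
    ((contDiffAt_affineProj hz).differentiableAt (by simp)).hasFDerivAt
  have h1 := (L.hasFDerivAt (x := z)).smul hd
  have h2 : (fun x => L x • affineProj x) =ᶠ[nhds z] J := by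
    filter_upwards [L.continuous.continuousAt.eventually_ne hz] with x hx using smul_affineProj hx
  have h3 := congrArg (fun T => T Z) ((h1.congr_of_eventuallyEq h2.symm).unique J.hasFDerivAt)
  simp only [add_apply, smul_apply, ContinuousLinearMap.smulRight_apply] at h3
  have h4 : z (Fin.last n) • fderiv ℝ (affineProj (n := n)) z Z + Z (Fin.last n) • affineProj z
    = Fin.init Z := h3
  rw [dAffineProj_apply, ← h4, add_sub_cancel_right, smul_smul, inv_mul_cancel₀ hz, one_smul]

/-- The same device once more: differentiate z_{n+1} · dπ_z(W) + W_{n+1} · π(z) = (W₁, …, Wₙ), which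
is constant in z. -/
lemma hessian_affineProj {z : Fin (n + 1) → ℂ} (hz : z (Fin.last n) ≠ 0)
    (Z W : Fin (n + 1) → ℂ) :
    hessian (affineProj (n := n)) z Z W = -((W (Fin.last n) / z (Fin.last n)) • dAffineProj z Z +
      (Z (Fin.last n) / z (Fin.last n)) • dAffineProj z W) := by
  let L : (Fin (n + 1) → ℂ) →L[ℝ] ℂ := ContinuousLinearMap.proj (Fin.last n)
  have hs := contDiffAt_affineProj hz
  have hd : HasFDerivAt (affineProj (n := n)) _ z := (hs.differentiableAt (by simp)).hasFDerivAt
  have hd2 : DifferentiableAt ℝ (fderiv ℝ (affineProj (n := n))) z :=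
    (hs.fderiv_right (m := ∞) (by simp)).differentiableAt (by simp)
  have hd3 := hd2.hasFDerivAt.clm_apply (hasFDerivAt_const W z)
  have h1 := ((L.hasFDerivAt (x := z)).smul hd3).add (hd.const_smul (L W))
  have h2 : ((fun x => L x • fderiv ℝ affineProj x W) + fun x => L W • affineProj x) =ᶠ[nhds z]
      fun _ => Fin.init W := by
    filter_upwards [L.continuous.continuousAt.eventually_ne hz] with x hx'
    have hx : x (Fin.last n) ≠ 0 := hx'
    have : x (Fin.last n) • dAffineProj x W + W (Fin.last n) • affineProj x = Fin.init W := by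
      rw [dAffineProj_apply, smul_smul, mul_inv_cancel₀ hx, one_smul, sub_add_cancel]
    rw [← fderiv_affineProj hx] at this
    exact this
  have h3 := congrArg (fun T => T Z) ((h1.congr_of_eventuallyEq h2.symm).unique
    (hasFDerivAt_const (Fin.init W : Fin n → ℂ) z))
  simp at h3
  have h4 : z (Fin.last n) • hessian (affineProj (n := n)) z Z W
      + Z (Fin.last n) • fderiv ℝ (affineProj (n := n)) z W
      + W (Fin.last n) • fderiv ℝ (affineProj (n := n)) z Z = 0 := h3
  rw [fderiv_affineProj hz, fderiv_affineProj hz] at h4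
  have h5 : hessian (affineProj (n := n)) z Z W =
      (z (Fin.last n))⁻¹ • (z (Fin.last n) • hessian (affineProj (n := n)) z Z W) := by
    rw [smul_smul, inv_mul_cancel₀ hz, one_smul]
  rw [h5, ← sub_eq_zero]
  have h6 := congrArg (fun X => (z (Fin.last n))⁻¹ • X) h4
  simp only [smul_add, smul_zero, smul_smul] at h6
  rw [smul_smul, ← h6, div_eq_inv_mul, div_eq_inv_mul]
  abel

/-! ### The Hopf fibration on horizontal vectors. -/

section OnQuadric

variable {z : Fin (n + 1) → ℂ} (hz : formL n z z = -1)
include hz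

lemma last_ne_zero_of_mem : z (Fin.last n) ≠ 0 :=
  last_ne_zero (by rw [hermL_re, hz]; norm_num)

lemma one_sub_formE_affineProj :
    1 - formE n (affineProj z) (affineProj z) = (Complex.normSq (z (Fin.last n)))⁻¹ := by
  have hl := last_ne_zero_of_mem hz
  have hl' := Complex.normSq_pos.2 hl
  rw [formL_self, ← smul_affineProj hl, ← hermE_re, hermE_smul_left, hermE_smul_right, ← mul_assoc,
    Complex.mul_conj, Complex.re_ofReal_mul, hermE_re] at hz
  field_simp
  linarith

lemma one_sub_formE_affineProj_pos : 0 < 1 - formE n (affineProj z) (affineProj z) := by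
  rw [one_sub_formE_affineProj hz]
  exact inv_pos.2 (Complex.normSq_pos.2 (last_ne_zero_of_mem hz))

/-- Horizontality of Z, divided by the conjugate of z_{n+1}, says that the initial part of Z pairs
with π(z) to Z_{n+1}. Subtracting the Z_{n+1} π(z) correction leaves the factor 1 − |π(z)|². -/
lemma hermE_dAffineProj {Z : Fin (n + 1) → ℂ} (h1 : formL n Z z = 0)
    (h2 : formL n Z (Complex.I • z) = 0) : hermE (dAffineProj z Z) (affineProj z) =
      (1 - formE n (affineProj z) (affineProj z) : ℝ) * (Z (Fin.last n) / z (Fin.last n)) := by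
  have hl := last_ne_zero_of_mem hz
  have h := hermL_eq_zero h1 h2
  rw [hermL_eq, ← smul_affineProj hl, hermE_smul_right, sub_eq_zero, mul_comm (Z _)] at h
  have h' := mul_left_cancel₀ ((map_ne_zero _).2 hl) h
  rw [dAffineProj_apply, hermE_smul_left, sub_eq_add_neg, ← neg_smul, hermE_add_left,
    hermE_smul_left, h', hermE_self]
  push_cast
  field_simp
  ring

/-- The Hopf fibration is totally geodesic on horizontal vectors. -/
lemma hessian_affineProj_add_christoffel {Z W : Fin (n + 1) → ℂ} (h1 : formL n Z z = 0)
    (h2 : formL n Z (Complex.I • z) = 0) (h3 : formL n W z = 0)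
    (h4 : formL n W (Complex.I • z) = 0) :
    hessian affineProj z Z W +
      christoffel (affineProj z) (dAffineProj z Z) (dAffineProj z W) = 0 := by
  have hp := one_sub_formE_affineProj_pos hz
  -- By `hermE_dAffineProj` the factor 1 − |π(z)|² cancels the inverse in the Christoffel symbols,
  -- leaving the exact negative of the Hessian.
  rw [hessian_affineProj (last_ne_zero_of_mem hz), christoffel_eq hp, hermE_dAffineProj hz h1 h2,
    hermE_dAffineProj hz h3 h4]
  set r := 1 - formE n (affineProj z) (affineProj z)
  have hr : (r : ℂ) ≠ 0 := by exact_mod_cast hp.ne'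
  funext i
  simp
  field_simp
  ring

/-- The Hopf fibration is a Riemannian submersion. -/
lemma metric_dAffineProj (Z : Fin (n + 1) → ℂ) {W : Fin (n + 1) → ℂ} (h3 : formL n W z = 0)
    (h4 : formL n W (Complex.I • z) = 0) :
    metric (affineProj z) (dAffineProj z Z) (dAffineProj z W) = formL n Z W := by
  have hl := last_ne_zero_of_mem hz
  have hp := one_sub_formE_affineProj_pos hz
  have hr := one_sub_formE_affineProj hz
  have h := hermL_eq_zero h3 h4
  rw [hermL_eq, ← smul_affineProj hl, hermE_smul_right, sub_eq_zero, mul_comm (W _)] at h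
  have h' := mul_left_cancel₀ ((map_ne_zero _).2 hl) h
  have h'' := hermE_conj (Fin.init W : Fin n → ℂ) (affineProj z)
  rw [h'] at h''
  have hrC : ((1 - formE n (affineProj z) (affineProj z) : ℝ) : ℂ) ≠ 0 := by exact_mod_cast hp.ne'
  -- Only W has to be horizontal: a vertical component of Z is killed by dπ and is orthogonal to W.
  -- This permits Z to be a Hessian or the derivative of a Maslov field.
  have key : hermE (dAffineProj z Z) (dAffineProj z W) + hermE (dAffineProj z Z) (affineProj z) *
      conj (hermE (dAffineProj z W) (affineProj z)) /
        (1 - formE n (affineProj z) (affineProj z) : ℝ) =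
      ((Complex.normSq (z (Fin.last n)))⁻¹ : ℝ) * hermL Z W := by
    rw [hermE_dAffineProj hz h3 h4, map_mul, Complex.conj_ofReal, mul_left_comm,
      mul_div_cancel_left₀ _ hrC, map_div₀, dAffineProj_apply z W, hermE_smul_right,
      sub_eq_add_neg, ← neg_smul, hermE_add_right, hermE_smul_right, dAffineProj_apply z Z,
      hermE_smul_left, hermE_smul_left, sub_eq_add_neg, ← neg_smul, hermE_add_left,
      hermE_smul_left, ← h'', hermL_eq, Complex.ofReal_inv, ← Complex.mul_conj, map_neg, map_inv₀]
    have hc : conj (z (Fin.last n)) ≠ 0 := (map_ne_zero _).2 hl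
    field_simp
    ring
  rw [metric_eq_hermE hp.ne', key, Complex.re_ofReal_mul, hermL_re, hr, inv_inv]
  have := Complex.normSq_pos.2 hl
  field_simp

end OnQuadric

end Hyperbolic

/-! ### Legendrian lifts of Lagrangian immersions -/

noncomputable section Lift

open ComplexHyperbolic

variable {E : Type*} [NormedAddCommGroup E] [NormedSpace ℝ E]
variable {n : ℕ} {Ψ : E → Fin (n + 1) → ℂ} {U : Set E}

section Flat

variable (h : IsLegendrianOn (formL n) (-1) Ψ U) {y : E} (hy : y ∈ U)
include h hy

lemma IsLegendrianOn.contDiffAt_affineProj : ContDiffAt ℝ ∞ (affineProj (n := n)) (Ψ y) :=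
  _root_.contDiffAt_affineProj (last_ne_zero_of_mem (h.mem y hy))

lemma IsLegendrianOn.fderiv_affineProj_comp (u : E) :
    fderiv ℝ (affineProj ∘ Ψ) y u = dAffineProj (Ψ y) (fderiv ℝ Ψ y u) := by
  rw [fderiv_comp_apply ((h.contDiffAt_affineProj hy).differentiableAt (by simp))
    (h.differentiableAt hy), fderiv_affineProj (last_ne_zero_of_mem (h.mem y hy))]

/-- In the chain rule the Hessian of π enters only on vectors dΨ(u), dΨ(v). These are horizontal
because Ψ is Legendrian, so that term cancels the Christoffel term. -/
lemma IsLegendrianOn.covariant_hessian (u v : E) :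
    hessian (affineProj ∘ Ψ) y u v + christoffel (affineProj (Ψ y))
      (dAffineProj (Ψ y) (fderiv ℝ Ψ y u)) (dAffineProj (Ψ y) (fderiv ℝ Ψ y v)) =
      dAffineProj (Ψ y) (hessian Ψ y u v) := by
  have hB := isHermitianRe_formL n
  rw [hessian_comp (h.contDiffAt_affineProj hy) (h.contDiffAt hy), add_right_comm,
    hessian_affineProj_add_christoffel (h.mem y hy) (h.tangent hy hB u) (h.legendrian y hy u)
      (h.tangent hy hB v) (h.legendrian y hy v), zero_add,
    fderiv_affineProj (last_ne_zero_of_mem (h.mem y hy))]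

/-- This differentiates the push-forward of a field along Ψ. When W is horizontal, the Hessian term
is what the Christoffel term of the covariant derivative removes. -/
lemma IsLegendrianOn.hasFDerivAt_dAffineProj {W : E → Fin (n + 1) → ℂ}
    (hW : DifferentiableAt ℝ W y) :
    DifferentiableAt ℝ (fun x => dAffineProj (Ψ x) (W x)) y ∧
    ∀ u, fderiv ℝ (fun x => dAffineProj (Ψ x) (W x)) y u =
      hessian affineProj (Ψ y) (fderiv ℝ Ψ y u) (W y) +
        dAffineProj (Ψ y) (fderiv ℝ W y u) := by
  have hev : (fun x => dAffineProj (Ψ x) (W x)) =ᶠ[nhds y]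
      fun x => fderiv ℝ (affineProj (n := n)) (Ψ x) (W x) := by
    filter_upwards [h.isOpen.mem_nhds hy] with x hx
    rw [fderiv_affineProj (last_ne_zero_of_mem (h.mem x hx))]
  have hd2 : DifferentiableAt ℝ (fderiv ℝ (affineProj (n := n))) (Ψ y) :=
    ((h.contDiffAt_affineProj hy).fderiv_right (m := ∞) (by simp)).differentiableAt (by simp)
  have hD := (hd2.hasFDerivAt.comp y (h.differentiableAt hy).hasFDerivAt).clm_apply hW.hasFDerivAt
  refine ⟨hev.differentiableAt_iff.2 hD.differentiableAt, fun u => ?_⟩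
  rw [hev.fderiv_eq]
  refine (congrArg (fun L => L u) hD.fderiv).trans ?_
  simp [hessian, fderiv_affineProj (last_ne_zero_of_mem (h.mem y hy)), add_comm]

end Flat

variable [FiniteDimensional ℝ E]
variable {H : Type*} [TopologicalSpace H] (I : ModelWithCorners ℝ E H) [I.Boundaryless]
variable {M : Type*} [TopologicalSpace M] [ChartedSpace H M] [IsManifold I ∞ M]
variable {Φ : M → ComplexHyperbolic n}

/-- JH of Φ is the push-forward of JH of the lift. The differential of π is complex linear,
isometric on horizontal vectors, carries flat Hessians to covariant ones and kills the radial
component. It therefore carries the second fundamental form in the quadric to that in ℂHⁿ. -/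
lemma I_smul_chMeanCurv (hΦ : ContMDiff I 𝓘(ℝ, Fin n → ℂ) ∞ (inAffine Φ))
    (hdim : Module.finrank ℝ E = n) (h : IsLegendrianOn (formL n) (-1) Ψ U) (p : M)
    (hU : U ⊆ (extChartAt I p).target)
    (hlift : ∀ y ∈ U, inAffine Φ ((extChartAt I p).symm y) = affineProj (Ψ y)) {y : E}
    (hy : y ∈ U) :
    Complex.I • chMeanCurv I Φ ((extChartAt I p).symm y) =
      dAffineProj (Ψ y) (-((n : ℝ)⁻¹ • maslovField (formL n) Ψ y)) := by
  have hB := isHermitianRe_formL n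
  obtain ⟨T, S, hTS⟩ := exists_coord_change I (V := Fin n → ℂ) p (hU hy)
  obtain ⟨hT, hS⟩ := hTS _ hΦ
  have hev : inAffine Φ ∘ (extChartAt I p).symm =ᶠ[nhds y] affineProj ∘ Ψ := by
    filter_upwards [h.isOpen.mem_nhds hy] with x hx using hlift x hx
  have hx := hlift y hy
  set x := (extChartAt I p).symm y
  have hz := h.mem y hy
  have hd : ∀ u, dMap I (inAffine Φ) x u = dAffineProj (Ψ y) (fderiv ℝ Ψ y (T u)) := fun u => by
    rw [hT, hev.fderiv_eq, h.fderiv_affineProj_comp hy]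
  have hh : ∀ u v, hessMap I (inAffine Φ) x u v + christoffel (inAffine Φ x)
      (dMap I (inAffine Φ) x u) (dMap I (inAffine Φ) x v) =
      dAffineProj (Ψ y) (hessian Ψ y (T u) (T v) + fderiv ℝ Ψ y (S u v)) := fun u v => by
    rw [hS, hd, hd, hx, hev.fderiv_eq, h.fderiv_affineProj_comp hy, hessian,
      (hev.fderiv (𝕜 := ℝ)).fderiv_eq, map_add, ← h.covariant_hessian hy]
    rw [← hessian]
    abel
  have hg : chInduced I Φ x = fun u v => pullbackForm (formL n) Ψ y (T u) (T v) := by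
    funext u v
    rw [chInduced, hx, hd, hd, metric_dAffineProj hz _ (h.tangent hy hB _) (h.legendrian y hy _)]
    rfl
  have hdim' : Module.finrank ℝ (Fin (n + 1) → ℂ) = 2 * (Module.finrank ℝ E + 1) := by
    rw [finrank_real_complex_space, hdim]
  have key := h.I_smul_trace_normal hB (by norm_num) hdim' hy T S
  rw [← smul_neg, ← key, chMeanCurv, smul_comm]
  let D : (Fin (n + 1) → ℂ) →ₗ[ℝ] (Fin n → ℂ) := (dAffineProj (Ψ y)).restrictScalars ℝ
  change _ = D _
  rw [map_smul, map_metricTrace, hg]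
  congr 1
  rw [show ∀ X : Fin n → ℂ, Complex.I • X = mulI _ X from fun _ => rfl, map_metricTrace]
  congr 1
  funext u v
  change Complex.I • chSecondFF I Φ x u v = dAffineProj (Ψ y) (Complex.I • _)
  rw [map_smul]
  congr 1
  rw [map_sub (dAffineProj (Ψ y)), map_sub (dAffineProj (Ψ y))]
  have h0 : ∀ c : ℝ, dAffineProj (Ψ y) (c • Ψ y) = 0 := fun c => by
    change D (c • Ψ y) = 0
    rw [map_smul]
    change c • dAffineProj (Ψ y) (Ψ y) = 0
    rw [dAffineProj_self (last_ne_zero_of_mem hz), smul_zero]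
  rw [h0, sub_zero]
  simp only [chSecondFF, hh, hg]
  simp only [hd]
  congr 1
  change _ = D _
  rw [map_metricTrace]
  congr 1
  funext a b
  rw [map_smul, hx, metric_dAffineProj hz _ (h.tangent hy hB _) (h.legendrian y hy _)]
  rfl

/-- The divergence of `JH` for a Lagrangian immersion is that of a local Legendrian lift. -/
lemma chDivJH_eq (hΦ : ContMDiff I 𝓘(ℝ, Fin n → ℂ) ∞ (inAffine Φ))
    (hdim : Module.finrank ℝ E = n) (h : IsLegendrianOn (formL n) (-1) Ψ U) (p : M)
    (hU : U ⊆ (extChartAt I p).target) (hp : extChartAt I p p ∈ U)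
    (hlift : ∀ y ∈ U, inAffine Φ ((extChartAt I p).symm y) = affineProj (Ψ y)) :
    chDivJH I Φ p = -((n : ℝ)⁻¹ * maslovDiv (formL n) Ψ (extChartAt I p p)) := by
  have hB := isHermitianRe_formL n
  set y := extChartAt I p p
  have hz := h.mem y hp
  have hev : inAffine Φ ∘ (extChartAt I p).symm =ᶠ[nhds y] affineProj ∘ Ψ := by
    filter_upwards [h.isOpen.mem_nhds hp] with x hx using hlift x hx
  have hx : inAffine Φ p = affineProj (Ψ y) := by
    rw [← hlift y hp, extChartAt_to_inv]
  have hd : ∀ u, dMap I (inAffine Φ) p u = dAffineProj (Ψ y) (fderiv ℝ Ψ y u) := fun u => by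
    rw [dMap_eq_fderiv I ((hΦ p).mdifferentiableAt (by simp)), hev.fderiv_eq,
      h.fderiv_affineProj_comp hp]
  have hg : chInduced I Φ p = pullbackForm (formL n) Ψ y := by
    funext u v
    rw [chInduced, hx, hd, hd, metric_dAffineProj hz _ (h.tangent hp hB _) (h.legendrian y hp _)]
    rfl
  set W : E → Fin (n + 1) → ℂ := fun x => -((n : ℝ)⁻¹ • maslovField (formL n) Ψ x) with hW
  have hm := h.differentiableAt_maslovField hB hp
  have hWd : DifferentiableAt ℝ W y := (hm.const_smul (n : ℝ)⁻¹).neg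
  have hWf : ∀ u, fderiv ℝ W y u = -((n : ℝ)⁻¹ • fderiv ℝ (maslovField (formL n) Ψ) y u) := by
    intro u
    rw [hW, fderiv_fun_neg, fderiv_fun_const_smul hm]
    rfl
  have hJH : (fun x => Complex.I • chMeanCurv I Φ x) ∘ (extChartAt I p).symm =ᶠ[nhds y]
      fun x => dAffineProj (Ψ x) (W x) := by
    filter_upwards [h.isOpen.mem_nhds hp] with x hx
    exact I_smul_chMeanCurv I hΦ hdim h p hU hlift hx
  obtain ⟨hGd, hGf⟩ := h.hasFDerivAt_dAffineProj hp hWd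
  have hX : Complex.I • chMeanCurv I Φ p = dAffineProj (Ψ y) (W y) := by
    have := I_smul_chMeanCurv I hΦ hdim h p hU hlift hp
    rwa [extChartAt_to_inv] at this
  -- Horizontality of JH is what lets the Hessian of π cancel the Christoffel term in the covariant
  -- derivative of JH.
  have hWh : formL n (W y) (Ψ y) = 0 ∧ formL n (W y) (Complex.I • Ψ y) = 0 := by
    obtain ⟨h1, h2⟩ := h.maslovField_horizontal hB hp
    simp [hW, h1, h2]
  have hcov : ∀ u, chCovDeriv I Φ (fun x => Complex.I • chMeanCurv I Φ x) p u =
      dAffineProj (Ψ y) (-((n : ℝ)⁻¹ • fderiv ℝ (maslovField (formL n) Ψ) y u)) := by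
    intro u
    rw [chCovDeriv, dMap_eq_of_eventuallyEq I hJH hGd, hGf, hX, hd, hx, ← hWf, add_right_comm,
      hessian_affineProj_add_christoffel hz (h.tangent hp hB _) (h.legendrian y hp _) hWh.1 hWh.2,
      zero_add]
  rw [chDivJH, hg, maslovDiv, ← smul_eq_mul, ← metricTrace_smul, ← metricTrace_neg]
  congr 1
  funext u v
  rw [hcov, hd, hx, metric_dAffineProj hz _ (h.tangent hp hB _) (h.legendrian y hp _)]
  simp

/-- A smooth map to complex hyperbolic space with local Legendrian lifts whose Maslov field is
divergence free is an H-minimal Lagrangian immersion. -/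
theorem isHMinimalLagrangian_of_lift (hΦ : ContMDiff I 𝓘(ℝ, Fin n → ℂ) ∞ (inAffine Φ))
    (hdim : Module.finrank ℝ E = n)
    (hlift : ∀ p : M, ∃ (U : Set E) (Ψ : E → Fin (n + 1) → ℂ), U ⊆ (extChartAt I p).target ∧
      extChartAt I p p ∈ U ∧ IsLegendrianOn (formL n) (-1) Ψ U ∧
      (∀ y ∈ U, inAffine Φ ((extChartAt I p).symm y) = affineProj (Ψ y)) ∧
      maslovDiv (formL n) Ψ (extChartAt I p p) = 0) :
    IsHMinimalLagrangian I Φ := by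
  have hB := isHermitianRe_formL n
  have hd : ∀ p : M, ∃ (z : Fin (n + 1) → ℂ) (d : E →L[ℝ] (Fin (n + 1) → ℂ)),
      formL n z z = -1 ∧ (∀ u, formL n (d u) z = 0) ∧ (∀ u, formL n (d u) (Complex.I • z) = 0) ∧
      (∀ u v, formL n (d u) (Complex.I • d v) = 0) ∧ (∀ u, u ≠ 0 → 0 < formL n (d u) (d u)) ∧
      inAffine Φ p = affineProj z ∧
      ∀ u, dMap I (inAffine Φ) p u = dAffineProj z (d u) := by
    intro p
    obtain ⟨U, Ψ, hU, hp, h, hl, -⟩ := hlift p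
    have hev : inAffine Φ ∘ (extChartAt I p).symm =ᶠ[nhds (extChartAt I p p)] affineProj ∘ Ψ := by
      filter_upwards [h.isOpen.mem_nhds hp] with x hx using hl x hx
    refine ⟨_, fderiv ℝ Ψ (extChartAt I p p), h.mem _ hp, h.tangent hp hB, h.legendrian _ hp,
      h.lagrangian hp hB, h.pos _ hp, ?_, fun u => ?_⟩
    · rw [← hl _ hp, extChartAt_to_inv]
    · rw [dMap_eq_fderiv I ((hΦ p).mdifferentiableAt (by simp)), hev.fderiv_eq,
        h.fderiv_affineProj_comp hp]
  refine ⟨⟨hdim, hΦ, fun p => ?_, fun p u v => ?_⟩, fun p => ?_⟩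
  · obtain ⟨z, d, hz, ht, hl, -, hpos, hx, hd⟩ := hd p
    intro u v huv
    by_contra hne
    have h1 : dAffineProj z (d (u - v)) = 0 := by
      rw [map_sub, map_sub, ← hd, ← hd, huv, sub_self]
    have h2 := hpos (u - v) (sub_ne_zero.2 hne)
    rw [← metric_dAffineProj hz _ (ht _) (hl _), h1] at h2
    have h3 := (metric_isScalarProduct (one_sub_formE_affineProj_pos hz)).bilin.smul_left 0 0 0
    simp at h3
    exact h2.ne' h3
  · obtain ⟨z, d, hz, ht, hl, hL, hpos, hx, hd⟩ := hd p
    rw [hx, hd, hd, ← map_smul, metric_dAffineProj hz _ (ht _) (hl _), hB.I_left, hL, neg_zero]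
  · obtain ⟨U, Ψ, hU, hp, h, hl, h0⟩ := hlift p
    rw [chDivJH_eq I hΦ hdim h p hU hp hl, h0]
    simp

end Lift

/-! ### Twisted products of Legendrian immersions -/

noncomputable section Twist

/-- The phase factor `c e^{iax}`. -/
def phase (c a x : ℝ) : ℂ := c * Complex.exp (Complex.I * (a * x))

lemma normSq_phase (c a x : ℝ) : Complex.normSq (phase c a x) = c ^ 2 := by
  rw [phase, map_mul, Complex.normSq_eq_norm_sq (Complex.exp _), mul_comm Complex.I,
    ← Complex.ofReal_mul, Complex.norm_exp_ofReal_mul_I, Complex.normSq_ofReal]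
  ring

lemma contDiff_phase (c a : ℝ) : ContDiff ℝ ∞ (phase c a) := by
  unfold phase
  have : ContDiff ℝ ∞ (fun x : ℝ => (x : ℂ)) := Complex.ofRealCLM.contDiff
  fun_prop

lemma hasDerivAt_phase (c a x : ℝ) : HasDerivAt (phase c a) (phase c a x * (Complex.I * a)) x := by
  have h := ((((hasDerivAt_id x).ofReal_comp).const_mul (a : ℂ)).const_mul Complex.I).cexp.const_mul
    (c : ℂ)
  refine h.congr_deriv ?_
  simp [phase]
  ring

section General

variable {E : Type*} [NormedAddCommGroup E] [NormedSpace ℝ E]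
variable {V : Type*} [NormedAddCommGroup V] [NormedSpace ℝ V] [NormedSpace ℂ V]
  [IsScalarTower ℝ ℂ V]

lemma ofReal_smul_eq (r : ℝ) (v : V) : (r : ℂ) • v = r • v := algebraMap_smul ℂ r v

lemma IsHermitianRe.map_smul_smul {B : V →L[ℝ] V →L[ℝ] ℝ} (hB : IsHermitianRe B) (q : ℂ) (z w : V) :
    B (q • z) (q • w) = Complex.normSq q * B z w := by
  have h : ∀ z : V, q • z = q.re • z + q.im • Complex.I • z := fun z => by
    conv_lhs => rw [← Complex.re_add_im q, add_smul, mul_smul, ofReal_smul_eq, ofReal_smul_eq]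
  rw [h, h, Complex.normSq_apply]
  simp only [map_add, map_smul, add_apply, smul_apply, smul_eq_mul, hB.map_I, hB.I_left z w]
  ring

/-- The map `c e^{iaσ} G`. -/
def twist (c a : ℝ) (σ : E → ℝ) (G : E → V) (Y : E) : V := phase c a (σ Y) • G Y

variable {c a : ℝ} {σ : E → ℝ} {G : E → V} {Y : E}

lemma hasFDerivAt_twist (hσ : DifferentiableAt ℝ σ Y) (hG : DifferentiableAt ℝ G Y) :
    DifferentiableAt ℝ (twist c a σ G) Y ∧ ∀ u, fderiv ℝ (twist c a σ G) Y u =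
      phase c a (σ Y) • ((a * fderiv ℝ σ Y u) • Complex.I • G Y + fderiv ℝ G Y u) := by
  have h1 := (hasDerivAt_phase c a (σ Y)).hasFDerivAt.comp Y hσ.hasFDerivAt
  have h2 := h1.smul hG.hasFDerivAt
  refine ⟨h2.differentiableAt, fun u => ?_⟩
  refine (congrArg (fun L => L u) h2.fderiv).trans ?_
  simp only [add_apply, smul_apply, ContinuousLinearMap.smulRight_apply,
    ContinuousLinearMap.comp_apply, ContinuousLinearMap.toSpanSingleton_apply, smul_add,
    Function.comp_apply]
  rw [add_comm]
  congr 1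
  rw [← ofReal_smul_eq (a * fderiv ℝ σ Y u), Complex.real_smul, smul_smul,
    smul_smul]
  push_cast
  congr 1
  ring

lemma contDiffAt_twist (hσ : ContDiffAt ℝ ∞ σ Y) (hG : ContDiffAt ℝ ∞ G Y) :
    ContDiffAt ℝ ∞ (twist c a σ G) Y :=
  (((contDiff_phase c a).contDiffAt).comp Y hσ).smul hG

/-- The directional derivative of a twist is again a twist, of (a dσ(v)) JG + dG(v), so the
first-order formula is applied twice. -/
lemma hessian_twist (hσ : ContDiffAt ℝ ∞ σ Y) (hG : ContDiffAt ℝ ∞ G Y) (u v : E) :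
    hessian (twist c a σ G) Y u v = phase c a (σ Y) •
      ((a * fderiv ℝ σ Y u) • Complex.I • ((a * fderiv ℝ σ Y v) • Complex.I • G Y + fderiv ℝ G Y v)
        + ((a * fderiv ℝ σ Y v) • Complex.I • fderiv ℝ G Y u
          + (a * hessian σ Y u v) • Complex.I • G Y + hessian G Y u v)) := by
  have e1 : ∀ᶠ x in nhds Y, DifferentiableAt ℝ σ x :=
    ((hσ.of_le (m := 1) (by norm_cast)).eventually (by simp)).mono fun x hx =>
      hx.differentiableAt (by simp)
  have e2 : ∀ᶠ x in nhds Y, DifferentiableAt ℝ G x :=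
    ((hG.of_le (m := 1) (by norm_cast)).eventually (by simp)).mono fun x hx =>
      hx.differentiableAt (by simp)
  have hev : (fun x => fderiv ℝ (twist c a σ G) x v) =ᶠ[nhds Y] twist c a σ
      (fun x => (a * fderiv ℝ σ x v) • Complex.I • G x + fderiv ℝ G x v) := by
    filter_upwards [e1, e2] with x h1 h2 using (hasFDerivAt_twist h1 h2).2 v
  have dσ : DifferentiableAt ℝ (fderiv ℝ σ) Y :=
    (hσ.fderiv_right (m := ∞) (by simp)).differentiableAt (by simp)
  have dG : DifferentiableAt ℝ (fderiv ℝ G) Y :=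
    (hG.fderiv_right (m := ∞) (by simp)).differentiableAt (by simp)
  have dT : DifferentiableAt ℝ (fderiv ℝ (twist c a σ G)) Y :=
    ((contDiffAt_twist hσ hG).fderiv_right (m := ∞) (by simp)).differentiableAt (by simp)
  have dσ0 : DifferentiableAt ℝ σ Y := hσ.differentiableAt (by simp)
  have dG0 : DifferentiableAt ℝ G Y := hG.differentiableAt (by simp)
  have h1 : HasFDerivAt (fun x => fderiv ℝ σ x v) _ Y :=
    dσ.hasFDerivAt.clm_apply (hasFDerivAt_const v Y)
  have h2 : HasFDerivAt (fun x => fderiv ℝ G x v) _ Y :=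
    dG.hasFDerivAt.clm_apply (hasFDerivAt_const v Y)
  have h3 := ((h1.const_mul a).smul (dG0.hasFDerivAt.const_smul Complex.I)).add h2
  have h4 : hessian (twist c a σ G) Y u v = fderiv ℝ (fun x => fderiv ℝ (twist c a σ G) x v) Y u := by
    rw [(dT.hasFDerivAt.clm_apply (hasFDerivAt_const v Y)).fderiv]
    simp [hessian]
  rw [h4, hev.fderiv_eq]
  refine ((hasFDerivAt_twist dσ0 h3.differentiableAt).2 u).trans ?_
  congr 2
  refine (congrArg (fun L => L u) h3.fderiv).trans ?_
  simp [hessian]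

end General

lemma hessian_clm {E V : Type*} [NormedAddCommGroup E] [NormedSpace ℝ E] [NormedAddCommGroup V]
    [NormedSpace ℝ V] (L : E →L[ℝ] V) (y u v : E) : hessian L y u v = 0 := by
  have : fderiv ℝ (L : E → V) = fun _ => L := funext fun x => L.fderiv
  simp [hessian, this]

lemma hessian_comp_clm {E F V : Type*} [NormedAddCommGroup E] [NormedSpace ℝ E]
    [NormedAddCommGroup F] [NormedSpace ℝ F] [NormedAddCommGroup V]
    [NormedSpace ℝ V] {G : F → V} (L : E →L[ℝ] F) {y : E} (hG : ContDiffAt ℝ ∞ G (L y)) (u v : E) :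
    hessian (G ∘ L) y u v = hessian G (L y) (L u) (L v) := by
  rw [hessian_comp hG L.contDiff.contDiffAt, hessian_clm, map_zero, add_zero, L.fderiv]

lemma fderiv_comp_clm {E F V : Type*} [NormedAddCommGroup E] [NormedSpace ℝ E]
    [NormedAddCommGroup F] [NormedSpace ℝ F] [NormedAddCommGroup V]
    [NormedSpace ℝ V] {G : F → V} (L : E →L[ℝ] F) {y : E} (hG : DifferentiableAt ℝ G (L y)) (u : E) :
    fderiv ℝ (G ∘ L) y u = fderiv ℝ G (L y) (L u) := by
  rw [fderiv_comp_apply hG L.differentiableAt, L.fderiv]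

end Twist

/-! ### The local Legendrian lift, its induced metric and its Maslov field. -/

noncomputable section TwistedProduct

lemma IsScalarProduct.const_mul {E : Type*} [AddCommGroup E] [Module ℝ E] {g : E → E → ℝ}
    (hg : IsScalarProduct g) {c : ℝ} (hc : 0 < c) : IsScalarProduct fun u v => c * g u v where
  bilin := by
    constructor <;> intros <;>
      simp [hg.bilin.add_left, hg.bilin.add_right, hg.bilin.smul_left, hg.bilin.smul_right] <;> ring
  symm u v := by rw [hg.symm]
  pos u hu := mul_pos hc (hg.pos u hu)

lemma IsScalarProduct.prod {E E' : Type*} [AddCommGroup E] [Module ℝ E] [AddCommGroup E']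
    [Module ℝ E'] {g : E → E → ℝ} {g' : E' → E' → ℝ}
    (hg : IsScalarProduct g) (hg' : IsScalarProduct g') :
    IsScalarProduct fun u v : E × E' => g u.1 v.1 + g' u.2 v.2 where
  bilin := by
    constructor <;> intros <;>
      simp [hg.bilin.add_left, hg.bilin.add_right, hg.bilin.smul_left, hg.bilin.smul_right,
        hg'.bilin.add_left, hg'.bilin.add_right, hg'.bilin.smul_left, hg'.bilin.smul_right] <;> ring
  symm u v := by rw [hg.symm, hg'.symm]
  pos u hu := by
    have h0 : g 0 0 = 0 := by simpa using hg.bilin.smul_left 0 0 0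
    have h0' : g' 0 0 = 0 := by simpa using hg'.bilin.smul_left 0 0 0
    rcases eq_or_ne u.1 0 with h | h
    · have h' : u.2 ≠ 0 := fun h' => hu (Prod.ext h h')
      rw [h, h0, zero_add]
      exact hg'.pos _ h'
    · rcases eq_or_ne u.2 0 with h' | h'
      · rw [h', h0', add_zero]
        exact hg.pos _ h
      · exact add_pos (hg.pos _ h) (hg'.pos _ h')

/-- A local coordinate on a line. -/
structure IsLineCoordinate {E₀ : Type*} [NormedAddCommGroup E₀] [NormedSpace ℝ E₀] (s : E₀ → ℝ)
    (U₀ : Set E₀) : Prop where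
  isOpen : IsOpen U₀
  smooth : ContDiffOn ℝ ∞ s U₀
  exists_unit : ∀ t ∈ U₀, ∃ e, fderiv ℝ s t e = 1 ∧ ∀ u : E₀, ∃ c : ℝ, u = c • e

lemma IsLineCoordinate.isScalarProduct {E₀ : Type*} [NormedAddCommGroup E₀] [NormedSpace ℝ E₀]
    {s : E₀ → ℝ} {U₀ : Set E₀} (hs : IsLineCoordinate s U₀) {t : E₀} (ht : t ∈ U₀) :
    IsScalarProduct fun u v => fderiv ℝ s t u * fderiv ℝ s t v where
  bilin := by constructor <;> intros <;> simp <;> ring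
  symm _ _ := mul_comm _ _
  pos u hu := by
    obtain ⟨e, he, h⟩ := hs.exists_unit t ht
    obtain ⟨c, rfl⟩ := h u
    have hc : c ≠ 0 := by rintro rfl; simp at hu
    simp only [map_smul, he, smul_eq_mul, mul_one]
    exact mul_self_pos.2 hc

variable {V₁ : Type*} [NormedAddCommGroup V₁] [NormedSpace ℝ V₁] [NormedSpace ℂ V₁]
  [IsScalarTower ℝ ℂ V₁]
variable {V₂ : Type*} [NormedAddCommGroup V₂] [NormedSpace ℝ V₂] [NormedSpace ℂ V₂]
  [IsScalarTower ℝ ℂ V₂]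
variable {V : Type*} [NormedAddCommGroup V] [NormedSpace ℝ V] [NormedSpace ℂ V]

/-- An orthogonal decomposition `V = V₁ ⊕ V₂`. -/
structure IsOrthogonalSum (B : V →L[ℝ] V →L[ℝ] ℝ) (B₁ : V₁ →L[ℝ] V₁ →L[ℝ] ℝ)
    (B₂ : V₂ →L[ℝ] V₂ →L[ℝ] ℝ) (ι₁ : V₁ →L[ℝ] V) (ι₂ : V₂ →L[ℝ] V) : Prop where
  map_I₁ : ∀ z, ι₁ (Complex.I • z) = Complex.I • ι₁ z
  map_I₂ : ∀ z, ι₂ (Complex.I • z) = Complex.I • ι₂ z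
  form : ∀ z w z' w', B (ι₁ z + ι₂ w) (ι₁ z' + ι₂ w') = B₁ z z' + B₂ w w'

variable {E₀ : Type*} [NormedAddCommGroup E₀] [NormedSpace ℝ E₀]
variable {E₁ : Type*} [NormedAddCommGroup E₁] [NormedSpace ℝ E₁]
variable {E₂ : Type*} [NormedAddCommGroup E₂] [NormedSpace ℝ E₂]

/-- The map `(t, x, y) ↦ (A e^{iC²s(t)} G₁(x), C e^{iA²s(t)} G₂(y))`. -/
def twistedProduct (ι₁ : V₁ →L[ℝ] V) (ι₂ : V₂ →L[ℝ] V) (A C : ℝ) (s : E₀ → ℝ) (G₁ : E₁ → V₁)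
    (G₂ : E₂ → V₂) (Y : E₀ × E₁ × E₂) : V :=
  ι₁ (phase A (C ^ 2) (s Y.1) • G₁ Y.2.1) + ι₂ (phase C (A ^ 2) (s Y.1) • G₂ Y.2.2)

variable {ι₁ : V₁ →L[ℝ] V} {ι₂ : V₂ →L[ℝ] V} {A C : ℝ} {s : E₀ → ℝ} {G₁ : E₁ → V₁} {G₂ : E₂ → V₂}

omit [NormedSpace ℂ V] in
lemma fderiv_twistedProduct {Y : E₀ × E₁ × E₂} (hs : DifferentiableAt ℝ s Y.1)
    (h₁ : DifferentiableAt ℝ G₁ Y.2.1) (h₂ : DifferentiableAt ℝ G₂ Y.2.2) (u : E₀ × E₁ × E₂) :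
    fderiv ℝ (twistedProduct ι₁ ι₂ A C s G₁ G₂) Y u =
      ι₁ (phase A (C ^ 2) (s Y.1) •
        ((C ^ 2 * fderiv ℝ s Y.1 u.1) • Complex.I • G₁ Y.2.1 + fderiv ℝ G₁ Y.2.1 u.2.1)) +
      ι₂ (phase C (A ^ 2) (s Y.1) •
        ((A ^ 2 * fderiv ℝ s Y.1 u.1) • Complex.I • G₂ Y.2.2 + fderiv ℝ G₂ Y.2.2 u.2.2)) := by
  let p₀ := ContinuousLinearMap.fst ℝ E₀ (E₁ × E₂)
  let p₁ := (ContinuousLinearMap.fst ℝ E₁ E₂).comp (ContinuousLinearMap.snd ℝ E₀ (E₁ × E₂))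
  let p₂ := (ContinuousLinearMap.snd ℝ E₁ E₂).comp (ContinuousLinearMap.snd ℝ E₀ (E₁ × E₂))
  have d₀ : DifferentiableAt ℝ (s ∘ p₀) Y := DifferentiableAt.comp Y hs p₀.differentiableAt
  have d₁ : DifferentiableAt ℝ (G₁ ∘ p₁) Y := DifferentiableAt.comp Y h₁ p₁.differentiableAt
  have d₂ : DifferentiableAt ℝ (G₂ ∘ p₂) Y := DifferentiableAt.comp Y h₂ p₂.differentiableAt
  obtain ⟨t₁, e₁⟩ := hasFDerivAt_twist (c := A) (a := C ^ 2) d₀ d₁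
  obtain ⟨t₂, e₂⟩ := hasFDerivAt_twist (c := C) (a := A ^ 2) d₀ d₂
  have hD := (ι₁.hasFDerivAt.comp Y t₁.hasFDerivAt).add (ι₂.hasFDerivAt.comp Y t₂.hasFDerivAt)
  have e := congrArg (fun L => L u) hD.fderiv
  simp only [add_apply, ContinuousLinearMap.comp_apply, e₁, e₂, fderiv_comp_clm p₀ hs,
    fderiv_comp_clm p₁ h₁, fderiv_comp_clm p₂ h₂] at e
  exact e

omit [NormedSpace ℂ V] in
lemma contDiffAt_twistedProduct {Y : E₀ × E₁ × E₂} (hs : ContDiffAt ℝ ∞ s Y.1)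
    (h₁ : ContDiffAt ℝ ∞ G₁ Y.2.1) (h₂ : ContDiffAt ℝ ∞ G₂ Y.2.2) :
    ContDiffAt ℝ ∞ (twistedProduct ι₁ ι₂ A C s G₁ G₂) Y := by
  have d₀ : ContDiffAt ℝ ∞ (fun Y : E₀ × E₁ × E₂ => s Y.1) Y := hs.comp Y contDiffAt_fst
  have d₁ : ContDiffAt ℝ ∞ (fun Y : E₀ × E₁ × E₂ => G₁ Y.2.1) Y :=
    h₁.comp Y (contDiffAt_fst.comp Y contDiffAt_snd)
  have d₂ : ContDiffAt ℝ ∞ (fun Y : E₀ × E₁ × E₂ => G₂ Y.2.2) Y :=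
    h₂.comp Y (contDiffAt_snd.comp Y contDiffAt_snd)
  exact (ι₁.contDiff.contDiffAt.comp Y (contDiffAt_twist d₀ d₁)).add
    (ι₂.contDiff.contDiffAt.comp Y (contDiffAt_twist d₀ d₂))

omit [NormedSpace ℂ V] in
lemma hessian_twistedProduct {Y : E₀ × E₁ × E₂} (hs : ContDiffAt ℝ ∞ s Y.1)
    (h₁ : ContDiffAt ℝ ∞ G₁ Y.2.1) (h₂ : ContDiffAt ℝ ∞ G₂ Y.2.2) (u v : E₀ × E₁ × E₂) :
    hessian (twistedProduct ι₁ ι₂ A C s G₁ G₂) Y u v =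
      ι₁ (phase A (C ^ 2) (s Y.1) • ((C ^ 2 * fderiv ℝ s Y.1 u.1) • Complex.I •
          ((C ^ 2 * fderiv ℝ s Y.1 v.1) • Complex.I • G₁ Y.2.1 + fderiv ℝ G₁ Y.2.1 v.2.1)
        + ((C ^ 2 * fderiv ℝ s Y.1 v.1) • Complex.I • fderiv ℝ G₁ Y.2.1 u.2.1
          + (C ^ 2 * hessian s Y.1 u.1 v.1) • Complex.I • G₁ Y.2.1
          + hessian G₁ Y.2.1 u.2.1 v.2.1))) +
      ι₂ (phase C (A ^ 2) (s Y.1) • ((A ^ 2 * fderiv ℝ s Y.1 u.1) • Complex.I •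
          ((A ^ 2 * fderiv ℝ s Y.1 v.1) • Complex.I • G₂ Y.2.2 + fderiv ℝ G₂ Y.2.2 v.2.2)
        + ((A ^ 2 * fderiv ℝ s Y.1 v.1) • Complex.I • fderiv ℝ G₂ Y.2.2 u.2.2
          + (A ^ 2 * hessian s Y.1 u.1 v.1) • Complex.I • G₂ Y.2.2
          + hessian G₂ Y.2.2 u.2.2 v.2.2))) := by
  let p₀ := ContinuousLinearMap.fst ℝ E₀ (E₁ × E₂)
  let p₁ := (ContinuousLinearMap.fst ℝ E₁ E₂).comp (ContinuousLinearMap.snd ℝ E₀ (E₁ × E₂))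
  let p₂ := (ContinuousLinearMap.snd ℝ E₁ E₂).comp (ContinuousLinearMap.snd ℝ E₀ (E₁ × E₂))
  have d₀ : ContDiffAt ℝ ∞ (s ∘ p₀) Y := ContDiffAt.comp Y hs p₀.contDiff.contDiffAt
  have d₁ : ContDiffAt ℝ ∞ (G₁ ∘ p₁) Y := ContDiffAt.comp Y h₁ p₁.contDiff.contDiffAt
  have d₂ : ContDiffAt ℝ ∞ (G₂ ∘ p₂) Y := ContDiffAt.comp Y h₂ p₂.contDiff.contDiffAt
  have t₁ := contDiffAt_twist (c := A) (a := C ^ 2) d₀ d₁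
  have t₂ := contDiffAt_twist (c := C) (a := A ^ 2) d₀ d₂
  have hsplit : hessian (twistedProduct ι₁ ι₂ A C s G₁ G₂) Y u v =
      ι₁ (hessian (twist A (C ^ 2) (s ∘ p₀) (G₁ ∘ p₁)) Y u v) +
      ι₂ (hessian (twist C (A ^ 2) (s ∘ p₀) (G₂ ∘ p₂)) Y u v) := by
    have c₁ : ContDiffAt ℝ ∞ (ι₁ ∘ twist A (C ^ 2) (s ∘ p₀) (G₁ ∘ p₁)) Y :=
      ι₁.contDiff.contDiffAt.comp Y t₁
    have c₂ : ContDiffAt ℝ ∞ (ι₂ ∘ twist C (A ^ 2) (s ∘ p₀) (G₂ ∘ p₂)) Y :=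
      ι₂.contDiff.contDiffAt.comp Y t₂
    have k₁ := hessian_comp ι₁.contDiff.contDiffAt t₁ u v
    have k₂ := hessian_comp ι₂.contDiff.contDiffAt t₂ u v
    rw [hessian_clm, zero_add, ContinuousLinearMap.fderiv] at k₁ k₂
    rw [← k₁, ← k₂]
    have e1 := ((c₁.of_le (m := 1) (by norm_cast)).eventually (by simp))
    have e2 := ((c₂.of_le (m := 1) (by norm_cast)).eventually (by simp))
    have hev : fderiv ℝ (twistedProduct ι₁ ι₂ A C s G₁ G₂) =ᶠ[nhds Y]
        fderiv ℝ (ι₁ ∘ twist A (C ^ 2) (s ∘ p₀) (G₁ ∘ p₁)) +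
          fderiv ℝ (ι₂ ∘ twist C (A ^ 2) (s ∘ p₀) (G₂ ∘ p₂)) := by
      filter_upwards [e1, e2] with x hx1 hx2
      exact fderiv_add (hx1.differentiableAt (by simp)) (hx2.differentiableAt (by simp))
    rw [hessian, hev.fderiv_eq, fderiv_add
      ((c₁.fderiv_right (m := ∞) (by simp)).differentiableAt (by simp))
      ((c₂.fderiv_right (m := ∞) (by simp)).differentiableAt (by simp))]
    rfl
  rw [hsplit, hessian_twist d₀ d₁, hessian_twist d₀ d₂]
  simp only [fderiv_comp_clm p₀ (hs.differentiableAt (by simp)),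
    fderiv_comp_clm p₁ (h₁.differentiableAt (by simp)),
    fderiv_comp_clm p₂ (h₂.differentiableAt (by simp)),
    hessian_comp_clm p₀ hs, hessian_comp_clm p₁ h₁, hessian_comp_clm p₂ h₂]
  rfl

variable {B : V →L[ℝ] V →L[ℝ] ℝ} {B₁ : V₁ →L[ℝ] V₁ →L[ℝ] ℝ} {B₂ : V₂ →L[ℝ] V₂ →L[ℝ] ℝ}

lemma IsOrthogonalSum.form_phase (hι : IsOrthogonalSum B B₁ B₂ ι₁ ι₂) (hB₁ : IsHermitianRe B₁)
    (hB₂ : IsHermitianRe B₂) (x : ℝ) (z z' : V₁) (w w' : V₂) :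
    B (ι₁ (phase A (C ^ 2) x • z) + ι₂ (phase C (A ^ 2) x • w))
      (ι₁ (phase A (C ^ 2) x • z') + ι₂ (phase C (A ^ 2) x • w')) =
      A ^ 2 * B₁ z z' + C ^ 2 * B₂ w w' := by
  rw [hι.form, hB₁.map_smul_smul, hB₂.map_smul_smul, normSq_phase, normSq_phase]

omit [IsScalarTower ℝ ℂ V₁] [IsScalarTower ℝ ℂ V₂] in
lemma IsOrthogonalSum.I_smul_phase (hι : IsOrthogonalSum B B₁ B₂ ι₁ ι₂) (x : ℝ) (z : V₁) (w : V₂) :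
    Complex.I • (ι₁ (phase A (C ^ 2) x • z) + ι₂ (phase C (A ^ 2) x • w)) =
      ι₁ (phase A (C ^ 2) x • Complex.I • z) + ι₂ (phase C (A ^ 2) x • Complex.I • w) := by
  rw [smul_add, ← hι.map_I₁, ← hι.map_I₂, smul_comm Complex.I, smul_comm Complex.I]

variable {F₁ : E₁ → V₁} {F₂ : E₂ → V₂} {U₀ : Set E₀} {U₁ : Set E₁} {U₂ : Set E₂}
variable (hι : IsOrthogonalSum B B₁ B₂ ι₁ ι₂) (hB₁ : IsHermitianRe B₁) (hB₂ : IsHermitianRe B₂)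
  (hA : 0 < A) (hC : 0 < C) (hAC : C ^ 2 = A ^ 2 + 1) (hs : IsLineCoordinate s U₀)
  (hF₁ : IsLegendrianOn B₁ 1 F₁ U₁) (hF₂ : IsLegendrianOn B₂ (-1) F₂ U₂)
include hι hB₁ hB₂ hAC hs hF₁ hF₂

/-- The phases contribute only the moduli A² and C², and mixed terms vanish because both factors are
Legendrian. The ds² coefficient is A²C⁴ − C²A⁴ = A²C²(C² − A²) = A²C²; the minus sign comes from the
negative position vector F₂. -/
lemma pullbackForm_twistedProduct {Y : E₀ × E₁ × E₂} (hY : Y ∈ U₀ ×ˢ U₁ ×ˢ U₂)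
    (u v : E₀ × E₁ × E₂) :
    pullbackForm B (twistedProduct ι₁ ι₂ A C s F₁ F₂) Y u v =
      A ^ 2 * C ^ 2 * (fderiv ℝ s Y.1 u.1 * fderiv ℝ s Y.1 v.1) +
        (A ^ 2 * pullbackForm B₁ F₁ Y.2.1 u.2.1 v.2.1 +
          C ^ 2 * pullbackForm B₂ F₂ Y.2.2 u.2.2 v.2.2) := by
  obtain ⟨h0, h1, h2⟩ := hY
  have s0 := (hs.smooth.contDiffAt (hs.isOpen.mem_nhds h0)).differentiableAt (by simp)
  rw [pullbackForm, fderiv_twistedProduct s0 (hF₁.differentiableAt h1) (hF₂.differentiableAt h2),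
    fderiv_twistedProduct s0 (hF₁.differentiableAt h1) (hF₂.differentiableAt h2),
    hι.form_phase hB₁ hB₂]
  have a₁ : ∀ v, B₁ (Complex.I • F₁ Y.2.1) (fderiv ℝ F₁ Y.2.1 v) = 0 := fun v => by
    rw [hB₁.symm, hF₁.legendrian _ h1]
  have a₂ : ∀ v, B₂ (Complex.I • F₂ Y.2.2) (fderiv ℝ F₂ Y.2.2 v) = 0 := fun v => by
    rw [hB₂.symm, hF₂.legendrian _ h2]
  simp only [map_add, map_smul, add_apply, smul_apply, smul_eq_mul, hB₁.map_I, hB₂.map_I,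
    hF₁.mem _ h1, hF₂.mem _ h2, a₁, a₂, hF₁.legendrian _ h1, hF₂.legendrian _ h2, pullbackForm]
  rw [hAC]
  ring

include hA hC

/-- The rotation speeds C² and A² are matched to the amplitudes: the two contributions to ⟨∂ₛΨ, JΨ⟩
are A²C² and −C²A². The quadric equation is A² − C² = −1. -/
lemma isLegendrianOn_twistedProduct :
    IsLegendrianOn B (-1) (twistedProduct ι₁ ι₂ A C s F₁ F₂) (U₀ ×ˢ U₁ ×ˢ U₂) where
  isOpen := hs.isOpen.prod (hF₁.isOpen.prod hF₂.isOpen)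
  smooth := fun Y hY => (contDiffAt_twistedProduct
    (hs.smooth.contDiffAt (hs.isOpen.mem_nhds hY.1)) (hF₁.contDiffAt hY.2.1)
    (hF₂.contDiffAt hY.2.2)).contDiffWithinAt
  mem := by
    rintro Y ⟨h0, h1, h2⟩
    rw [twistedProduct, hι.form_phase hB₁ hB₂, hF₁.mem _ h1, hF₂.mem _ h2, hAC]
    ring
  legendrian := by
    rintro Y ⟨h0, h1, h2⟩ u
    have s0 := (hs.smooth.contDiffAt (hs.isOpen.mem_nhds h0)).differentiableAt (by simp)
    rw [fderiv_twistedProduct s0 (hF₁.differentiableAt h1) (hF₂.differentiableAt h2),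
      twistedProduct, hι.I_smul_phase, hι.form_phase hB₁ hB₂]
    simp only [map_add, map_smul, add_apply, smul_apply, smul_eq_mul, hB₁.map_I, hB₂.map_I,
      hF₁.mem _ h1, hF₂.mem _ h2, hF₁.legendrian _ h1, hF₂.legendrian _ h2]
    ring
  pos := by
    intro Y hY u hu
    have hY' := hY
    obtain ⟨h0, h1, h2⟩ := hY'
    have := pullbackForm_twistedProduct hι hB₁ hB₂ hAC hs hF₁ hF₂ hY u u
    rw [pullbackForm] at this
    rw [this]
    exact (((hs.isScalarProduct h0).const_mul (by positivity)).prod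
      (((hF₁.scalarProduct h1 hB₁).const_mul (by positivity)).prod
        ((hF₂.scalarProduct h2 hB₂).const_mul (by positivity)))).pos u hu

variable [FiniteDimensional ℝ E₀] [FiniteDimensional ℝ E₁] [FiniteDimensional ℝ E₂]

lemma metricTrace_twistedProduct {W : Type*} [AddCommGroup W] [Module ℝ W]
    {Y : E₀ × E₁ × E₂} (hY : Y ∈ U₀ ×ˢ U₁ ×ˢ U₂) {e : E₀} (he : fderiv ℝ s Y.1 e = 1)
    (he' : ∀ u : E₀, ∃ c : ℝ, u = c • e) {b : E₀ × E₁ × E₂ → E₀ × E₁ × E₂ → W} (hb : IsBilin b) :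
    metricTrace (pullbackForm B (twistedProduct ι₁ ι₂ A C s F₁ F₂) Y) b =
      (A ^ 2 * C ^ 2)⁻¹ • b (e, 0) (e, 0) +
      ((A ^ 2)⁻¹ • metricTrace (pullbackForm B₁ F₁ Y.2.1) (fun u v => b (0, u, 0) (0, v, 0)) +
        (C ^ 2)⁻¹ • metricTrace (pullbackForm B₂ F₂ Y.2.2) fun u v => b (0, 0, u) (0, 0, v)) := by
  have h0 := hs.isScalarProduct hY.1
  have h1 := hF₁.scalarProduct hY.2.1 hB₁
  have h2 := hF₂.scalarProduct hY.2.2 hB₂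
  have hA2 : 0 < A ^ 2 := by positivity
  have hC2 : 0 < C ^ 2 := by positivity
  have hAC2 : 0 < A ^ 2 * C ^ 2 := by positivity
  have b0 : IsBilin fun u v : E₀ => b (u, 0) (v, 0) := hb.comp (LinearMap.inl ℝ E₀ (E₁ × E₂))
  have b12 : IsBilin fun u v : E₁ × E₂ => b (0, u) (0, v) :=
    hb.comp (LinearMap.inr ℝ E₀ (E₁ × E₂))
  rw [metricTrace_prod (h0.const_mul hAC2) ((h1.const_mul hA2).prod (h2.const_mul hC2))
    (pullbackForm_twistedProduct hι hB₁ hB₂ hAC hs hF₁ hF₂ hY) hb,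
    metricTrace_prod (h1.const_mul hA2) (h2.const_mul hC2) (fun _ _ => rfl) b12,
    metricTrace_rescale hAC2.ne', metricTrace_rescale hA2.ne', metricTrace_rescale hC2.ne',
    metricTrace_line e he' h0 (by simp [he]) b0]

set_option maxHeartbeats 1000000 in
/-- The Maslov field of a twisted product is a twisted product. -/
lemma maslovField_twistedProduct [SMulCommClass ℂ ℝ V] : ∃ k : ℝ, ∀ Y ∈ U₀ ×ˢ U₁ ×ˢ U₂,
    maslovField B (twistedProduct ι₁ ι₂ A C s F₁ F₂) Y =
      twistedProduct ι₁ ι₂ A C s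
        (fun x => (k * C ^ 2) • Complex.I • F₁ x + (A ^ 2)⁻¹ • maslovField B₁ F₁ x)
        (fun y => (k * A ^ 2) • Complex.I • F₂ y + (C ^ 2)⁻¹ • maslovField B₂ F₂ y) Y := by
  have hA2 : A ^ 2 ≠ 0 := by positivity
  have hC2 : C ^ 2 ≠ 0 := by positivity
  -- k is B(tr hess Ψ, J dΨ(e)) divided by |dΨ(e)|² = A²C², where ds(e) = 1. It depends on A, C and
  -- the dimensions only, since tr hess Fᵢ has radial pairing −dim Eᵢ.
  refine ⟨(A ^ 2 * C ^ 2)⁻¹ * (A ^ 2 * C ^ 2 * ((A ^ 2 * C ^ 2)⁻¹ * (C ^ 2) ^ 2 +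
      (A ^ 2)⁻¹ * Module.finrank ℝ E₁) + C ^ 2 * A ^ 2 * (-((A ^ 2 * C ^ 2)⁻¹ * (A ^ 2) ^ 2) +
      (C ^ 2)⁻¹ * Module.finrank ℝ E₂)), fun Y hY => ?_⟩
  obtain ⟨h0, h1, h2⟩ := hY
  have hY : Y ∈ U₀ ×ˢ U₁ ×ˢ U₂ := ⟨h0, h1, h2⟩
  obtain ⟨e, he, he'⟩ := hs.exists_unit _ h0
  have ss := hs.smooth.contDiffAt (hs.isOpen.mem_nhds h0)
  have sd := ss.differentiableAt (by simp)
  have g₁ := hF₁.scalarProduct h1 hB₁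
  have g₂ := hF₂.scalarProduct h2 hB₂
  set Ψ := twistedProduct ι₁ ι₂ A C s F₁ F₂ with hΨ
  set q₁ := phase A (C ^ 2) (s Y.1) with hq₁
  set q₂ := phase C (A ^ 2) (s Y.1) with hq₂
  have hdΨ : ∀ u, fderiv ℝ Ψ Y u = ι₁ (q₁ • ((C ^ 2 * fderiv ℝ s Y.1 u.1) • Complex.I • F₁ Y.2.1 +
        fderiv ℝ F₁ Y.2.1 u.2.1)) + ι₂ (q₂ • ((A ^ 2 * fderiv ℝ s Y.1 u.1) • Complex.I • F₂ Y.2.2 +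
        fderiv ℝ F₂ Y.2.2 u.2.2)) :=
    fderiv_twistedProduct sd (hF₁.differentiableAt h1) (hF₂.differentiableAt h2)
  have hhΨ := hessian_twistedProduct (ι₁ := ι₁) (ι₂ := ι₂) (A := A) (C := C) ss (hF₁.contDiffAt h1)
    (hF₂.contDiffAt h2)
  set L₁ := metricTrace (pullbackForm B₁ F₁ Y.2.1) (hessian F₁ Y.2.1) with hL₁
  set L₂ := metricTrace (pullbackForm B₂ F₂ Y.2.2) (hessian F₂ Y.2.2) with hL₂
  -- m₁ and m₂ are the two components of tr hess Ψ with the phases stripped. The terms in `hessian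
  -- s` appear because s need not be affine in the chart; they point along JFᵢ and drop out of every
  -- pairing below.
  let m₁ : V₁ := (A ^ 2 * C ^ 2)⁻¹ • (-((C ^ 2) ^ 2) • F₁ Y.2.1 +
    (C ^ 2 * hessian s Y.1 e e) • Complex.I • F₁ Y.2.1) + (A ^ 2)⁻¹ • L₁
  let m₂ : V₂ := (A ^ 2 * C ^ 2)⁻¹ • (-((A ^ 2) ^ 2) • F₂ Y.2.2 +
    (A ^ 2 * hessian s Y.1 e e) • Complex.I • F₂ Y.2.2) + (C ^ 2)⁻¹ • L₂
  let J₁ : V₁ →ₗ[ℝ] V := ι₁.toLinearMap ∘ₗ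
    (LinearMap.lsmul ℂ V₁ q₁).restrictScalars ℝ
  let J₂ : V₂ →ₗ[ℝ] V := ι₂.toLinearMap ∘ₗ
    (LinearMap.lsmul ℂ V₂ q₂).restrictScalars ℝ
  have hJ₁ : ∀ z, ι₁ (q₁ • z) = J₁ z := fun _ => rfl
  have hJ₂ : ∀ z, ι₂ (q₂ • z) = J₂ z := fun _ => rfl
  have hII₁ : ∀ z : V₁, Complex.I • Complex.I • z = - z := fun z => by
    rw [smul_smul, Complex.I_mul_I, neg_one_smul]
  have hII₂ : ∀ z : V₂, Complex.I • Complex.I • z = - z := fun z => by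
    rw [smul_smul, Complex.I_mul_I, neg_one_smul]
  have trace_hess : metricTrace (pullbackForm B Ψ Y) (hessian Ψ Y) = J₁ m₁ + J₂ m₂ := by
    rw [hΨ, metricTrace_twistedProduct hι hB₁ hB₂ hA hC hAC hs hF₁ hF₂ hY he he'
      (by constructor <;> intros <;> simp [hessian])]
    simp only [hhΨ, he, Prod.fst_zero, Prod.snd_zero, map_zero, mul_zero, zero_smul, mul_one,
      smul_zero, zero_add, add_zero, ← hq₁, ← hq₂, hJ₁, hJ₂, hII₁, hII₂,
      smul_comm Complex.I (_ : ℝ)]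
    have z₁ : ∀ v, hessian F₁ Y.2.1 0 v = 0 := fun v => by simp [hessian]
    have z₂ : ∀ v, hessian F₂ Y.2.2 0 v = 0 := fun v => by simp [hessian]
    have z₀ : ∀ v, hessian s Y.1 0 v = 0 := fun v => by simp [hessian]
    simp only [z₀, z₁, z₂, add_zero, map_zero, zero_add, mul_zero, zero_smul]
    rw [← map_metricTrace J₁ _ (fun u v => hessian F₁ Y.2.1 u v),
      ← map_metricTrace J₂ _ (fun u v => hessian F₂ Y.2.2 u v)]
    simp only [m₁, m₂, map_add, map_smul, map_neg, smul_add, smul_neg, neg_smul, smul_smul, hL₁,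
      hL₂]
    ring_nf
    abel
  have o₁ : ∀ v, B₁ (F₁ Y.2.1) (Complex.I • fderiv ℝ F₁ Y.2.1 v) = 0 := fun v => by
    have := hB₁.I_left (F₁ Y.2.1) (fderiv ℝ F₁ Y.2.1 v)
    rw [hB₁.symm, hF₁.legendrian _ h1] at this
    linarith
  have o₂ : ∀ v, B₂ (F₂ Y.2.2) (Complex.I • fderiv ℝ F₂ Y.2.2 v) = 0 := fun v => by
    have := hB₂.I_left (F₂ Y.2.2) (fderiv ℝ F₂ Y.2.2 v)
    rw [hB₂.symm, hF₂.legendrian _ h2] at this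
    linarith
  have f₁ : ∀ v, B₁ m₁ (Complex.I • fderiv ℝ F₁ Y.2.1 v) =
      (A ^ 2)⁻¹ * B₁ L₁ (Complex.I • fderiv ℝ F₁ Y.2.1 v) := by
    intro v
    simp [m₁, o₁, hB₁.map_I, hB₁.symm (F₁ Y.2.1), hF₁.tangent h1 hB₁]
  have f₂ : ∀ v, B₂ m₂ (Complex.I • fderiv ℝ F₂ Y.2.2 v) =
      (C ^ 2)⁻¹ * B₂ L₂ (Complex.I • fderiv ℝ F₂ Y.2.2 v) := by
    intro v
    simp [m₂, o₂, hB₂.map_I, hB₂.symm (F₂ Y.2.2), hF₂.tangent h2 hB₂]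
  have t₁ : B₁ L₁ (F₁ Y.2.1) = - Module.finrank ℝ E₁ := by
    change (B₁.flip (F₁ Y.2.1) : V₁ →ₗ[ℝ] ℝ) L₁ = _
    rw [hL₁, map_metricTrace, ← g₁.metricTrace_self, ← metricTrace_neg]
    congr 1
    funext u v
    exact hF₁.hessian_radial h1 hB₁ u v
  have t₂ : B₂ L₂ (F₂ Y.2.2) = - Module.finrank ℝ E₂ := by
    change (B₂.flip (F₂ Y.2.2) : V₂ →ₗ[ℝ] ℝ) L₂ = _
    rw [hL₂, map_metricTrace, ← g₂.metricTrace_self, ← metricTrace_neg]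
    congr 1
    funext u v
    exact hF₂.hessian_radial h2 hB₂ u v
  have r₁ : B₁ m₁ (F₁ Y.2.1) = -((A ^ 2 * C ^ 2)⁻¹ * (C ^ 2) ^ 2) -
      (A ^ 2)⁻¹ * Module.finrank ℝ E₁ := by
    simp only [m₁, map_add, map_smul, add_apply, smul_apply, smul_eq_mul, hF₁.mem _ h1,
      hB₁.I_self, t₁]
    ring
  have r₂ : B₂ m₂ (F₂ Y.2.2) = (A ^ 2 * C ^ 2)⁻¹ * (A ^ 2) ^ 2 -
      (C ^ 2)⁻¹ * Module.finrank ℝ E₂ := by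
    simp only [m₂, map_add, map_smul, add_apply, smul_apply, smul_eq_mul, hF₂.mem _ h2,
      hB₂.I_self, t₂]
    ring
  have hpair : ∀ u, B (J₁ m₁ + J₂ m₂) (Complex.I • fderiv ℝ Ψ Y u) =
      A ^ 2 * (-(C ^ 2 * fderiv ℝ s Y.1 u.1) * B₁ m₁ (F₁ Y.2.1) +
        (A ^ 2)⁻¹ * B₁ L₁ (Complex.I • fderiv ℝ F₁ Y.2.1 u.2.1)) +
      C ^ 2 * (-(A ^ 2 * fderiv ℝ s Y.1 u.1) * B₂ m₂ (F₂ Y.2.2) +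
        (C ^ 2)⁻¹ * B₂ L₂ (Complex.I • fderiv ℝ F₂ Y.2.2 u.2.2)) := by
    intro u
    rw [hdΨ, hι.I_smul_phase, ← hJ₁, ← hJ₂, hι.form_phase hB₁ hB₂]
    simp only [smul_add, smul_comm Complex.I (_ : ℝ), hII₁, hII₂, map_add, map_smul, map_neg, f₁,
      f₂, smul_eq_mul, smul_neg]
    ring
  rw [maslovField_eq_normalTrace, trace_hess]
  change metricTrace (pullbackForm B Ψ Y) (fun a b =>
    B (J₁ m₁ + J₂ m₂) (Complex.I • fderiv ℝ Ψ Y a) • fderiv ℝ Ψ Y b) = _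
  refine (metricTrace_twistedProduct hι hB₁ hB₂ hA hC hAC hs hF₁ hF₂ hY he he'
    (isBilin_normalTrace B (fderiv ℝ Ψ Y : E₀ × E₁ × E₂ →ₗ[ℝ] V) _)).trans ?_
  change _ = J₁ _ + J₂ _
  simp only [ContinuousLinearMap.coe_coe, hpair]
  simp only [hdΨ, he, Prod.fst_zero, Prod.snd_zero, map_zero, mul_zero, zero_mul, neg_zero,
    zero_smul, mul_one, smul_zero, zero_add, add_zero, hJ₁, hJ₂, r₁, r₂,
    mul_inv_cancel_left₀ hA2, mul_inv_cancel_left₀ hC2]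
  have n₁ : metricTrace (pullbackForm B₁ F₁ Y.2.1) (fun u v =>
      B₁ L₁ (Complex.I • fderiv ℝ F₁ Y.2.1 u) • J₁ (fderiv ℝ F₁ Y.2.1 v)) =
        J₁ (maslovField B₁ F₁ Y.2.1) := by
    rw [maslovField_eq_normalTrace, ← hL₁]
    refine Eq.trans ?_ (map_metricTrace J₁ (pullbackForm B₁ F₁ Y.2.1) fun u v =>
      B₁ L₁ (Complex.I • fderiv ℝ F₁ Y.2.1 u) • fderiv ℝ F₁ Y.2.1 v).symm
    simp only [map_smul]
  have n₂ : metricTrace (pullbackForm B₂ F₂ Y.2.2) (fun u v =>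
      B₂ L₂ (Complex.I • fderiv ℝ F₂ Y.2.2 u) • J₂ (fderiv ℝ F₂ Y.2.2 v)) =
        J₂ (maslovField B₂ F₂ Y.2.2) := by
    rw [maslovField_eq_normalTrace, ← hL₂]
    refine Eq.trans ?_ (map_metricTrace J₂ (pullbackForm B₂ F₂ Y.2.2) fun u v =>
      B₂ L₂ (Complex.I • fderiv ℝ F₂ Y.2.2 u) • fderiv ℝ F₂ Y.2.2 v).symm
    simp only [map_smul]
  rw [n₁, n₂]
  simp only [map_add, map_smul]
  match_scalars <;> ring

/-- Twisted products of C-minimal immersions are C-minimal. -/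
lemma maslovDiv_twistedProduct [SMulCommClass ℂ ℝ V] {Y : E₀ × E₁ × E₂}
    (hY : Y ∈ U₀ ×ˢ U₁ ×ˢ U₂) (h₁ : maslovDiv B₁ F₁ Y.2.1 = 0) (h₂ : maslovDiv B₂ F₂ Y.2.2 = 0) :
    maslovDiv B (twistedProduct ι₁ ι₂ A C s F₁ F₂) Y = 0 := by
  obtain ⟨k, hk⟩ := maslovField_twistedProduct hι hB₁ hB₂ hA hC hAC hs hF₁ hF₂
  obtain ⟨h0, h1, h2⟩ := hY
  have hY : Y ∈ U₀ ×ˢ U₁ ×ˢ U₂ := ⟨h0, h1, h2⟩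
  obtain ⟨e, he, he'⟩ := hs.exists_unit _ h0
  have hA2 : A ^ 2 ≠ 0 := by positivity
  have hC2 : C ^ 2 ≠ 0 := by positivity
  have sd := (hs.smooth.contDiffAt (hs.isOpen.mem_nhds h0)).differentiableAt (by simp)
  have hopen : IsOpen (U₀ ×ˢ U₁ ×ˢ U₂) := hs.isOpen.prod (hF₁.isOpen.prod hF₂.isOpen)
  have hev : maslovField B (twistedProduct ι₁ ι₂ A C s F₁ F₂) =ᶠ[nhds Y]
      twistedProduct ι₁ ι₂ A C s
        (fun x => (k * C ^ 2) • Complex.I • F₁ x + (A ^ 2)⁻¹ • maslovField B₁ F₁ x)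
        (fun y => (k * A ^ 2) • Complex.I • F₂ y + (C ^ 2)⁻¹ • maslovField B₂ F₂ y) := by
    filter_upwards [hopen.mem_nhds hY] with x hx using hk x hx
  have dF₁ := hF₁.differentiableAt h1
  have dF₂ := hF₂.differentiableAt h2
  have dM₁ := hF₁.differentiableAt_maslovField hB₁ h1
  have dM₂ := hF₂.differentiableAt_maslovField hB₂ h2
  have a₁ := ((dF₁.hasFDerivAt.const_smul Complex.I).const_smul (k * C ^ 2)).add
    (dM₁.hasFDerivAt.const_smul (A ^ 2)⁻¹)
  have a₂ := ((dF₂.hasFDerivAt.const_smul Complex.I).const_smul (k * A ^ 2)).add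
    (dM₂.hasFDerivAt.const_smul (C ^ 2)⁻¹)
  have hD := fun u => fderiv_twistedProduct (ι₁ := ι₁) (ι₂ := ι₂) (A := A) (C := C) sd
    a₁.differentiableAt a₂.differentiableAt u
  rw [a₁.fderiv, a₂.fderiv] at hD
  -- The s-direction contributes nothing to the divergence: JF₁ and the Maslov field are both
  -- orthogonal to F₁, and J is an isometry.
  have p₁ : B₁ (Complex.I • ((k * C ^ 2) • Complex.I • F₁ Y.2.1 +
      (A ^ 2)⁻¹ • maslovField B₁ F₁ Y.2.1)) (Complex.I • F₁ Y.2.1) = 0 := by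
    simp [hB₁.map_I, hB₁.I_self, (hF₁.maslovField_horizontal hB₁ h1).1]
  have p₂ : B₂ (Complex.I • ((k * A ^ 2) • Complex.I • F₂ Y.2.2 +
      (C ^ 2)⁻¹ • maslovField B₂ F₂ Y.2.2)) (Complex.I • F₂ Y.2.2) = 0 := by
    simp [hB₂.map_I, hB₂.I_self, (hF₂.maslovField_horizontal hB₂ h2).1]
  -- Along a factor, the ∂ₛ part of the field has derivative proportional to J dFᵢ, which is normal.
  -- Only the divergences of the factors' Maslov fields survive.
  have q₁ : ∀ u v, B₁ (Complex.I • fderiv ℝ F₁ Y.2.1 u) (fderiv ℝ F₁ Y.2.1 v) = 0 := fun u v => by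
    rw [hB₁.symm, hF₁.lagrangian h1 hB₁]
  have q₂ : ∀ u v, B₂ (Complex.I • fderiv ℝ F₂ Y.2.2 u) (fderiv ℝ F₂ Y.2.2 v) = 0 := fun u v => by
    rw [hB₂.symm, hF₂.lagrangian h2 hB₂]
  rw [maslovDiv, metricTrace_twistedProduct hι hB₁ hB₂ hA hC hAC hs hF₁ hF₂ hY he he'
    (by constructor <;> intros <;> simp), hev.fderiv_eq]
  have hD' : ∀ u, fderiv ℝ (twistedProduct ι₁ ι₂ A C s
        (fun x => (k * C ^ 2) • Complex.I • F₁ x + (A ^ 2)⁻¹ • maslovField B₁ F₁ x)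
        (fun y => (k * A ^ 2) • Complex.I • F₂ y + (C ^ 2)⁻¹ • maslovField B₂ F₂ y)) Y u = _ := hD
  simp only [hD', fderiv_twistedProduct sd dF₁ dF₂, hι.form_phase hB₁ hB₂]
  simp only [he, Prod.fst_zero, Prod.snd_zero, map_zero, mul_zero, mul_one,
    zero_smul, zero_add, add_zero]
  simp only [map_smul, smul_apply, smul_eq_mul, add_apply, map_add]
  simp only [Pi.add_apply, Pi.smul_apply, p₁, p₂, q₁, q₂, mul_zero, zero_add, add_zero,
    mul_inv_cancel_left₀ hA2, mul_inv_cancel_left₀ hC2]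
  change (A ^ 2)⁻¹ * maslovDiv B₁ F₁ Y.2.1 + (C ^ 2)⁻¹ * maslovDiv B₂ F₂ Y.2.2 = 0
  rw [h₁, h₂, mul_zero, mul_zero, add_zero]

end TwistedProduct

/-! ### Angular coordinates of the circle -/

noncomputable section Angle

attribute [local instance] finrank_real_complex_fact'

lemma contMDiff_circle_coe : ContMDiff (𝓡 1) 𝓘(ℝ, ℂ) ∞ (fun z : Circle => (z : ℂ)) :=
  contMDiff_coe_sphere (E := ℂ) (n := 1)

/-- The angle is a coordinate of the circle near any of its points. -/
lemma exists_isLineCoordinate_circle (z₀ : Circle) :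
    ∃ (s : EuclideanSpace ℝ (Fin 1) → ℝ) (U₀ : Set (EuclideanSpace ℝ (Fin 1))),
      U₀ ⊆ (extChartAt (𝓡 1) z₀).target ∧ extChartAt (𝓡 1) z₀ z₀ ∈ U₀ ∧ IsLineCoordinate s U₀ ∧
      ∀ t ∈ U₀, Circle.exp (s t) = (extChartAt (𝓡 1) z₀).symm t := by
  set κ := extChartAt (𝓡 1) z₀ with hκ
  -- Rotating the base point to 1 keeps nearby points in the slit plane, where the argument is
  -- smooth.
  set w : EuclideanSpace ℝ (Fin 1) → ℂ := fun t => ((z₀⁻¹ * κ.symm t : Circle) : ℂ) with hw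
  have hsm : ContDiffOn ℝ ∞ w κ.target := by
    have h := contDiffOn_comp_chart_symm (𝓡 1) contMDiff_circle_coe z₀
    have : w = fun t => ((z₀⁻¹ : Circle) : ℂ) * ((fun z : Circle => (z : ℂ)) ∘ κ.symm) t := by
      funext t; simp [hw]
    rw [this]
    exact contDiffOn_const.mul h
  have hwn : ∀ t, ‖w t‖ = 1 := fun t => Circle.norm_coe _
  set U₀ := κ.target ∩ w ⁻¹' Complex.slitPlane with hU₀
  set s : EuclideanSpace ℝ (Fin 1) → ℝ := fun t => Complex.arg z₀ + Complex.arg (w t) with hs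
  have hopen : IsOpen U₀ :=
    hsm.continuousOn.isOpen_inter_preimage (isOpen_extChartAt_target z₀) Complex.isOpen_slitPlane
  have hexp : ∀ t, Circle.exp (s t) = κ.symm t := by
    intro t
    rw [hs, Circle.exp_add, Circle.exp_arg, hw, Circle.exp_arg, mul_inv_cancel_left]
  have hss : ContDiffOn ℝ ∞ s U₀ := by
    have h1 : ContDiffOn ℝ ∞ (fun t => (Complex.log (w t)).im) U₀ := fun t ht =>
      Complex.imCLM.contDiff.comp_contDiffWithinAt
        (((Complex.contDiffAt_log ht.2).restrict_scalars ℝ).comp_contDiffWithinAt t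
          ((hsm t ht.1).mono Set.inter_subset_left))
    simp only [Complex.log_im] at h1
    exact contDiffOn_const.add h1
  refine ⟨s, U₀, Set.inter_subset_left, ⟨mem_extChartAt_target z₀, ?_⟩, ⟨hopen, hss, ?_⟩,
    fun t _ => hexp t⟩
  · have : w (κ z₀) = 1 := by
      simp only [hw, hκ, extChartAt_to_inv, inv_mul_cancel, Circle.coe_one]
    rw [Set.mem_preimage, this]
    exact Complex.one_mem_slitPlane
  · intro t ht
    have d1 : DifferentiableAt ℝ s t := (hss.contDiffAt (hopen.mem_nhds ht)).differentiableAt (by simp)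
    -- The chart composed with `Circle.exp` is a differentiable left inverse of s near t, so ds is
    -- injective. Hence the tangent space is spanned by the vector e with ds(e) = 1.
    have d2 : DifferentiableAt ℝ (fun x => κ (Circle.exp x)) (s t) := by
      have h1 : ContMDiffAt (𝓡 1) 𝓘(ℝ, EuclideanSpace ℝ (Fin 1)) ∞ κ (Circle.exp (s t)) := by
        refine contMDiffAt_extChartAt' ?_
        rw [hexp, ← extChartAt_source (𝓡 1)]
        exact κ.map_target ht.1
      have h2 : ContMDiffAt 𝓘(ℝ, ℝ) 𝓘(ℝ, EuclideanSpace ℝ (Fin 1)) ∞ (κ ∘ Circle.exp) (s t) :=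
        h1.comp (s t) contMDiff_circleExp.contMDiffAt
      exact h2.contDiffAt.differentiableAt (by simp)
    have hinj : ∀ u, fderiv ℝ s t u = 0 → u = 0 := by
      intro u hu
      have hev : (fun x => κ (Circle.exp x)) ∘ s =ᶠ[nhds t] id := by
        filter_upwards [hopen.mem_nhds ht] with x hx
        simp only [Function.comp, hexp, id]
        exact κ.right_inv hx.1
      have h := hev.fderiv_eq (𝕜 := ℝ)
      rw [fderiv_comp t d2 d1, fderiv_id] at h
      have h' := DFunLike.congr_fun h u
      simpa [hu] using h'.symm
    have hne : fderiv ℝ s t (EuclideanSpace.single 0 1) ≠ 0 := fun h => by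
      have := congrFun (congrArg WithLp.ofLp (hinj _ h)) 0
      simp at this
    refine ⟨(fderiv ℝ s t (EuclideanSpace.single 0 1))⁻¹ • EuclideanSpace.single 0 1, ?_, fun u =>
      ⟨fderiv ℝ s t u, sub_eq_zero.1 (hinj _ ?_)⟩⟩
    · simp [hne]
    · simp [hne]

end Angle

/-! ### Orthogonal sum decomposition of `ℂ^{n₁+1} ⊕ ℂ^{n₂+1}` -/

noncomputable section Append

/-- `z ↦ (z, 0)`. -/
def appendLeft (k l : ℕ) : (Fin k → ℂ) →L[ℝ] (Fin (k + l) → ℂ) :=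
  LinearMap.toContinuousLinearMap
    { toFun := fun z => Fin.append z 0
      map_add' := fun z w => by funext i; refine Fin.addCases (fun i => ?_) (fun i => ?_) i <;> simp
      map_smul' := fun c z => by funext i; refine Fin.addCases (fun i => ?_) (fun i => ?_) i <;> simp }

/-- `w ↦ (0, w)`. -/
def appendRight (k l : ℕ) : (Fin l → ℂ) →L[ℝ] (Fin (k + l) → ℂ) :=
  LinearMap.toContinuousLinearMap
    { toFun := fun w => Fin.append 0 w
      map_add' := fun z w => by funext i; refine Fin.addCases (fun i => ?_) (fun i => ?_) i <;> simp
      map_smul' := fun c z => by funext i; refine Fin.addCases (fun i => ?_) (fun i => ?_) i <;> simp }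

lemma appendLeft_apply {k l : ℕ} (z : Fin k → ℂ) : appendLeft k l z = Fin.append z 0 := rfl

lemma appendRight_apply {k l : ℕ} (w : Fin l → ℂ) : appendRight k l w = Fin.append 0 w := rfl

lemma appendLeft_add_appendRight {k l : ℕ} (z : Fin k → ℂ) (w : Fin l → ℂ) :
    appendLeft k l z + appendRight k l w = Fin.append z w := by
  funext i
  refine Fin.addCases (fun i => ?_) (fun i => ?_) i <;> simp [appendLeft_apply, appendRight_apply]

lemma append_smul {k l : ℕ} (c : ℂ) (z : Fin k → ℂ) (w : Fin l → ℂ) :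
    Fin.append (c • z) (c • w) = c • Fin.append z w := by
  funext i
  refine Fin.addCases (fun i => ?_) (fun i => ?_) i <;> simp

/-- The single negative coordinate of the sum is the last one of the second block. The index types
`Fin (k + l + 1)` and `Fin (k + (l + 1))` agree definitionally, and `h1`, `h2`, `h3` translate
between the two ways of splitting them. -/
lemma hermL_append {k l : ℕ} (a a' : Fin k → ℂ) (b b' : Fin (l + 1) → ℂ) :
    hermL (n := k + l) (@Fin.append k (l + 1) ℂ a b) (@Fin.append k (l + 1) ℂ a' b') = hermE a a' + hermL b b' := by
  have h1 : ∀ (a : Fin k → ℂ) (b : Fin (l + 1) → ℂ) (i : Fin k),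
      Fin.append a b (Fin.castSucc (Fin.castAdd l i)) = a i := fun a b i =>
    Fin.append_left a b i
  have h2 : ∀ (a : Fin k → ℂ) (b : Fin (l + 1) → ℂ) (i : Fin l),
      Fin.append a b (Fin.castSucc (Fin.natAdd k i)) = b i.castSucc := fun a b i =>
    Fin.append_right a b i.castSucc
  have h3 : ∀ (a : Fin k → ℂ) (b : Fin (l + 1) → ℂ),
      Fin.append a b (Fin.last (k + l)) = b (Fin.last l) := fun a b =>
    Fin.append_right a b (Fin.last l)
  unfold hermL hermE
  rw [Fin.sum_univ_add]
  simp only [h1, h2, h3]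
  ring

lemma isOrthogonalSum_append (k l : ℕ) :
    IsOrthogonalSum (formL (k + l)) (formE k) (formL l) (appendLeft k (l + 1))
      (appendRight k (l + 1)) where
  map_I₁ z := by
    have := append_smul Complex.I z (0 : Fin (l + 1) → ℂ)
    rwa [smul_zero] at this
  map_I₂ z := by
    have := append_smul Complex.I (0 : Fin k → ℂ) z
    rwa [smul_zero] at this
  form z w z' w' := by
    have := congrArg Complex.re (hermL_append z z' w w')
    rw [Complex.add_re, hermL_re, hermE_re, hermL_re] at this
    rw [← this]
    rw [← appendLeft_add_appendRight z w, ← appendLeft_add_appendRight z' w']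

end Append

/-! ### The H-minimal Lagrangian immersion built from two C-minimal Legendrian immersions -/

noncomputable section Construction

open ComplexHyperbolic

lemma ComplexHyperbolic.mk_smul {n : ℕ} {z w : Fin (n + 1) → ℂ} (hz : (hermL z z).re < 0)
    (hw : (hermL w w).re < 0) (c : ℂ) (h : c • w = z) :
    ComplexHyperbolic.mk z hz = ComplexHyperbolic.mk w hw :=
  Subtype.ext ((Projectivization.mk_eq_mk_iff' ℂ _ _ _ _).2 ⟨c, h⟩)

lemma affineProj_smul {n : ℕ} {c : ℂ} (hc : c ≠ 0) (z : Fin (n + 1) → ℂ) :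
    affineProj (c • z) = affineProj z := by
  funext i
  exact mul_div_mul_left _ _ hc

variable {n₁ n₂ : ℕ} {N₁ N₂ : Type*} {ψ₁ : N₁ → Fin (n₁ + 1) → ℂ} {ψ₂ : N₂ → Fin (n₂ + 1) → ℂ}

lemma hermL_append_smul {a b : ℂ} {A C : ℝ} (ha : Complex.normSq a = A ^ 2)
    (hb : Complex.normSq b = C ^ 2) (hAC : C ^ 2 = A ^ 2 + 1) {z : Fin (n₁ + 1) → ℂ}
    {w : Fin (n₂ + 1) → ℂ} (hz : hermE z z = 1) (hw : hermL w w = -1) :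
    hermL (n := n₁ + 1 + n₂) (@Fin.append (n₁ + 1) (n₂ + 1) ℂ (a • z) (b • w))
      (@Fin.append (n₁ + 1) (n₂ + 1) ℂ (a • z) (b • w)) = -1 := by
  rw [hermL_append, hermE_smul_left, hermE_smul_right, hz, hermL_smul_right]
  have : hermL (b • w) w = b * hermL w w := by
    simp only [hermL, Pi.smul_apply, smul_eq_mul, mul_sub, Finset.mul_sum, mul_assoc]
  rw [this, hw, mul_one, mul_neg, mul_neg, mul_one, Complex.mul_conj, mul_comm, Complex.mul_conj,
    ha, hb, hAC]
  push_cast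
  ring

/-- The lift `(A z ψ₁(p), C ψ₂(q))` of the immersion to anti-de Sitter space. -/
def productLift (A C : ℝ) (ψ₁ : N₁ → Fin (n₁ + 1) → ℂ) (ψ₂ : N₂ → Fin (n₂ + 1) → ℂ)
    (x : Circle × N₁ × N₂) : Fin (n₁ + 1 + n₂ + 1) → ℂ :=
  @Fin.append (n₁ + 1) (n₂ + 1) ℂ (((A : ℂ) * (x.1 : ℂ)) • ψ₁ x.2.1) ((C : ℂ) • ψ₂ x.2.2)

variable {A C : ℝ}

lemma hermL_productLift (hAC : C ^ 2 = A ^ 2 + 1) (h₁ : ∀ p, hermE (ψ₁ p) (ψ₁ p) = 1)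
    (h₂ : ∀ q, hermL (ψ₂ q) (ψ₂ q) = -1) (x : Circle × N₁ × N₂) :
    hermL (productLift A C ψ₁ ψ₂ x) (productLift A C ψ₁ ψ₂ x) = -1 :=
  hermL_append_smul (by simp [pow_two]) (by simp [pow_two]) hAC (h₁ _) (h₂ _)

/-- Pulling out e^{iA²s} leaves e^{i(C²−A²)s} = e^{is} on the first block and no phase on the
second. This is why the projected map depends on the point of the circle only, although the
Legendrian lift depends on s. -/
lemma append_phase (hAC : C ^ 2 = A ^ 2 + 1) (s : ℝ) (p : N₁) (q : N₂) :
    @Fin.append (n₁ + 1) (n₂ + 1) ℂ (phase A (C ^ 2) s • ψ₁ p) (phase C (A ^ 2) s • ψ₂ q) =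
      phase 1 (A ^ 2) s • productLift A C ψ₁ ψ₂ (Circle.exp s, p, q) := by
  rw [productLift, ← append_smul, smul_smul, smul_smul]
  congr 2
  · simp only [phase, Circle.coe_exp, hAC]
    push_cast
    rw [show Complex.I * (((A : ℂ) ^ 2 + 1) * s) = Complex.I * ((A : ℂ) ^ 2 * s) + s * Complex.I by
      ring, Complex.exp_add]
    ring
  · simp [phase]; ring

lemma phase_one_ne_zero (a s : ℝ) : phase 1 a s ≠ 0 := by simp [phase]

lemma twistedProduct_append {E₀ E₁ E₂ : Type*} [NormedAddCommGroup E₀] [NormedSpace ℝ E₀]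
    [NormedAddCommGroup E₁] [NormedSpace ℝ E₁] [NormedAddCommGroup E₂] [NormedSpace ℝ E₂]
    (hAC : C ^ 2 = A ^ 2 + 1) (s : E₀ → ℝ) (f₁ : E₁ → N₁) (f₂ : E₂ → N₂) (y : E₀ × E₁ × E₂) :
    twistedProduct (appendLeft (n₁ + 1) (n₂ + 1)) (appendRight (n₁ + 1) (n₂ + 1)) A C s (ψ₁ ∘ f₁)
      (ψ₂ ∘ f₂) y =
      phase 1 (A ^ 2) (s y.1) •
        productLift A C ψ₁ ψ₂ (Circle.exp (s y.1), f₁ y.2.1, f₂ y.2.2) := by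
  rw [← append_phase hAC, twistedProduct, appendLeft_add_appendRight]
  rfl

/-- The immersion `(z, p, q) ↦ [(A z ψ₁(p), C ψ₂(q))]`. -/
def productImmersion (hAC : C ^ 2 = A ^ 2 + 1) (h₁ : ∀ p, hermE (ψ₁ p) (ψ₁ p) = 1)
    (h₂ : ∀ q, hermL (ψ₂ q) (ψ₂ q) = -1) (x : Circle × N₁ × N₂) :
    ComplexHyperbolic (n₁ + 1 + n₂) :=
  ComplexHyperbolic.mk (productLift A C ψ₁ ψ₂ x) (by rw [hermL_productLift hAC h₁ h₂]; simp)

lemma inAffine_productImmersion (hAC : C ^ 2 = A ^ 2 + 1) (h₁ : ∀ p, hermE (ψ₁ p) (ψ₁ p) = 1)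
    (h₂ : ∀ q, hermL (ψ₂ q) (ψ₂ q) = -1) (x : Circle × N₁ × N₂) :
    inAffine (productImmersion hAC h₁ h₂) x = affineProj (productLift A C ψ₁ ψ₂ x) :=
  mk_affine _ _

section Smooth

variable {E₁ E₂ H₁ H₂ : Type*} [NormedAddCommGroup E₁] [NormedSpace ℝ E₁] [NormedAddCommGroup E₂]
  [NormedSpace ℝ E₂] [TopologicalSpace H₁] [TopologicalSpace H₂] {I₁ : ModelWithCorners ℝ E₁ H₁}
  {I₂ : ModelWithCorners ℝ E₂ H₂} [TopologicalSpace N₁] [TopologicalSpace N₂]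
  [ChartedSpace H₁ N₁] [ChartedSpace H₂ N₂]

lemma contMDiff_productLift (hψ₁ : ContMDiff I₁ 𝓘(ℝ, Fin (n₁ + 1) → ℂ) ∞ ψ₁)
    (hψ₂ : ContMDiff I₂ 𝓘(ℝ, Fin (n₂ + 1) → ℂ) ∞ ψ₂) :
    ContMDiff ((𝓡 1).prod (I₁.prod I₂)) 𝓘(ℝ, Fin (n₁ + 1 + n₂ + 1) → ℂ) ∞
      (productLift A C ψ₁ ψ₂) := by
  have hz : ContMDiff ((𝓡 1).prod (I₁.prod I₂)) 𝓘(ℝ, ℂ) ∞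
      fun x : Circle × N₁ × N₂ => (A : ℂ) * (x.1 : ℂ) :=
    (contDiff_const.mul contDiff_id : ContDiff ℝ ∞ fun z : ℂ => (A : ℂ) * z).contMDiff.comp
      (contMDiff_circle_coe.comp contMDiff_fst)
  have h1 : ContMDiff ((𝓡 1).prod (I₁.prod I₂)) 𝓘(ℝ, Fin (n₁ + 1) → ℂ) ∞
      fun x : Circle × N₁ × N₂ => ((A : ℂ) * (x.1 : ℂ)) • ψ₁ x.2.1 :=
    (contDiff_fst.smul contDiff_snd :
      ContDiff ℝ ∞ fun y : ℂ × (Fin (n₁ + 1) → ℂ) => y.1 • y.2).contMDiff.comp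
      (hz.prodMk_space (hψ₁.comp (contMDiff_fst.comp contMDiff_snd)))
  have h2 : ContMDiff ((𝓡 1).prod (I₁.prod I₂)) 𝓘(ℝ, Fin (n₂ + 1) → ℂ) ∞
      fun x : Circle × N₁ × N₂ => (C : ℂ) • ψ₂ x.2.2 :=
    (contDiff_id.const_smul (C : ℂ) :
      ContDiff ℝ ∞ fun y : Fin (n₂ + 1) → ℂ => (C : ℂ) • y).contMDiff.comp
      (hψ₂.comp (contMDiff_snd.comp contMDiff_snd))
  have h3 := ((appendLeft (n₁ + 1) (n₂ + 1)).contMDiff.comp h1).add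
    ((appendRight (n₁ + 1) (n₂ + 1)).contMDiff.comp h2)
  exact h3.congr fun x => (appendLeft_add_appendRight _ _).symm

lemma contMDiff_productImmersion (hAC : C ^ 2 = A ^ 2 + 1)
    (h₁ : ∀ p, hermE (ψ₁ p) (ψ₁ p) = 1) (h₂ : ∀ q, hermL (ψ₂ q) (ψ₂ q) = -1)
    (hψ₁ : ContMDiff I₁ 𝓘(ℝ, Fin (n₁ + 1) → ℂ) ∞ ψ₁)
    (hψ₂ : ContMDiff I₂ 𝓘(ℝ, Fin (n₂ + 1) → ℂ) ∞ ψ₂) :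
    ContMDiff ((𝓡 1).prod (I₁.prod I₂)) 𝓘(ℝ, Fin (n₁ + 1 + n₂) → ℂ) ∞
      (inAffine (productImmersion hAC h₁ h₂)) := by
  have : inAffine (productImmersion hAC h₁ h₂) = affineProj ∘ productLift A C ψ₁ ψ₂ :=
    funext (inAffine_productImmersion hAC h₁ h₂)
  rw [this]
  intro x
  refine (contDiffAt_affineProj (last_ne_zero ?_)).contMDiffAt.comp x
    (contMDiff_productLift hψ₁ hψ₂ x)
  rw [hermL_productLift hAC h₁ h₂]
  simp

end Smooth

theorem isHMinimalLagrangian_productImmersion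
    [TopologicalSpace N₁] [ChartedSpace (EuclideanSpace ℝ (Fin n₁)) N₁] [IsManifold (𝓡 n₁) ∞ N₁]
    [TopologicalSpace N₂] [ChartedSpace (EuclideanSpace ℝ (Fin n₂)) N₂] [IsManifold (𝓡 n₂) ∞ N₂]
    (hA : 0 < A) (hC : 0 < C) (hAC : C ^ 2 = A ^ 2 + 1)
    (hψ₁ : IsCMinimalLegendrian (𝓡 n₁) hermE 1 ψ₁)
    (hψ₂ : IsCMinimalLegendrian (𝓡 n₂) hermL (-1) ψ₂)
    (h₁ : ∀ p, hermE (ψ₁ p) (ψ₁ p) = 1) (h₂ : ∀ q, hermL (ψ₂ q) (ψ₂ q) = -1) :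
    IsHMinimalLagrangian ((𝓡 1).prod ((𝓡 n₁).prod (𝓡 n₂))) (productImmersion hAC h₁ h₂) := by
  refine isHMinimalLagrangian_of_lift _ (contMDiff_productImmersion hAC h₁ h₂
    hψ₁.legendrian_immersion.smooth hψ₂.legendrian_immersion.smooth) ?_ ?_
  · simp; ring
  · rintro ⟨z₀, p, q⟩
    obtain ⟨s, U₀, hU₀, hz₀, hs, hexp⟩ := exists_isLineCoordinate_circle z₀
    have hB₁ := isHermitianRe_formE (n₁ + 1)
    have hB₂ := isHermitianRe_formL n₂
    have hpos : ∀ z Z : Fin (n₁ + 1) → ℂ, formE (n₁ + 1) z z = 1 → formE (n₁ + 1) Z z = 0 →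
        formE (n₁ + 1) Z (Complex.I • z) = 0 → Z ≠ 0 → 0 < formE (n₁ + 1) Z Z :=
      fun _ _ _ _ _ => formE_pos
    have hF₁ := hψ₁.legendrian_immersion.isLegendrianOn (𝓡 n₁) hB₁ hermE_re hpos p
    have hF₂ := hψ₂.legendrian_immersion.isLegendrianOn (𝓡 n₂) hB₂ hermL_re formL_pos q
    have hι := isOrthogonalSum_append (n₁ + 1) n₂
    have hY : extChartAt ((𝓡 1).prod ((𝓡 n₁).prod (𝓡 n₂))) (z₀, p, q) (z₀, p, q) ∈
        U₀ ×ˢ (extChartAt (𝓡 n₁) p).target ×ˢ (extChartAt (𝓡 n₂) q).target := by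
      rw [extChartAt_prod, extChartAt_prod]
      exact ⟨hz₀, mem_extChartAt_target p, mem_extChartAt_target q⟩
    refine ⟨_, twistedProduct (appendLeft (n₁ + 1) (n₂ + 1)) (appendRight (n₁ + 1) (n₂ + 1)) A C s
      (ψ₁ ∘ (extChartAt (𝓡 n₁) p).symm) (ψ₂ ∘ (extChartAt (𝓡 n₂) q).symm), ?_, hY,
      isLegendrianOn_twistedProduct hι hB₁ hB₂ hA hC hAC hs hF₁ hF₂, ?_, ?_⟩
    · rw [extChartAt_prod, extChartAt_prod]
      exact Set.prod_mono hU₀ subset_rfl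
    · rintro ⟨t, x, y⟩ ⟨ht, -, -⟩
      -- The Legendrian lift and `productLift` differ by a nonzero scalar, which affine coordinates
      -- do not see.
      rw [inAffine_productImmersion, twistedProduct_append hAC,
        affineProj_smul (phase_one_ne_zero _ _), hexp t ht, extChartAt_prod, extChartAt_prod]
      rfl
    · refine maslovDiv_twistedProduct hι hB₁ hB₂ hA hC hAC hs hF₁ hF₂ hY ?_ ?_
      · rw [extChartAt_prod, extChartAt_prod]
        exact hψ₁.maslovDiv_eq_zero (𝓡 n₁) hB₁ (by norm_num) hermE_re hpos p
      · rw [extChartAt_prod, extChartAt_prod]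
        exact hψ₂.maslovDiv_eq_zero (𝓡 n₂) hB₂ (by norm_num) hermL_re formL_pos q

end Construction

theorem corollary8 (n₁ n₂ : ℕ)
    {N₁ : Type*} [TopologicalSpace N₁] [ChartedSpace (EuclideanSpace ℝ (Fin n₁)) N₁]
    [IsManifold (𝓡 n₁) ∞ N₁]
    {N₂ : Type*} [TopologicalSpace N₂] [ChartedSpace (EuclideanSpace ℝ (Fin n₂)) N₂]
    [IsManifold (𝓡 n₂) ∞ N₂]
    (ψ₁ : N₁ → Fin (n₁ + 1) → ℂ) (ψ₂ : N₂ → Fin (n₂ + 1) → ℂ)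
    (hψ₁ : IsCMinimalLegendrian (𝓡 n₁) hermE 1 ψ₁)
    (hψ₂ : IsCMinimalLegendrian (𝓡 n₂) hermL (-1) ψ₂)
    (ρ : ℝ) (hρ : 0 < ρ) :
    ∃ Φ : Circle × N₁ × N₂ → ComplexHyperbolic (n₁ + 1 + n₂),
      (∀ (s : ℝ) (p : N₁) (q : N₂),
        ∃ hmem : Fin.append
            (((Real.sinh ρ : ℂ) *
              Complex.exp (Complex.I * (s : ℂ) * ((Real.cosh ρ ^ 2 : ℝ) : ℂ))) • ψ₁ p)
            (((Real.cosh ρ : ℂ) *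
              Complex.exp (Complex.I * (s : ℂ) * ((Real.sinh ρ ^ 2 : ℝ) : ℂ))) • ψ₂ q)
            ∈ AntiDeSitter (n₁ + 1 + n₂),
          Φ (Circle.exp s, p, q) = ComplexHyperbolic.hopf ⟨_, hmem⟩) ∧
      IsHMinimalLagrangian ((𝓡 1).prod ((𝓡 n₁).prod (𝓡 n₂))) Φ := by
  have hA : 0 < Real.sinh ρ := Real.sinh_pos_iff.2 hρ
  have hC : 0 < Real.cosh ρ := Real.cosh_pos ρ
  -- Positivity and this relation are all that the construction uses about the constants; ρ > 0
  -- enters only through sinh ρ > 0.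
  have hAC := Real.cosh_sq ρ
  have h₁ : ∀ p, hermE (ψ₁ p) (ψ₁ p) = 1 := fun p => by
    simpa using hψ₁.legendrian_immersion.mem p
  have h₂ : ∀ q, hermL (ψ₂ q) (ψ₂ q) = -1 := fun q => by
    simpa using hψ₂.legendrian_immersion.mem q
  refine ⟨productImmersion hAC h₁ h₂, fun s p q => ?_,
    isHMinimalLagrangian_productImmersion hA hC hAC hψ₁ hψ₂ h₁ h₂⟩
  have hphase : ∀ c a : ℝ, (c : ℂ) * Complex.exp (Complex.I * (s : ℂ) * (a : ℂ)) = phase c a s :=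
    fun c a => by rw [phase, mul_assoc, mul_comm (s : ℂ)]
  simp only [hphase]
  refine ⟨hermL_append_smul (normSq_phase _ _ _) (normSq_phase _ _ _) hAC (h₁ p) (h₂ q), ?_⟩
  exact (ComplexHyperbolic.mk_smul _ _ _ (append_phase hAC s p q).symm).symm
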